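/- Let $1<p<\infty$, $p^*=p/(p-1)$, let $1\le i<m$ be integers, and let $T_*\in(0,1)$ with $T_*\neq i/m$. For a real potential $q\in L^p(0,1)$ let $\lambda_1(q)<\lambda_2(q)<\cdots$ be the eigenvalues of $-y''+q(x)y=\lambda y$ on $(0,1)$, $y(0)=y(1)=0$, let $E_m(\cdot;q)$ be an eigenfunction for $\lambda_m(q)$, and let $T_{i,m}(q)$ be the $i$-th zero of $E_m(\cdot;q)$ in $(0,1)$. Let $\hat q\in L^p(0,1)$ be any minimizer of $\|q\|_{L^p}$ among the $q\in L^p(0,1)$ with $T_{i,m}(q)=T_*$ (target potential $q_0=0$). Put $\varepsilon=-1$ if $T_*<i/m$ and $\varepsilon=+1$ if $T_*>i/m$. Let $I_\varepsilon=(0,1)$ if $\varepsilon=1$ and $I_\varepsilon=(0,\infty)$ if $\varepsilon=-1$. For $\alpha\in I_\varepsilon$ and $\beta\in I_{-\varepsilon}$ put $$\underline D(\alpha,t)=1-t^2-\varepsilon\tfrac{\alpha}{p^*}(1-t^{2p^*}),\qquad \overline D(\beta,t)=1-t^2+\varepsilon\tfrac{\beta}{p^*}(1-t^{2p^*}),$$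 $$\underline{\mathbf T}_p(\alpha)=\int_0^1\frac{dt}{\sqrt{\underline D(\alpha,t)}},\quad \underline{\mathbf V}_p(\alpha)=\alpha^{p-1}\int_0^1\frac{t^2\,dt}{\sqrt{\underline D(\alpha,t)}},\quad \underline{\mathbf U}_p(\alpha)=\int_0^1\frac{t^{2p^*}dt}{\sqrt{\underline D(\alpha,t)}},$$ and define $\overline{\mathbf T}_p(\beta),\overline{\mathbf V}_p(\beta),\overline{\mathbf U}_p(\beta)$ in the same way with $\beta$ and $\overline D$ in place of $\alpha$ and $\underline D$. These integrals converge, and $\underline{\mathbf T}_p$ and $\overline{\mathbf T}_p$ are injective on $I_\varepsilon$ and $I_{-\varepsilon}$ respectively. Then, with $\lambda_m=\lambda_m(\hat q)$, there are an eigenfunction $E$ for $\lambda_m$, constants $A,B>0$, and a function $u_m$ with $u_m=AE$ on $[0,T_*]$ and $u_m=BE$ on $(T_*,1]$, such that almost everywhere $\hat q=\varepsilon|u_m|^{2p^*-2}$ on $[0,T_*]$ and $\hat q=-\varepsilon|u_m|^{2p^*-2}$ on $(T_*,1]$. Moreover $\lambda_m>0$, and the parameters $$\alpha_m=\frac{\bigl(\max_{[0,T_*]}|u_m|\bigr)^{2p^*-2}}{\lambda_m}\in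 I_\varepsilon,\qquad \beta_m=\frac{\bigl(\max_{[T_*,1]}|u_m|\bigr)^{2p^*-2}}{\lambda_m}\in I_{-\varepsilon}$$ satisfy $$\alpha_m=\underline{\mathbf T}_p^{-1}\!\left(\frac{\sqrt{\lambda_m}\,T_*}{2i}\right),\qquad \beta_m=\overline{\mathbf T}_p^{-1}\!\left(\frac{\sqrt{\lambda_m}(1-T_*)}{2(m-i)}\right),\qquad i\,\underline{\mathbf V}_p(\alpha_m)=(m-i)\,\overline{\mathbf V}_p(\beta_m)$$ (where the arguments of the inverse functions lie in the ranges $\underline{\mathbf T}_p(I_\varepsilon)$ and $\overline{\mathbf T}_p(I_{-\varepsilon})$), and $$\|\hat q\|_{L^p}^p=\frac{2i(\lambda_m\alpha_m)^{(p-1)p^*}}{\sqrt{\lambda_m}}\,\underline{\mathbf U}_p(\alpha_m)+\frac{2(m-i)(\lambda_m\beta_m)^{(p-1)p^*}}{\sqrt{\lambda_m}}\,\overline{\mathbf U}_p(\beta_m).$$ The optimal potential is determined by the three parameters: two minimizers with the same $(\alpha_m,\beta_m,\lambda_m)$ coincide almost everywhere. -/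

import Mathlib

open MeasureTheory Set

noncomputable section

namespace InverseNodal

/-- The space of real potentials `L^p(0,1)` (elements are classes of functions on `[0,1]`). -/
abbrev Potential (p : ℝ) : Type :=
  Lp ℝ (ENNReal.ofReal p) (volume.restrict (Icc (0 : ℝ) 1))

/-- `y` solves `-y'' + q y = lam y` on `[0,1]` in the Carathéodory sense: `y` is `C¹` with
absolutely continuous derivative `z`, and `z' = (q - lam) y` almost everywhere, written in
integrated form. -/
def IsSolution (q : ℝ → ℝ) (lam : ℝ) (y : ℝ → ℝ) : Prop :=
  ∃ z : ℝ → ℝ,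
    (∀ x ∈ Icc (0 : ℝ) 1, HasDerivWithinAt y (z x) (Icc (0 : ℝ) 1) x) ∧
    ∀ x ∈ Icc (0 : ℝ) 1, z x = z 0 + ∫ t in (0 : ℝ)..x, (q t - lam) * y t

/-- `E` is an eigenfunction, for the value `lam`, of `-y'' + q y` with Dirichlet conditions
`y(0) = y(1) = 0`. -/
def IsEigenfunction (q : ℝ → ℝ) (lam : ℝ) (E : ℝ → ℝ) : Prop :=
  IsSolution q lam E ∧ E 0 = 0 ∧ E 1 = 0 ∧ ∃ x ∈ Icc (0 : ℝ) 1, E x ≠ 0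

/-- `lam` is a Dirichlet eigenvalue of `-y'' + q y`. -/
def IsEigenvalue (q : ℝ → ℝ) (lam : ℝ) : Prop :=
  ∃ E : ℝ → ℝ, IsEigenfunction q lam E

/-- `lam = λ_m(q)`: the `m`-th Dirichlet eigenvalue in increasing order, `m = 1, 2, …`; that is,
exactly `m - 1` eigenvalues are smaller. -/
def IsNthEigenvalue (m : ℕ) (q : ℝ → ℝ) (lam : ℝ) : Prop :=
  IsEigenvalue q lam ∧ {mu : ℝ | mu < lam ∧ IsEigenvalue q mu}.encard + 1 = (m : ℕ∞)

/-- `T = T_{i,m}(q)`: the `i`-th zero (counted from the left, `i = 1, 2, …`) in the open interval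
`(0,1)` of an eigenfunction for the `m`-th eigenvalue. -/
def IsNode (i m : ℕ) (q : ℝ → ℝ) (T : ℝ) : Prop :=
  ∃ (lam : ℝ) (E : ℝ → ℝ), IsNthEigenvalue m q lam ∧ IsEigenfunction q lam E ∧
    T ∈ Ioo (0 : ℝ) 1 ∧ E T = 0 ∧ {x : ℝ | x ∈ Ioo 0 T ∧ E x = 0}.encard + 1 = (i : ℕ∞)

/-- `q` solves Problem (P) with target `q₀`: among all potentials in `L^p` whose `(i,m)`-th node
is `T`, it minimizes the `L^p` distance to `q₀`. -/
def IsOptimal (p : ℝ) (i m : ℕ) (T : ℝ) (q₀ q : Potential p) : Prop :=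
  IsNode i m q T ∧ ∀ r : Potential p, IsNode i m r T → ‖q - q₀‖ ≤ ‖r - q₀‖

/-- The sign `ε`: `-1` if `T < i/m`, and `+1` if `T > i/m`. -/
def nodeSign (i m : ℕ) (T : ℝ) : ℝ :=
  if T < (i : ℝ) / m then -1 else 1

/-- `1 - t² - σ (a / p*) (1 - t^{2p*})` with `p* = p / (p - 1)`. -/
def radicand (p σ a t : ℝ) : ℝ :=
  1 - t ^ 2 - σ * (a / p.conjExponent) * (1 - t ^ (2 * p.conjExponent))

/-- `T̲_p` (for the sign `ε`). -/
def lowerT (p ε α : ℝ) : ℝ :=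
  ∫ t in (0 : ℝ)..1, 1 / √(radicand p ε α t)

/-- `T̄_p` (for the sign `ε`). -/
def upperT (p ε β : ℝ) : ℝ :=
  ∫ t in (0 : ℝ)..1, 1 / √(radicand p (-ε) β t)

/-- `V̲_p` (for the sign `ε`). -/
def lowerV (p ε α : ℝ) : ℝ :=
  α ^ (p - 1) * ∫ t in (0 : ℝ)..1, t ^ 2 / √(radicand p ε α t)

/-- `V̄_p` (for the sign `ε`). -/
def upperV (p ε β : ℝ) : ℝ :=
  β ^ (p - 1) * ∫ t in (0 : ℝ)..1, t ^ 2 / √(radicand p (-ε) β t)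

/-- `U̲_p` (for the sign `ε`). -/
def lowerU (p ε α : ℝ) : ℝ :=
  ∫ t in (0 : ℝ)..1, t ^ (2 * p.conjExponent) / √(radicand p ε α t)

/-- `Ū_p` (for the sign `ε`). -/
def upperU (p ε β : ℝ) : ℝ :=
  ∫ t in (0 : ℝ)..1, t ^ (2 * p.conjExponent) / √(radicand p (-ε) β t)

/-- The range of `α`: `(0,1)` if `ε = 1`, and `(0,∞)` if `ε = -1`. -/
def lowerDomain (ε : ℝ) : Set ℝ := {α | 0 < α ∧ (ε = 1 → α < 1)}

/-- The range of `β`: `(0,1)` if `ε = -1`, and `(0,∞)` if `ε = 1`. -/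
def upperDomain (ε : ℝ) : Set ℝ := {β | 0 < β ∧ (ε = -1 → β < 1)}

/-- The inverse function of `T̲_p` on its domain. -/
def lowerTInv (p ε : ℝ) : ℝ → ℝ := Function.invFunOn (lowerT p ε) (lowerDomain ε)

/-- The inverse function of `T̄_p` on its domain. -/
def upperTInv (p ε : ℝ) : ℝ → ℝ := Function.invFunOn (upperT p ε) (upperDomain ε)

/-- `α, β, lam` are the characteristic parameters `α_m, β_m, λ_m` of the potential `q`:
`lam = λ_m(q)`, and there is a piecewise rescaling `u` of an eigenfunction `E` for `lam` with
`q = ε |u|^{2p*-2}` on `[0,T]` and `q = -ε |u|^{2p*-2}` on `(T,1]`, such that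
`α = h^{2p*-2} / lam` and `β = k^{2p*-2} / lam`, where `h` and `k` are the maxima of `|u|` on
`[0,T]` and on `[T,1]`. -/
def IsCharacteristicTriple (p : ℝ) (i m : ℕ) (T : ℝ) (q : Potential p) (α β lam : ℝ) : Prop :=
  IsNthEigenvalue m q lam ∧
  ∃ (E u : ℝ → ℝ) (A B h k : ℝ),
    IsEigenfunction q lam E ∧ 0 < A ∧ 0 < B ∧
    (∀ x ∈ Icc 0 T, u x = A * E x) ∧ (∀ x ∈ Ioc T 1, u x = B * E x) ∧
    (∀ᵐ x ∂(volume.restrict (Icc (0 : ℝ) 1)),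
      q x = (if x ≤ T then nodeSign i m T else -nodeSign i m T) *
        |u x| ^ (2 * p.conjExponent - 2)) ∧
    IsGreatest ((fun x => |u x|) '' Icc 0 T) h ∧
    IsGreatest ((fun x => |u x|) '' Icc T 1) k ∧
    α = h ^ (2 * p.conjExponent - 2) / lam ∧
    β = k ^ (2 * p.conjExponent - 2) / lam

end InverseNodal

end

open InverseNodal

noncomputable section

namespace InverseNodal

open Filter Topology

/-! In Prüfer coordinates y = ρ sin θ, y' = ρ cos θ, the equation y'' = Qy with Q = q - λ becomes θ'
= 1 - (Q + 1) sin² θ. For integrable q the solution y with y(0) = 0 is then governed by θ alone: λ =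
λ_m(q) means θ(1) = mπ, and T is the i-th node when moreover θ(T) = iπ (`isNthEigenvalue_iff`,
`isNode_iff`). The constraint of the minimization is thus that two values of θ are prescribed, with
λ free.

Optimality. The derivative of θ(b) in the direction w is a negative multiple of ∫₀ᵇ w y². A bounded
direction v supported on one side of T with ∫ v y² = 0 can be corrected by a small constant on its
support so that the node stays exactly in place (`IsPrufer.exists_perturbation`). Minimality of the
norm then makes |q|^(p-2) q orthogonal to every such v, so it equals k₁y² on [0,T] and k₂y² on
[T,1]. Adding a constant to q merely shifts λ, which forces ∫ |q|^(p-2) q = 0, that is k₁∫₀ᵀ y² +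
k₂∫_T¹ y² = 0 (`IsOptimal.exists_multiplier`). Hence k₁ and k₂ have opposite signs or both vanish, q
= κ|u|^(2p*-2) with κ = ±1 on each piece for a rescaling u of y, and ∫ u² is the same on both
pieces.

Quadrature. On each piece u'' = (κ|u|^(2p*-2) - λ)u is autonomous and conserves u'² + λu² -
(κ/p*)|u|^(2p*). Between consecutive zeros of u and u' the substitution s = |u| turns ∫ F(|u|) into
an integral over [0,1] with weight 1/√D; n half oscillations give 2n equal copies
(`IsTrajectory.integral_comp_abs`, `IsPrufer.exists_amplitude`). The choices F = 1, s², |s|^(2p*)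
produce T, V and U, hence the three equations and the norm formula.

Sign and uniqueness. The travel time grows strictly with κα, so the piece with κ = 1 oscillates more
slowly and the sign of k₁ decides the side of i/m on which T lies; k₁ = k₂ = 0 would give T = i/m
(`IsOptimal.exists_profile`). At the maximum of |u| one has κh^(2p*-2) < λ, so λ > 0 from the piece
with κ = 1. Finally α, β, λ fix the two amplitudes, hence the energies, hence the initial slopes up
to sign, and ODE uniqueness fixes |u| (`IsCharacteristicTriple.unique`). -/

/-- `f` is absolutely continuous on `[a,b]` and `g` is its derivative almost everywhere. -/
structure HasAEDeriv (f g : ℝ → ℝ) (a b : ℝ) : Prop where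
  le : a ≤ b
  ac : AbsolutelyContinuousOnInterval f a b
  deriv : ∀ᵐ x, x ∈ Ioo a b → HasDerivAt f (g x) x

theorem ae_ne_and_ne (a b : ℝ) : ∀ᵐ x : ℝ, x ≠ a ∧ x ≠ b := by
  have h1 : ∀ᵐ x : ℝ, x ≠ a := by simp [ae_iff, measure_singleton]
  have h2 : ∀ᵐ x : ℝ, x ≠ b := by simp [ae_iff, measure_singleton]
  exact h1.and h2

/-- A property that holds a.e. on an open interval holds a.e. on the half-open one. -/
theorem ae_Ioc_of_ae_Ioo {a b : ℝ} {P : ℝ → Prop} (h : ∀ᵐ x, x ∈ Ioo a b → P x) :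
    ∀ᵐ x, x ∈ Ioc a b → P x := by
  filter_upwards [h, ae_ne_and_ne a b] with x hx hne hm
  exact hx ⟨hm.1, lt_of_le_of_ne hm.2 hne.2⟩

/-! ### Calculus of absolutely continuous functions. -/

namespace HasAEDeriv

variable {f f₁ f₂ g g₁ g₂ : ℝ → ℝ} {a b c d : ℝ}

theorem continuousOn (h : HasAEDeriv f g a b) : ContinuousOn f (Icc a b) := by
  have := h.ac.continuousOn
  rwa [uIcc_of_le h.le] at this

theorem ae_deriv_eq (h : HasAEDeriv f g a b) :
    ∀ᵐ x, x ∈ uIoc a b → _root_.deriv f x = g x := by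
  rw [uIoc_of_le h.le]
  apply ae_Ioc_of_ae_Ioo
  filter_upwards [h.deriv] with x hx hm
  exact (hx hm).deriv

theorem intervalIntegrable (h : HasAEDeriv f g a b) : IntervalIntegrable g volume a b := by
  refine h.ac.intervalIntegrable_deriv.congr_ae ?_
  rw [Filter.EventuallyEq, ae_restrict_iff' measurableSet_uIoc]
  exact h.ae_deriv_eq

theorem mono (h : HasAEDeriv f g a b) (hc : a ≤ c) (hcd : c ≤ d) (hd : d ≤ b) :
    HasAEDeriv f g c d := by
  refine ⟨hcd, h.ac.mono ?_, ?_⟩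
  · rw [uIcc_of_le hcd, uIcc_of_le h.le]
    exact Icc_subset_Icc hc hd
  · filter_upwards [h.deriv] with x hx hm
    exact hx (Ioo_subset_Ioo hc hd hm)

theorem integral_eq_sub (h : HasAEDeriv f g a b) : ∫ t in a..b, g t = f b - f a := by
  rw [← h.ac.integral_deriv_eq_sub]
  symm
  exact intervalIntegral.integral_congr_ae h.ae_deriv_eq

theorem eq_add_integral (h : HasAEDeriv f g a b) {x : ℝ} (hx : x ∈ Icc a b) :
    f x = f a + ∫ t in a..x, g t := by
  rw [(h.mono le_rfl hx.1 hx.2).integral_eq_sub]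
  ring

theorem ac_congr (h : AbsolutelyContinuousOnInterval f₁ a b) (e : EqOn f₂ f₁ (uIcc a b)) :
    AbsolutelyContinuousOnInterval f₂ a b := by
  rw [absolutelyContinuousOnInterval_iff] at h ⊢
  intro ε hε
  obtain ⟨δ, hδ, H⟩ := h ε hε
  refine ⟨δ, hδ, fun E hE hs => ?_⟩
  convert H E hE hs using 2 with i hi
  rw [e (hE.1 i hi).1, e (hE.1 i hi).2]

theorem of_eq_add_integral (hab : a ≤ b) (hg : IntervalIntegrable g volume a b)
    (h : ∀ x ∈ Icc a b, f x = f a + ∫ t in a..x, g t) : HasAEDeriv f g a b := by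
  refine ⟨hab, ?_, ?_⟩
  · have h0 := hg.absolutelyContinuousOnInterval_intervalIntegral (c := a) left_mem_uIcc
    have hc : AbsolutelyContinuousOnInterval (fun _ : ℝ => f a) a b :=
      (LipschitzWith.const (f a)).lipschitzOnWith.absolutelyContinuousOnInterval (K := 0)
    refine ac_congr (hc.add h0) ?_
    rw [uIcc_of_le hab]
    intro x hx
    exact h x hx
  · filter_upwards [hg.ae_hasDerivAt_integral] with x hx hm
    have hm' : x ∈ uIcc a b := by rw [uIcc_of_le hab]; exact Ioo_subset_Icc_self hm
    refine ((hx hm' a left_mem_uIcc).const_add (f a)).congr_of_eventuallyEq ?_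
    filter_upwards [isOpen_Ioo.mem_nhds hm] with y hy
    exact h y (Ioo_subset_Icc_self hy)

theorem congr_deriv (h : HasAEDeriv f g₁ a b) (e : ∀ᵐ x, x ∈ Ioo a b → g₁ x = g₂ x) :
    HasAEDeriv f g₂ a b := by
  refine ⟨h.le, h.ac, ?_⟩
  filter_upwards [h.deriv, e] with x hx he hm
  rw [← he hm]
  exact hx hm

theorem congr_fun (h : HasAEDeriv f₁ g a b) (e : EqOn f₂ f₁ (Icc a b)) :
    HasAEDeriv f₂ g a b := by
  refine ⟨h.le, ac_congr h.ac (by rwa [uIcc_of_le h.le]), ?_⟩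
  filter_upwards [h.deriv] with x hx hm
  refine (hx hm).congr_of_eventuallyEq ?_
  filter_upwards [isOpen_Ioo.mem_nhds hm] with y hy
  exact e (Ioo_subset_Icc_self hy)

theorem add (h₁ : HasAEDeriv f₁ g₁ a b) (h₂ : HasAEDeriv f₂ g₂ a b) :
    HasAEDeriv (fun x => f₁ x + f₂ x) (fun x => g₁ x + g₂ x) a b := by
  refine ⟨h₁.le, h₁.ac.add h₂.ac, ?_⟩
  filter_upwards [h₁.deriv, h₂.deriv] with x k₁ k₂ hm
  exact (k₁ hm).add (k₂ hm)

theorem sub (h₁ : HasAEDeriv f₁ g₁ a b) (h₂ : HasAEDeriv f₂ g₂ a b) :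
    HasAEDeriv (fun x => f₁ x - f₂ x) (fun x => g₁ x - g₂ x) a b := by
  refine ⟨h₁.le, h₁.ac.sub h₂.ac, ?_⟩
  filter_upwards [h₁.deriv, h₂.deriv] with x k₁ k₂ hm
  exact (k₁ hm).sub (k₂ hm)

theorem const_mul (k : ℝ) (h : HasAEDeriv f g a b) :
    HasAEDeriv (fun x => k * f x) (fun x => k * g x) a b := by
  refine ⟨h.le, h.ac.const_mul k, ?_⟩
  filter_upwards [h.deriv] with x hx hm
  exact (hx hm).const_mul k

theorem mul (h₁ : HasAEDeriv f₁ g₁ a b) (h₂ : HasAEDeriv f₂ g₂ a b) :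
    HasAEDeriv (fun x => f₁ x * f₂ x) (fun x => g₁ x * f₂ x + f₁ x * g₂ x) a b := by
  refine ⟨h₁.le, h₁.ac.mul h₂.ac, ?_⟩
  filter_upwards [h₁.deriv, h₂.deriv] with x k₁ k₂ hm
  exact (k₁ hm).mul (k₂ hm)

/-- An absolutely continuous f has bounded range, on which F with continuous derivative is
Lipschitz; a Lipschitz function of an absolutely continuous one is absolutely continuous. -/
theorem comp {F F' : ℝ → ℝ} (hF : ∀ y, HasDerivAt F (F' y) y) (hF' : Continuous F')
    (h : HasAEDeriv f g a b) :
    HasAEDeriv (fun x => F (f x)) (fun x => F' (f x) * g x) a b := by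
  refine ⟨h.le, ?_, ?_⟩
  · obtain ⟨C, hC⟩ := h.ac.exists_bound
    obtain ⟨K, hK⟩ := (isCompact_Icc (a := -C) (b := C)).exists_bound_of_continuousOn
      hF'.continuousOn
    have hK' : ∀ y ∈ Icc (-C) C, |F' y| ≤ |K| + 1 := fun y hy =>
      (hK y hy).trans ((le_abs_self K).trans (by linarith))
    have hlip : ∀ y ∈ Icc (-C) C, ∀ z ∈ Icc (-C) C, dist (F y) (F z) ≤ (|K| + 1) * dist y z := by
      intro y hy z hz
      exact (convex_Icc (-C) C).norm_image_sub_le_of_norm_hasDerivWithin_le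
        (fun t _ => (hF t).hasDerivWithinAt) hK' hz hy
    have hac := h.ac
    rw [absolutelyContinuousOnInterval_iff] at hac ⊢
    intro ε hε
    have hpos : 0 < |K| + 1 := by positivity
    obtain ⟨δ, hδ, H⟩ := hac (ε / (|K| + 1)) (by positivity)
    refine ⟨δ, hδ, fun E hE hs => ?_⟩
    have h1 := H E hE hs
    rw [lt_div_iff₀' hpos, Finset.mul_sum] at h1
    refine lt_of_le_of_lt (Finset.sum_le_sum fun i hi => ?_) h1
    exact hlip _ (abs_le.1 (hC _ (hE.1 i hi).1)) _ (abs_le.1 (hC _ (hE.1 i hi).2))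
  · filter_upwards [h.deriv] with x hx hm
    exact (hF (f x)).comp x (hx hm)

theorem of_hasDerivWithinAt (hab : a ≤ b) (h : ∀ x ∈ Icc a b, HasDerivWithinAt f (g x) (Icc a b) x)
    (hg : ContinuousOn g (Icc a b)) : HasAEDeriv f g a b := by
  refine of_eq_add_integral hab (hg.intervalIntegrable_of_Icc hab) fun x hx => ?_
  have hsub : Icc a x ⊆ Icc a b := Icc_subset_Icc_right hx.2
  rw [intervalIntegral.integral_eq_sub_of_hasDerivAt_of_le hx.1
    (fun y hy => (h y (hsub hy)).continuousWithinAt.mono hsub)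
    (fun y hy => (h y (hsub (Ioo_subset_Icc_self hy))).hasDerivAt
      (Icc_mem_nhds hy.1 (hy.2.trans_le hx.2)))
    ((hg.mono hsub).intervalIntegrable_of_Icc hx.1)]
  ring

/-- An absolutely continuous function whose derivative agrees a.e. with a continuous function is
continuously differentiable. -/
theorem hasDerivWithinAt (h : HasAEDeriv f g a b) (hg : ContinuousOn g (Icc a b)) {x : ℝ}
    (hx : x ∈ Icc a b) : HasDerivWithinAt f (g x) (Icc a b) x := by
  have hab := h.le
  -- A continuous extension of g beyond the endpoints lets the two-sided fundamental theorem of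
  -- calculus apply at every point of the closed interval.
  let G : ℝ → ℝ := IccExtend hab ((Icc a b).domRestrict g)
  have hG : Continuous G := (continuousOn_iff_continuous_domRestrict.1 hg).Icc_extend'
  have hGe : ∀ t ∈ Icc a b, G t = g t := fun t ht => by
    simp [G, IccExtend_of_mem hab _ ht, Set.domRestrict]
  have h1 : HasDerivAt (fun u => f a + ∫ t in a..u, G t) (G x) x :=
    (intervalIntegral.integral_hasDerivAt_right (hG.intervalIntegrable _ _)
      (hG.stronglyMeasurableAtFilter _ _) hG.continuousAt).const_add _
  rw [← hGe x hx]
  have key : ∀ u ∈ Icc a b, f u = f a + ∫ t in a..u, G t := fun u hu => by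
    rw [h.eq_add_integral hu]
    congr 1
    refine intervalIntegral.integral_congr fun t ht => ?_
    rw [uIcc_of_le hu.1] at ht
    exact (hGe t ⟨ht.1, ht.2.trans hu.2⟩).symm
  exact h1.hasDerivWithinAt.congr key (key x hx)

end HasAEDeriv

/-! ### Scalar linear equations with integrable coefficients. -/

theorem hasAEDeriv_integral {a b : ℝ} {g : ℝ → ℝ} (hab : a ≤ b)
    (hg : IntervalIntegrable g volume a b) :
    HasAEDeriv (fun x => ∫ t in a..x, g t) g a b :=
  .of_eq_add_integral hab hg fun x _ => by simp

/-- Variation of constants for a scalar linear equation with integrable coefficients. -/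
theorem HasAEDeriv.linear {w α β : ℝ → ℝ} {a b : ℝ}
    (hα : IntervalIntegrable α volume a b)
    (h : HasAEDeriv w (fun x => α x * w x + β x) a b) {x : ℝ} (hx : x ∈ Icc a b) :
    w x = Real.exp (∫ t in a..x, α t) *
      (w a + ∫ t in a..x, Real.exp (-∫ s in a..t, α s) * β t) := by
  have hA := (hasAEDeriv_integral h.le hα).const_mul (-1)
  have hE := hA.comp Real.hasDerivAt_exp Real.continuous_exp
  have hP := (hE.mul h).congr_deriv (g₂ := fun x => Real.exp (-∫ s in a..x, α s) * β x)
    (Eventually.of_forall fun x _ => by simp only [neg_one_mul]; ring)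
  have := hP.eq_add_integral hx
  simp only [neg_one_mul, intervalIntegral.integral_same, neg_zero, Real.exp_zero, one_mul] at this
  rw [← this, ← mul_assoc, ← Real.exp_add]
  simp

/-- A homogeneous linear equation has only the zero solution with zero initial value. -/
theorem HasAEDeriv.eq_zero {w α : ℝ → ℝ} {a b : ℝ}
    (hα : IntervalIntegrable α volume a b)
    (h : HasAEDeriv w (fun x => α x * w x) a b) (h0 : w a = 0) {x : ℝ} (hx : x ∈ Icc a b) :
    w x = 0 := by
  have := HasAEDeriv.linear (β := fun _ => 0) hα
    (h.congr_deriv (Eventually.of_forall fun x _ => by simp)) hx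
  simpa [h0] using this

/-! ### The Prüfer equation. -/

theorem sin_sq_sub_sin_sq (a b : ℝ) :
    Real.sin a ^ 2 - Real.sin b ^ 2 = Real.sin (a - b) * Real.sin (a + b) := by
  rw [Real.sin_sub, Real.sin_add]
  have h1 := Real.sin_sq_add_cos_sq a
  have h2 := Real.sin_sq_add_cos_sq b
  linear_combination (Real.sin b ^ 2) * h1 - (Real.sin a ^ 2) * h2

theorem abs_sin_sq_sub_le (a b : ℝ) :
    |Real.sin a ^ 2 - Real.sin b ^ 2| ≤ |a - b| := by
  rw [sin_sq_sub_sin_sq, abs_mul]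
  calc _ ≤ |a - b| * 1 := mul_le_mul Real.abs_sin_le_abs (Real.abs_sin_le_one _) (abs_nonneg _)
        (abs_nonneg _)
    _ = _ := mul_one _

/-- `θ` is the Prüfer angle of the equation `y'' = Q y` with `θ(0) = 0`. -/
structure IsPrufer (Q θ : ℝ → ℝ) : Prop where
  hasAEDeriv : HasAEDeriv θ (fun x => 1 - (Q x + 1) * Real.sin (θ x) ^ 2) 0 1
  zero : θ 0 = 0

theorem intervalIntegrable_mul_of_continuousOn {Q s : ℝ → ℝ} {a b : ℝ} (hab : a ≤ b)
    (hQ : IntervalIntegrable Q volume a b) (hs : ContinuousOn s (Icc a b)) :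
    IntervalIntegrable (fun x => Q x * s x) volume a b :=
  hQ.mul_continuousOn (by rwa [uIcc_of_le hab])

theorem IntervalIntegrable.mono_Icc {g : ℝ → ℝ} {a b c d : ℝ}
    (h : IntervalIntegrable g volume a b) (hc : a ≤ c) (hcd : c ≤ d) (hd : d ≤ b) :
    IntervalIntegrable g volume c d := by
  refine h.mono_set ?_
  rw [uIcc_of_le hcd, uIcc_of_le (hc.trans (hcd.trans hd))]
  exact Icc_subset_Icc hc hd

/-- The weighted integral operator whose fixed point is the Prüfer angle. -/
def pruferMap (Q : ℝ → ℝ) (φ : ℝ → ℝ) (x : ℝ) : ℝ :=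
  Real.exp (-2 * ∫ s in (0 : ℝ)..x, (|Q s| + 1)) * ∫ t in (0 : ℝ)..x,
    (1 - (Q t + 1) * Real.sin (Real.exp (2 * ∫ s in (0 : ℝ)..t, (|Q s| + 1)) * φ t) ^ 2)

/-! ### Existence of the Prüfer angle by a contraction. -/

section Existence

variable {Q : ℝ → ℝ} (hQ : IntervalIntegrable Q volume 0 1)
include hQ

theorem hasAEDeriv_weight :
    HasAEDeriv (fun x => ∫ s in (0 : ℝ)..x, (|Q s| + 1)) (fun x => |Q x| + 1) 0 1 :=
  hasAEDeriv_integral zero_le_one (hQ.abs.add intervalIntegrable_const)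

theorem pruferMap_integrable {φ : ℝ → ℝ} (hφ : ContinuousOn φ (Icc 0 1)) :
    IntervalIntegrable (fun t => 1 - (Q t + 1) *
      Real.sin (Real.exp (2 * ∫ s in (0 : ℝ)..t, (|Q s| + 1)) * φ t) ^ 2) volume 0 1 := by
  have hK := (hasAEDeriv_weight hQ).continuousOn
  refine intervalIntegrable_const.sub (intervalIntegrable_mul_of_continuousOn zero_le_one
    (hQ.add intervalIntegrable_const) ?_)
  fun_prop

theorem pruferMap_continuousOn {φ : ℝ → ℝ} (hφ : ContinuousOn φ (Icc 0 1)) :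
    ContinuousOn (pruferMap Q φ) (Icc 0 1) := by
  have hK := (hasAEDeriv_weight hQ).continuousOn
  have hI := (hasAEDeriv_integral zero_le_one (pruferMap_integrable hQ hφ)).continuousOn
  unfold pruferMap
  fun_prop

/-- With K(x) = ∫₀ˣ (|Q| + 1), the map is the Picard iteration conjugated by the weight exp(2K). The
difference of the two integrands is at most d(|Q| + 1)exp(2K), whose antiderivative is (d/2)exp(2K);
the outer factor exp(-2K) leaves d/2. The weight makes one step contract on all of [0,1], however
large the integral of |Q|. -/
theorem pruferMap_contracting {φ ψ : ℝ → ℝ} (hφ : ContinuousOn φ (Icc 0 1))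
    (hψ : ContinuousOn ψ (Icc 0 1)) {d : ℝ} (hd : ∀ x ∈ Icc (0 : ℝ) 1, |φ x - ψ x| ≤ d)
    {x : ℝ} (hx : x ∈ Icc (0 : ℝ) 1) :
    |pruferMap Q φ x - pruferMap Q ψ x| ≤ d / 2 := by
  have hK := hasAEDeriv_weight hQ
  set K : ℝ → ℝ := fun x => ∫ s in (0 : ℝ)..x, (|Q s| + 1) with hKdef
  have hd0 : 0 ≤ d := (abs_nonneg _).trans (hd x hx)
  have hE := ((hK.const_mul 2).comp Real.hasDerivAt_exp Real.continuous_exp).const_mul (d / 2)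
  have hEi : IntervalIntegrable (fun t => d / 2 * (Real.exp (2 * K t) * (2 * (|Q t| + 1))))
    volume 0 x := (hE.mono le_rfl hx.1 hx.2).intervalIntegrable
  have hEv := (hE.mono le_rfl hx.1 hx.2).integral_eq_sub
  have h1 := (pruferMap_integrable hQ hφ).mono_Icc le_rfl hx.1 hx.2
  have h2 := (pruferMap_integrable hQ hψ).mono_Icc le_rfl hx.1 hx.2
  have hsub : |(∫ t in (0 : ℝ)..x, (1 - (Q t + 1) * Real.sin (Real.exp (2 * K t) * φ t) ^ 2)) -
      ∫ t in (0 : ℝ)..x, (1 - (Q t + 1) * Real.sin (Real.exp (2 * K t) * ψ t) ^ 2)| ≤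
      d / 2 * Real.exp (2 * K x) - d / 2 * Real.exp (2 * K 0) := by
    rw [← intervalIntegral.integral_sub h1 h2, ← hEv]
    refine (intervalIntegral.abs_integral_le_integral_abs hx.1).trans
      (intervalIntegral.integral_mono_on hx.1 (h1.sub h2).abs hEi fun t ht => ?_)
    have ht1 : t ∈ Icc (0 : ℝ) 1 := ⟨ht.1, ht.2.trans hx.2⟩
    have e : (1 - (Q t + 1) * Real.sin (Real.exp (2 * K t) * φ t) ^ 2) -
        (1 - (Q t + 1) * Real.sin (Real.exp (2 * K t) * ψ t) ^ 2) =
        (Q t + 1) * (Real.sin (Real.exp (2 * K t) * ψ t) ^ 2 -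
          Real.sin (Real.exp (2 * K t) * φ t) ^ 2) := by ring
    have b1 : |Q t + 1| ≤ |Q t| + 1 := (abs_add_le _ _).trans (by simp)
    have b2 := abs_sin_sq_sub_le (Real.exp (2 * K t) * ψ t) (Real.exp (2 * K t) * φ t)
    rw [← mul_sub, abs_mul, abs_of_pos (Real.exp_pos _), abs_sub_comm] at b2
    have b3 : |Real.sin (Real.exp (2 * K t) * ψ t) ^ 2 -
        Real.sin (Real.exp (2 * K t) * φ t) ^ 2| ≤ Real.exp (2 * K t) * d := by
      rw [abs_sub_comm]
      exact b2.trans (mul_le_mul_of_nonneg_left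
        (by rw [abs_sub_comm]; exact hd t ht1) (Real.exp_pos _).le)
    rw [e, abs_mul]
    calc |Q t + 1| * _ ≤ (|Q t| + 1) * (Real.exp (2 * K t) * d) :=
          mul_le_mul b1 b3 (abs_nonneg _) (by positivity)
      _ = _ := by ring
  unfold pruferMap
  rw [← mul_sub, abs_mul, abs_of_pos (Real.exp_pos _)]
  calc _ ≤ Real.exp (-2 * K x) * (d / 2 * Real.exp (2 * K x) - d / 2 * Real.exp (2 * K 0)) :=
        mul_le_mul_of_nonneg_left hsub (Real.exp_pos _).le
    _ ≤ Real.exp (-2 * K x) * (d / 2 * Real.exp (2 * K x)) := by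
        refine mul_le_mul_of_nonneg_left ?_ (Real.exp_pos _).le
        have := Real.exp_pos (2 * K 0)
        have : 0 ≤ d / 2 * Real.exp (2 * K 0) := by positivity
        linarith
    _ = d / 2 := by
        rw [mul_comm, mul_assoc, ← Real.exp_add]
        simp

theorem exists_isPrufer : ∃ θ, IsPrufer Q θ := by
  let X := C(Icc (0 : ℝ) 1, ℝ)
  have hext : ∀ φ : X, ContinuousOn (IccExtend zero_le_one φ) (Icc (0 : ℝ) 1) := fun φ =>
    (φ.continuous.Icc_extend').continuousOn
  let P : X → X := fun φ => ⟨(Icc (0 : ℝ) 1).domRestrict (pruferMap Q (IccExtend zero_le_one φ)),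
    continuousOn_iff_continuous_domRestrict.1 (pruferMap_continuousOn hQ (hext φ))⟩
  have hP : ContractingWith (1 / 2) P := by
    refine ⟨by rw [← NNReal.coe_lt_coe]; norm_num, LipschitzWith.of_dist_le_mul fun φ ψ => ?_⟩
    rw [ContinuousMap.dist_le (by positivity)]
    intro x
    have := pruferMap_contracting hQ (hext φ) (hext ψ) (d := dist φ ψ) (fun y hy => by
      rw [IccExtend_of_mem _ _ hy, IccExtend_of_mem _ _ hy]
      exact ContinuousMap.dist_apply_le_dist (f := φ) (g := ψ) _) x.2
    rw [Real.dist_eq]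
    refine this.trans_eq ?_
    push_cast
    ring
  obtain ⟨φ, hφ⟩ : ∃ φ, P φ = φ := ⟨_, hP.fixedPoint_isFixedPt⟩
  set φ' : ℝ → ℝ := IccExtend zero_le_one φ with hφ'
  set K : ℝ → ℝ := fun x => ∫ s in (0 : ℝ)..x, (|Q s| + 1) with hKdef
  have hfix : ∀ x ∈ Icc (0 : ℝ) 1, Real.exp (2 * K x) * φ' x =
      ∫ t in (0 : ℝ)..x, (1 - (Q t + 1) * Real.sin (Real.exp (2 * K t) * φ' t) ^ 2) := by
    intro x hx
    have h1 : φ' x = pruferMap Q φ' x := by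
      conv_lhs => rw [hφ', IccExtend_of_mem _ _ hx, ← hφ]
      rfl
    rw [h1]
    unfold pruferMap
    rw [← mul_assoc, ← Real.exp_add]
    simp [hKdef]
  -- The fixed point is exp(-2K)θ, so the weight has to be undone.
  refine ⟨fun x => Real.exp (2 * K x) * φ' x, ?_, ?_⟩
  · refine .of_eq_add_integral zero_le_one (pruferMap_integrable hQ (hext φ)) fun x hx => ?_
    rw [hfix x hx, hfix 0 (left_mem_Icc.2 zero_le_one)]
    simp
  · exact (hfix 0 (left_mem_Icc.2 zero_le_one)).trans (by simp)

end Existence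

/-! ### Comparison of two Prüfer angles. -/

namespace IsPrufer

variable {Q Q₁ Q₂ θ θ₁ θ₂ : ℝ → ℝ}

theorem continuousOn (h : IsPrufer Q θ) : ContinuousOn θ (Icc 0 1) := h.hasAEDeriv.continuousOn

theorem congr_ae (h : IsPrufer Q₁ θ) (e : ∀ᵐ x, x ∈ Ioo (0 : ℝ) 1 → Q₁ x = Q₂ x) :
    IsPrufer Q₂ θ := by
  refine ⟨h.hasAEDeriv.congr_deriv ?_, h.zero⟩
  filter_upwards [e] with x hx hm
  rw [hx hm]

/-- The coefficient of the linear equation satisfied by a difference of two Prüfer angles. -/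
def diffCoeff (Q₁ θ₁ θ₂ : ℝ → ℝ) (x : ℝ) : ℝ :=
  (Q₁ x + 1) * (-(Real.sinc (θ₁ x - θ₂ x) * Real.sin (θ₁ x + θ₂ x)))

theorem abs_diffCoeff_le (Q₁ θ₁ θ₂ : ℝ → ℝ) (x : ℝ) :
    |diffCoeff Q₁ θ₁ θ₂ x| ≤ |Q₁ x| + 1 := by
  unfold diffCoeff
  rw [abs_mul, abs_neg, abs_mul]
  have b1 : |Q₁ x + 1| ≤ |Q₁ x| + 1 := (abs_add_le _ _).trans (by simp)
  have b2 := mul_le_mul (Real.abs_sinc_le_one (θ₁ x - θ₂ x))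
    (Real.abs_sin_le_one (θ₁ x + θ₂ x)) (abs_nonneg _) zero_le_one
  calc _ ≤ (|Q₁ x| + 1) * (1 * 1) := mul_le_mul b1 b2 (by positivity) (by positivity)
    _ = _ := by ring

theorem diffCoeff_intervalIntegrable (hQ : IntervalIntegrable Q₁ volume 0 1)
    (h₁ : ContinuousOn θ₁ (Icc 0 1)) (h₂ : ContinuousOn θ₂ (Icc 0 1)) :
    IntervalIntegrable (diffCoeff Q₁ θ₁ θ₂) volume 0 1 := by
  refine intervalIntegrable_mul_of_continuousOn zero_le_one
    (hQ.add intervalIntegrable_const) ?_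
  have := Real.continuous_sinc
  fun_prop

/-- The identity sin² a - sin² b = sin(a - b) sin(a + b), with sin(a - b) = sinc(a - b)·(a - b),
makes the equation for the difference linear, with the discrepancy of the potentials as
inhomogeneity. Monotonicity, Lipschitz dependence and the first variation all come from this. -/
theorem sub_hasAEDeriv (h₁ : IsPrufer Q₁ θ₁) (h₂ : IsPrufer Q₂ θ₂) :
    HasAEDeriv (fun x => θ₁ x - θ₂ x) (fun x => diffCoeff Q₁ θ₁ θ₂ x * (θ₁ x - θ₂ x) +
      (Q₂ x - Q₁ x) * Real.sin (θ₂ x) ^ 2) 0 1 := by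
  refine (h₁.hasAEDeriv.sub h₂.hasAEDeriv).congr_deriv (Eventually.of_forall fun x _ => ?_)
  have hs : Real.sinc (θ₁ x - θ₂ x) * (θ₁ x - θ₂ x) = Real.sin (θ₁ x - θ₂ x) := by
    by_cases h : θ₁ x - θ₂ x = 0
    · simp [h]
    · rw [Real.sinc_of_ne_zero h]
      field_simp
  have h := sin_sq_sub_sin_sq (θ₁ x) (θ₂ x)
  unfold diffCoeff
  linear_combination (-(Q₁ x + 1)) * h + (-(Q₁ x + 1)) * Real.sin (θ₁ x + θ₂ x) * (-1) * hs

/-- Variation of constants for the difference of two Prüfer angles. -/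
theorem sub_eq (h₁ : IsPrufer Q₁ θ₁) (h₂ : IsPrufer Q₂ θ₂)
    (hQ : IntervalIntegrable Q₁ volume 0 1) {x : ℝ} (hx : x ∈ Icc (0 : ℝ) 1) :
    θ₁ x - θ₂ x = Real.exp (∫ t in (0 : ℝ)..x, diffCoeff Q₁ θ₁ θ₂ t) *
      ∫ t in (0 : ℝ)..x, Real.exp (-∫ s in (0 : ℝ)..t, diffCoeff Q₁ θ₁ θ₂ s) *
        ((Q₂ t - Q₁ t) * Real.sin (θ₂ t) ^ 2) := by
  have := (sub_hasAEDeriv h₁ h₂).linear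
    (diffCoeff_intervalIntegrable hQ h₁.continuousOn h₂.continuousOn) hx
  simpa [h₁.zero, h₂.zero] using this

end IsPrufer

/-! ### Uniqueness for second-order linear equations. -/

section Uniqueness

variable {Q y z : ℝ → ℝ} {a b : ℝ}

/-- Uniqueness for the linear system `y' = z`, `z' = Q y` with integrable `Q`. -/
theorem linear_system_eq_zero (hQ : IntervalIntegrable Q volume a b) (hy : HasAEDeriv y z a b)
    (hz : HasAEDeriv z (fun x => Q x * y x) a b) (hya : y a = 0) (hza : z a = 0) {x : ℝ}
    (hx : x ∈ Icc a b) : y x = 0 ∧ z x = 0 := by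
  have hab := hy.le
  -- N = y² + z² satisfies N' = 2(1 + Q)yz = (1 + Q)sN with |s| ≤ 1, a homogeneous scalar equation
  -- with integrable coefficient. Where N = 0 the quotient s has the value 0, and both sides vanish.
  let N : ℝ → ℝ := fun x => y x * y x + z x * z x
  let s : ℝ → ℝ := fun x => 2 * (y x * z x) / N x
  have hN : HasAEDeriv N (fun x => ((1 + Q x) * s x) * N x) a b := by
    refine ((hy.mul hy).add (hz.mul hz)).congr_deriv (Eventually.of_forall fun t _ => ?_)
    by_cases h : N t = 0
    · have h1 : y t = 0 := by
        simp only [N] at h; nlinarith [mul_self_nonneg (y t), mul_self_nonneg (z t)]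
      have h2 : z t = 0 := by
        simp only [N] at h; nlinarith [mul_self_nonneg (y t), mul_self_nonneg (z t)]
      simp [h, h1, h2]
    · simp only [s]
      field_simp
      ring
  have hs : ∀ t, ‖s t‖ ≤ 1 := fun t => by
    have h0 : 0 ≤ N t := add_nonneg (mul_self_nonneg _) (mul_self_nonneg _)
    rw [Real.norm_eq_abs, abs_div, abs_of_nonneg h0]
    refine div_le_one_of_le₀ ?_ h0
    rw [abs_le]
    constructor <;> simp only [N] <;> nlinarith [sq_nonneg (y t + z t), sq_nonneg (y t - z t)]
  have hα : IntervalIntegrable (fun x => (1 + Q x) * s x) volume a b := by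
    have h1 : IntervalIntegrable (fun x => 1 + Q x) volume a b := intervalIntegrable_const.add hQ
    rw [intervalIntegrable_iff_integrableOn_Ioc_of_le hab] at h1 ⊢
    have hym : AEMeasurable y (volume.restrict (Ioc a b)) :=
      (hy.continuousOn.mono Ioc_subset_Icc_self).aemeasurable measurableSet_Ioc
    have hzm : AEMeasurable z (volume.restrict (Ioc a b)) :=
      (hz.continuousOn.mono Ioc_subset_Icc_self).aemeasurable measurableSet_Ioc
    have hsm : AEMeasurable s (volume.restrict (Ioc a b)) := by
      simp only [s, N]
      fun_prop
    exact h1.mul_bdd hsm.aestronglyMeasurable (Eventually.of_forall hs)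
  have h0 := hN.eq_zero hα (by simp [N, hya, hza]) hx
  simp only [N] at h0
  constructor <;> nlinarith [mul_self_nonneg (y x), mul_self_nonneg (z x)]

/-- A nontrivial solution does not vanish identically on an interval. -/
theorem exists_ne_zero_of_hasDerivWithinAt (hab : a < b)
    (hy : HasDerivWithinAt y (z a) (Icc a b) a) (hza : z a ≠ 0) : ∃ x ∈ Icc a b, y x ≠ 0 := by
  by_contra! h
  refine hza ?_
  have h1 : HasDerivWithinAt y 0 (Icc a b) a :=
    (hasDerivWithinAt_const a (Icc a b) (0 : ℝ)).congr h (h a (left_mem_Icc.2 hab.le))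
  exact (uniqueDiffOn_Icc hab a (left_mem_Icc.2 hab.le)).eq_deriv _ hy h1

end Uniqueness

/-! ### Functions that cross levels only upwards. -/

section Crossing

variable {f : ℝ → ℝ} {a b c : ℝ}

/-- Near every point of `[a,b]` where it takes the value `c`, `f` passes from below `c` to
above `c`. -/
def CrossesUp (f : ℝ → ℝ) (a b c : ℝ) : Prop :=
  ∀ x ∈ Icc a b, f x = c → (x < b → ∀ᶠ t in 𝓝[>] x, c < f t) ∧ (a < x → ∀ᶠ t in 𝓝[<] x, f t < c)

theorem eventually_of_deriv_pos {d x : ℝ} (hx : x ∈ Icc a b)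
    (h : HasDerivWithinAt f d (Icc a b) x) (hd : 0 < d) :
    (x < b → ∀ᶠ t in 𝓝[>] x, f x < f t) ∧ (a < x → ∀ᶠ t in 𝓝[<] x, f t < f x) := by
  rw [hasDerivWithinAt_iff_tendsto_slope] at h
  have h1 : ∀ᶠ t in 𝓝[Icc a b \ {x}] x, 0 < slope f x t := h.eventually (lt_mem_nhds hd)
  constructor
  · intro hxb
    have h2 : 𝓝[>] x ≤ 𝓝[Icc a b \ {x}] x := by
      rw [← nhdsWithin_Ioc_eq_nhdsGT hxb]
      exact nhdsWithin_mono _ fun t ht => ⟨⟨hx.1.trans ht.1.le, ht.2⟩, ht.1.ne'⟩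
    filter_upwards [h2 h1, self_mem_nhdsWithin] with t ht htx
    rw [slope_def_field, div_pos_iff_of_pos_right (sub_pos.2 htx)] at ht
    linarith
  · intro hax
    have h2 : 𝓝[<] x ≤ 𝓝[Icc a b \ {x}] x := by
      rw [← nhdsWithin_Ico_eq_nhdsLT hax]
      exact nhdsWithin_mono _ fun t ht => ⟨⟨ht.1, ht.2.le.trans hx.2⟩, ht.2.ne⟩
    filter_upwards [h2 h1, self_mem_nhdsWithin] with t ht htx
    rw [slope_def_field] at ht
    have htx' : t - x < 0 := sub_neg.2 htx
    have := mul_neg_of_pos_of_neg ht htx'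
    rw [div_mul_cancel₀ _ htx'.ne] at this
    linarith

/-- Otherwise there would be a first point after leaving level c upwards at which f is again ≤ c.
Its value there is c, yet f exceeds c just before, against the upward crossing. -/
theorem CrossesUp.lt_of_le (h : CrossesUp f a b c) (hf : ContinuousOn f (Icc a b)) {x y : ℝ}
    (hx : x ∈ Icc a b) (hy : y ∈ Icc a b) (hxy : x < y) (hc : c ≤ f x) : c < f y := by
  by_contra! hcy
  obtain ⟨x₁, h1, h1y, hcx⟩ : ∃ x₁, x ≤ x₁ ∧ x₁ < y ∧ c < f x₁ := by
    rcases hc.eq_or_lt with h0 | h0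
    · have h2 := (h x hx h0.symm).1 (hxy.trans_le hy.2)
      have h3 : ∀ᶠ t in 𝓝[>] x, t ∈ Ioo x y := Ioo_mem_nhdsGT hxy
      obtain ⟨t, ht, ht'⟩ := (h2.and h3).exists
      exact ⟨t, ht'.1.le, ht'.2, ht⟩
    · exact ⟨x, le_rfl, hxy, h0⟩
  have hsub : Icc x₁ y ⊆ Icc a b := Icc_subset_Icc (hx.1.trans h1) hy.2
  have hcomp : IsCompact (Icc x₁ y ∩ f ⁻¹' Iic c) :=
    isCompact_Icc.of_isClosed_subset
      ((hf.mono hsub).preimage_isClosed_of_isClosed isClosed_Icc isClosed_Iic) inter_subset_left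
  obtain ⟨t, ⟨ht, htc⟩, hmin⟩ := hcomp.exists_isLeast ⟨y, right_mem_Icc.2 h1y.le, hcy⟩
  have htx : x₁ < t := lt_of_le_of_ne ht.1 fun e => by
    rw [← e] at htc
    exact absurd (mem_Iic.1 htc) (not_le.2 hcx)
  have hlt : ∀ s ∈ Ico x₁ t, c < f s := fun s hs => by
    by_contra! hle
    exact absurd (hmin ⟨⟨hs.1, hs.2.le.trans ht.2⟩, hle⟩) (not_le.2 hs.2)
  have hnb : ∀ᶠ s in 𝓝[<] t, s ∈ Ico x₁ t := Ico_mem_nhdsLT htx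
  have hft : f t = c := by
    refine le_antisymm htc ?_
    have hcont : Tendsto f (𝓝[<] t) (𝓝 (f t)) := by
      rw [← nhdsWithin_Ico_eq_nhdsLT htx]
      exact (hf t (hsub ht)).mono fun s hs => hsub ⟨hs.1, hs.2.le.trans ht.2⟩
    exact ge_of_tendsto hcont (hnb.mono fun s hs => (hlt s hs).le)
  have h4 := (h t (hsub ht) hft).2 ((hsub (left_mem_Icc.2 h1y.le)).1.trans_lt htx)
  obtain ⟨s, hs, hs'⟩ := (h4.and hnb).exists
  exact absurd hs (not_lt.2 (hlt s hs').le)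

/-- The number of times that a function strictly between two multiples of `π` meets the
multiples of `π`, if it meets each of them at most once and from below. -/
theorem encard_sin_eq_zero {n : ℕ} (hn : 1 ≤ n) (hab : a < b) (hf : ContinuousOn f (Icc a b))
    (hfa : f a < Real.pi) (hpos : ∀ x ∈ Ioo a b, 0 < f x) (hfb : f b = n * Real.pi)
    (hup : ∀ k : ℕ, ∀ x ∈ Icc a b, ∀ y ∈ Icc a b, x < y → k * Real.pi ≤ f x →
      k * Real.pi < f y) :
    {x | x ∈ Ioo a b ∧ Real.sin (f x) = 0}.encard + 1 = (n : ℕ∞) := by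
  set S := {x | x ∈ Ioo a b ∧ Real.sin (f x) = 0} with hS
  have hpi := Real.pi_pos
  -- Positivity excludes levels kπ with k ≤ 0. A level k ≥ n reached before b would force f b > nπ.
  -- Hence exactly the n - 1 levels π, …, (n - 1)π can occur.
  have hlev : ∀ x ∈ S, ∃ k : ℕ, k ∈ Ico 1 n ∧ f x = k * Real.pi := by
    rintro x ⟨hx, hs⟩
    obtain ⟨k, hk⟩ := Real.sin_eq_zero_iff.1 hs
    have hk0 : 0 < k := by
      have := hpos x hx
      rw [← hk] at this
      exact_mod_cast (pos_iff_pos_of_mul_pos this).2 hpi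
    lift k to ℕ using hk0.le
    refine ⟨k, ⟨by omega, ?_⟩, by rw [← hk]; simp⟩
    by_contra! hnk
    have h1 : (n : ℝ) * Real.pi ≤ f x := by
      rw [← hk]
      have : (n : ℝ) ≤ k := by exact_mod_cast hnk
      push_cast
      gcongr
    have := hup n x (Ioo_subset_Icc_self hx) b (right_mem_Icc.2 hab.le) hx.2 h1
    linarith
  have hinj : InjOn f S := by
    intro x hx y hy hxy
    obtain ⟨k, -, hk⟩ := hlev x hx
    by_contra hne
    rcases lt_or_gt_of_ne hne with h | h
    · have := hup k x (Ioo_subset_Icc_self hx.1) y (Ioo_subset_Icc_self hy.1) h hk.ge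
      linarith
    · have := hup k y (Ioo_subset_Icc_self hy.1) x (Ioo_subset_Icc_self hx.1) h (by linarith)
      linarith
  have himg : f '' S = (fun k : ℕ => (k : ℝ) * Real.pi) '' (Ico 1 n) := by
    ext v
    constructor
    · rintro ⟨x, hx, rfl⟩
      obtain ⟨k, hk, hk'⟩ := hlev x hx
      exact ⟨k, hk, hk'.symm⟩
    · rintro ⟨k, hk, rfl⟩
      have hk1 : (1 : ℝ) ≤ k := by exact_mod_cast hk.1
      have hk2 : (k : ℝ) < n := by exact_mod_cast hk.2
      have hmem : (k : ℝ) * Real.pi ∈ Ioo (f a) (f b) := by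
        constructor
        · nlinarith
        · rw [hfb]; gcongr
      obtain ⟨x, hx, hxe⟩ := intermediate_value_Ioo hab.le hf hmem
      exact ⟨x, ⟨hx, by rw [hxe]; exact Real.sin_nat_mul_pi k⟩, hxe⟩
  have hinj2 : Function.Injective fun k : ℕ => (k : ℝ) * Real.pi := fun k l hkl => by
    have := mul_right_cancel₀ hpi.ne' hkl
    exact_mod_cast this
  rw [← hinj.encard_image, himg, hinj2.encard_image]
  have : (Ico 1 n : Set ℕ) = (Finset.Ico 1 n : Finset ℕ) := by simp
  rw [this, Set.encard_coe_eq_coe_finsetCard, Nat.card_Ico]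
  norm_cast
  omega

end Crossing

/-! ### Polar form of solutions and counting of their zeros. -/

/-- The Prüfer radius belonging to the angle `θ`. -/
def pruferRadius (Q θ : ℝ → ℝ) (x : ℝ) : ℝ :=
  Real.exp (∫ t in (0 : ℝ)..x, (1 + Q t) * (Real.sin (θ t) * Real.cos (θ t)))

theorem pruferRadius_pos (Q θ : ℝ → ℝ) (x : ℝ) : 0 < pruferRadius Q θ x := Real.exp_pos _

namespace IsPrufer

variable {Q θ : ℝ → ℝ}

theorem radius_hasAEDeriv (h : IsPrufer Q θ) (hQ : IntervalIntegrable Q volume 0 1) :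
    HasAEDeriv (pruferRadius Q θ)
      (fun x => pruferRadius Q θ x * ((1 + Q x) * (Real.sin (θ x) * Real.cos (θ x)))) 0 1 := by
  have hc := h.continuousOn
  have hi : IntervalIntegrable (fun t => (1 + Q t) * (Real.sin (θ t) * Real.cos (θ t)))
      volume 0 1 :=
    intervalIntegrable_mul_of_continuousOn zero_le_one (intervalIntegrable_const.add hQ)
      (by fun_prop)
  exact (hasAEDeriv_integral zero_le_one hi).comp (F := Real.exp) Real.hasDerivAt_exp
    Real.continuous_exp

theorem sin_hasAEDeriv (h : IsPrufer Q θ) (hQ : IntervalIntegrable Q volume 0 1) :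
    HasAEDeriv (fun x => pruferRadius Q θ x * Real.sin (θ x))
      (fun x => pruferRadius Q θ x * Real.cos (θ x)) 0 1 := by
  refine ((h.radius_hasAEDeriv hQ).mul (h.hasAEDeriv.comp Real.hasDerivAt_sin
    Real.continuous_cos)).congr_deriv (Eventually.of_forall fun x _ => ?_)
  ring

theorem cos_hasAEDeriv (h : IsPrufer Q θ) (hQ : IntervalIntegrable Q volume 0 1) :
    HasAEDeriv (fun x => pruferRadius Q θ x * Real.cos (θ x))
      (fun x => Q x * (pruferRadius Q θ x * Real.sin (θ x))) 0 1 := by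
  refine ((h.radius_hasAEDeriv hQ).mul (h.hasAEDeriv.comp Real.hasDerivAt_cos
    Real.continuous_sin.neg)).congr_deriv (Eventually.of_forall fun x _ => ?_)
  have := Real.sin_sq_add_cos_sq (θ x)
  linear_combination (pruferRadius Q θ x * Real.sin (θ x) * (1 + Q x)) * this

theorem sin_hasDerivWithinAt (h : IsPrufer Q θ) (hQ : IntervalIntegrable Q volume 0 1) {x : ℝ}
    (hx : x ∈ Icc (0 : ℝ) 1) :
    HasDerivWithinAt (fun x => pruferRadius Q θ x * Real.sin (θ x))
      (pruferRadius Q θ x * Real.cos (θ x)) (Icc 0 1) x :=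
  (h.sin_hasAEDeriv hQ).hasDerivWithinAt (h.cos_hasAEDeriv hQ).continuousOn hx

/-- The Prüfer angle crosses the multiples of `π` upwards. -/
theorem crossesUp (h : IsPrufer Q θ) (hQ : IntervalIntegrable Q volume 0 1) (n : ℤ) :
    CrossesUp θ 0 1 (n * Real.pi) := by
  intro x hx hn
  have hc1 : Real.cos (n * Real.pi) * Real.cos (n * Real.pi) = 1 := by
    have := Real.sin_sq_add_cos_sq (n * Real.pi)
    rw [Real.sin_int_mul_pi] at this
    linarith
  have hρ := pruferRadius_pos Q θ x
  -- The angle is only absolutely continuous, so its crossing is read off from the C¹ function ρ sin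
  -- θ; the factor cos(nπ) = ±1 makes its derivative at the crossing positive.
  have hd := (h.sin_hasDerivWithinAt hQ hx).const_mul (Real.cos (n * Real.pi))
  have hpos : 0 < Real.cos (n * Real.pi) * (pruferRadius Q θ x * Real.cos (θ x)) := by
    rw [hn, mul_left_comm, hc1, mul_one]
    exact hρ
  have hev := eventually_of_deriv_pos hx hd hpos
  have hx0 : Real.cos (n * Real.pi) * (pruferRadius Q θ x * Real.sin (θ x)) = 0 := by
    rw [hn, Real.sin_int_mul_pi]; ring
  have hs : ∀ t, Real.sin (θ t - n * Real.pi) = Real.cos (n * Real.pi) * Real.sin (θ t) := fun t =>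
    by rw [Real.sin_sub, Real.sin_int_mul_pi]; ring
  have hnear : ∀ᶠ t in 𝓝[Icc 0 1] x, |θ t - n * Real.pi| < Real.pi := by
    have : Tendsto (fun t => |θ t - n * Real.pi|) (𝓝[Icc 0 1] x) (𝓝 |θ x - n * Real.pi|) :=
      ((h.continuousOn x hx).sub_const _).abs
    rw [hn, sub_self, abs_zero] at this
    exact this.eventually (gt_mem_nhds Real.pi_pos)
  rw [eventually_nhdsWithin_iff] at hnear
  have key : ∀ t, Real.cos (n * Real.pi) * (pruferRadius Q θ t * Real.sin (θ t)) =
      pruferRadius Q θ t * Real.sin (θ t - n * Real.pi) := fun t => by rw [hs]; ring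
  rw [hx0] at hev
  constructor
  · intro hx1
    filter_upwards [hev.1 hx1, nhdsWithin_le_nhds hnear, Ioc_mem_nhdsGT hx1] with t ht htn htm
    rw [key] at ht
    have ht' := (pos_iff_pos_of_mul_pos ht).1 (pruferRadius_pos Q θ t)
    have := abs_lt.1 (htn ⟨hx.1.trans htm.1.le, htm.2⟩)
    by_contra! hle
    exact absurd ht' (not_lt.2 (Real.sin_nonpos_of_nonpos_of_neg_pi_le (by linarith)
      (by linarith)))
  · intro hx0
    filter_upwards [hev.2 hx0, nhdsWithin_le_nhds hnear, Ico_mem_nhdsLT hx0] with t ht htn htm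
    rw [key] at ht
    have := abs_lt.1 (htn ⟨htm.1, htm.2.le.trans hx.2⟩)
    by_contra! hle
    exact absurd ht (not_lt.2 (mul_nonneg (pruferRadius_pos Q θ t).le
      (Real.sin_nonneg_of_nonneg_of_le_pi (by linarith) (by linarith))))

theorem lt_of_le (h : IsPrufer Q θ) (hQ : IntervalIntegrable Q volume 0 1) (n : ℕ) {x y : ℝ}
    (hx : x ∈ Icc (0 : ℝ) 1) (hy : y ∈ Icc (0 : ℝ) 1) (hxy : x < y) (hc : n * Real.pi ≤ θ x) :
    n * Real.pi < θ y := by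
  have := (h.crossesUp hQ n).lt_of_le h.continuousOn hx hy hxy
  exact_mod_cast this (by exact_mod_cast hc)

theorem pos (h : IsPrufer Q θ) (hQ : IntervalIntegrable Q volume 0 1) {x : ℝ}
    (hx : x ∈ Ioc (0 : ℝ) 1) : 0 < θ x := by
  have := h.lt_of_le hQ 0 (left_mem_Icc.2 zero_le_one) (Ioc_subset_Icc_self hx) hx.1
    (by simp [h.zero])
  simpa using this

/-- Number of zeros of `sin θ` before a zero. -/
theorem encard_zeros (h : IsPrufer Q θ) (hQ : IntervalIntegrable Q volume 0 1) {T : ℝ}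
    (hT : T ∈ Ioc (0 : ℝ) 1) {n : ℕ} (hn : 1 ≤ n) (hθ : θ T = n * Real.pi) :
    {x | x ∈ Ioo 0 T ∧ Real.sin (θ x) = 0}.encard + 1 = (n : ℕ∞) := by
  have hsub : Icc 0 T ⊆ Icc (0 : ℝ) 1 := Icc_subset_Icc_right hT.2
  refine encard_sin_eq_zero hn hT.1 (h.continuousOn.mono hsub) ?_ ?_ hθ ?_
  · rw [h.zero]; exact Real.pi_pos
  · exact fun x hx => h.pos hQ ⟨hx.1, hx.2.le.trans hT.2⟩
  · exact fun k x hx y hy hxy hk => h.lt_of_le hQ k (hsub hx) (hsub hy) hxy hk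

theorem exists_nat_of_sin_eq_zero (h : IsPrufer Q θ) (hQ : IntervalIntegrable Q volume 0 1)
    {T : ℝ} (hT : T ∈ Ioc (0 : ℝ) 1) (hs : Real.sin (θ T) = 0) :
    ∃ n : ℕ, 1 ≤ n ∧ θ T = n * Real.pi := by
  obtain ⟨k, hk⟩ := Real.sin_eq_zero_iff.1 hs
  have hk0 : 0 < k := by
    have := h.pos hQ hT
    rw [← hk] at this
    exact_mod_cast (pos_iff_pos_of_mul_pos this).2 Real.pi_pos
  lift k to ℕ using hk0.le
  exact ⟨k, by omega, by rw [← hk]; simp⟩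

end IsPrufer

theorem IsSolution.exists_system {q y : ℝ → ℝ} {lam : ℝ} (hq : IntervalIntegrable q volume 0 1)
    (h : IsSolution q lam y) :
    ∃ z : ℝ → ℝ, (∀ x ∈ Icc (0 : ℝ) 1, HasDerivWithinAt y (z x) (Icc (0 : ℝ) 1) x) ∧
      HasAEDeriv y z 0 1 ∧ HasAEDeriv z (fun x => (q x - lam) * y x) 0 1 := by
  obtain ⟨z, h1, h2⟩ := h
  have hy : ContinuousOn y (Icc 0 1) := fun x hx => (h1 x hx).continuousWithinAt
  have hz : HasAEDeriv z (fun x => (q x - lam) * y x) 0 1 := .of_eq_add_integral zero_le_one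
    (intervalIntegrable_mul_of_continuousOn zero_le_one (hq.sub intervalIntegrable_const) hy) h2
  exact ⟨z, h1, .of_hasDerivWithinAt zero_le_one h1 hz.continuousOn, hz⟩

theorem isSolution_of_system {q y z : ℝ → ℝ} {lam : ℝ} (hy : HasAEDeriv y z 0 1)
    (hz : HasAEDeriv z (fun x => (q x - lam) * y x) 0 1) : IsSolution q lam y :=
  ⟨z, fun _ hx => hy.hasDerivWithinAt hz.continuousOn hx, fun _ hx => hz.eq_add_integral hx⟩

namespace IsPrufer

variable {Q θ : ℝ → ℝ}

/-- Every solution that vanishes at `0` is a multiple of the one given by the Prüfer angle. -/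
theorem eq_const_mul (h : IsPrufer Q θ) (hQ : IntervalIntegrable Q volume 0 1) {y z : ℝ → ℝ}
    (hy : HasAEDeriv y z 0 1) (hz : HasAEDeriv z (fun x => Q x * y x) 0 1) (h0 : y 0 = 0) {x : ℝ}
    (hx : x ∈ Icc (0 : ℝ) 1) :
    y x = z 0 * (pruferRadius Q θ x * Real.sin (θ x)) ∧
      z x = z 0 * (pruferRadius Q θ x * Real.cos (θ x)) := by
  have hD := hy.sub ((h.sin_hasAEDeriv hQ).const_mul (z 0))
  have hD' := (hz.sub ((h.cos_hasAEDeriv hQ).const_mul (z 0))).congr_deriv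
    (g₂ := fun x => Q x * (y x - z 0 * (pruferRadius Q θ x * Real.sin (θ x))))
    (Eventually.of_forall fun x _ => by ring)
  have := linear_system_eq_zero hQ hD hD' (by simp [h0, h.zero])
    (by simp [h.zero, pruferRadius]) hx
  constructor
  · linarith [this.1]
  · linarith [this.2]

theorem exists_sin_ne_zero (h : IsPrufer Q θ) (hQ : IntervalIntegrable Q volume 0 1) {c : ℝ}
    (hc : c ∈ Ioc (0 : ℝ) 1) : ∃ x ∈ Icc 0 c, Real.sin (θ x) ≠ 0 := by
  obtain ⟨x, hx, hne⟩ := exists_ne_zero_of_hasDerivWithinAt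
    (z := fun x => pruferRadius Q θ x * Real.cos (θ x)) hc.1
    ((h.sin_hasDerivWithinAt hQ (left_mem_Icc.2 zero_le_one)).mono (Icc_subset_Icc_right hc.2))
    (by simp [h.zero, pruferRadius])
  exact ⟨x, hx, right_ne_zero_of_mul hne⟩

end IsPrufer

/-! ### Eigenfunctions and eigenvalues through the Prüfer angle. -/

section Eigen

variable {q θ : ℝ → ℝ} {lam : ℝ}

theorem IsPrufer.isEigenfunction (hq : IntervalIntegrable q volume 0 1)
    (h : IsPrufer (fun x => q x - lam) θ) (h1 : Real.sin (θ 1) = 0) :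
    IsEigenfunction q lam (fun x => pruferRadius (fun x => q x - lam) θ x * Real.sin (θ x)) := by
  have hQ : IntervalIntegrable (fun x => q x - lam) volume 0 1 := hq.sub intervalIntegrable_const
  obtain ⟨x, hx, hne⟩ := h.exists_sin_ne_zero hQ (right_mem_Ioc.2 zero_lt_one)
  exact ⟨isSolution_of_system (h.sin_hasAEDeriv hQ) (h.cos_hasAEDeriv hQ), by simp [h.zero],
    by simp [h1], x, hx, mul_ne_zero (pruferRadius_pos _ _ _).ne' hne⟩

theorem IsEigenfunction.eq_const_mul {E : ℝ → ℝ} (hq : IntervalIntegrable q volume 0 1)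
    (hE : IsEigenfunction q lam E) (h : IsPrufer (fun x => q x - lam) θ) :
    ∃ C ≠ 0, ∀ x ∈ Icc (0 : ℝ) 1,
      E x = C * (pruferRadius (fun x => q x - lam) θ x * Real.sin (θ x)) := by
  obtain ⟨hs, h0, -, x, hx, hne⟩ := hE
  obtain ⟨z, -, hy, hz⟩ := hs.exists_system hq
  have key := fun x hx => (h.eq_const_mul (hq.sub intervalIntegrable_const) hy hz h0 (x := x) hx).1
  refine ⟨z 0, fun hz0 => hne ?_, key⟩
  rw [key x hx, hz0, zero_mul]

theorem IsEigenfunction.eq_zero_iff {E : ℝ → ℝ} (hq : IntervalIntegrable q volume 0 1)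
    (hE : IsEigenfunction q lam E) (h : IsPrufer (fun x => q x - lam) θ) {x : ℝ}
    (hx : x ∈ Icc (0 : ℝ) 1) : E x = 0 ↔ Real.sin (θ x) = 0 := by
  obtain ⟨C, hC, key⟩ := hE.eq_const_mul hq h
  rw [key x hx]
  simp [hC, (pruferRadius_pos _ _ _).ne']

theorem IsPrufer.isEigenvalue_iff (hq : IntervalIntegrable q volume 0 1)
    (h : IsPrufer (fun x => q x - lam) θ) : IsEigenvalue q lam ↔ Real.sin (θ 1) = 0 := by
  refine ⟨fun ⟨E, hE⟩ => ?_, fun h1 => ⟨_, h.isEigenfunction hq h1⟩⟩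
  exact (hE.eq_zero_iff hq h (right_mem_Icc.2 zero_le_one)).1 hE.2.2.1

end Eigen

/-! ### Dependence of the angle on the potential and the spectral parameter. -/

section Dependence

variable {Q₁ Q₂ θ₁ θ₂ : ℝ → ℝ}

theorem IsPrufer.abs_integral_diffCoeff_le (hQ : IntervalIntegrable Q₁ volume 0 1)
    {x : ℝ} (hx : x ∈ Icc (0 : ℝ) 1) :
    |∫ t in (0 : ℝ)..x, IsPrufer.diffCoeff Q₁ θ₁ θ₂ t| ≤ ∫ t in (0 : ℝ)..1, (|Q₁ t| + 1) := by
  have hi : IntervalIntegrable (fun t => |Q₁ t| + 1) volume 0 1 := hQ.abs.add intervalIntegrable_const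
  rw [← Real.norm_eq_abs]
  calc _ ≤ ∫ t in (0 : ℝ)..x, (|Q₁ t| + 1) :=
        intervalIntegral.norm_integral_le_of_norm_le hx.1
          (Eventually.of_forall fun t _ => IsPrufer.abs_diffCoeff_le _ _ _ t)
          (hi.mono_Icc le_rfl hx.1 hx.2)
    _ ≤ _ := intervalIntegral.integral_mono_interval le_rfl hx.1 hx.2
        (Eventually.of_forall fun t => by positivity) hi

/-- Lipschitz dependence of the Prüfer angle on the potential. -/
theorem IsPrufer.abs_sub_le (h₁ : IsPrufer Q₁ θ₁) (h₂ : IsPrufer Q₂ θ₂)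
    (hQ₁ : IntervalIntegrable Q₁ volume 0 1) (hQ₂ : IntervalIntegrable Q₂ volume 0 1)
    {x : ℝ} (hx : x ∈ Icc (0 : ℝ) 1) :
    |θ₁ x - θ₂ x| ≤ Real.exp (2 * ∫ t in (0 : ℝ)..1, (|Q₁ t| + 1)) *
      ∫ t in (0 : ℝ)..1, |Q₂ t - Q₁ t| := by
  set M := ∫ t in (0 : ℝ)..1, (|Q₁ t| + 1) with hM
  have hb := fun x hx => abs_le.1
    (IsPrufer.abs_integral_diffCoeff_le (θ₁ := θ₁) (θ₂ := θ₂) hQ₁ (x := x) hx)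
  have hi : IntervalIntegrable (fun t => Real.exp M * |Q₂ t - Q₁ t|) volume 0 1 :=
    (hQ₂.sub hQ₁).abs.const_mul _
  have h1 : |∫ t in (0 : ℝ)..x, Real.exp (-∫ s in (0 : ℝ)..t, IsPrufer.diffCoeff Q₁ θ₁ θ₂ s) *
      ((Q₂ t - Q₁ t) * Real.sin (θ₂ t) ^ 2)| ≤ ∫ t in (0 : ℝ)..1, Real.exp M * |Q₂ t - Q₁ t| := by
    rw [← Real.norm_eq_abs]
    refine (intervalIntegral.norm_integral_le_of_norm_le hx.1
          (Eventually.of_forall fun t ht => ?_) (hi.mono_Icc le_rfl hx.1 hx.2)).trans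
      (intervalIntegral.integral_mono_interval le_rfl hx.1 hx.2
        (Eventually.of_forall fun t => by positivity) hi)
    have ht1 : t ∈ Icc (0 : ℝ) 1 := ⟨ht.1.le, ht.2.trans hx.2⟩
    rw [Real.norm_eq_abs, abs_mul, abs_of_pos (Real.exp_pos _), abs_mul,
      abs_of_nonneg (sq_nonneg (Real.sin (θ₂ t)))]
    refine mul_le_mul (Real.exp_le_exp.2 (by linarith [(hb t ht1).1])) ?_ (by positivity)
      (Real.exp_pos _).le
    exact mul_le_of_le_one_right (abs_nonneg _) (Real.sin_sq_le_one _)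
  rw [h₁.sub_eq h₂ hQ₁ hx, abs_mul, abs_of_pos (Real.exp_pos _)]
  rw [intervalIntegral.integral_const_mul] at h1
  calc _ ≤ Real.exp M * (Real.exp M * ∫ t in (0 : ℝ)..1, |Q₂ t - Q₁ t|) :=
        mul_le_mul (Real.exp_le_exp.2 (hb x hx).2) h1 (abs_nonneg _) (Real.exp_pos _).le
    _ = _ := by rw [two_mul, Real.exp_add]; ring

theorem IsPrufer.unique (h₁ : IsPrufer Q₁ θ₁) (h₂ : IsPrufer Q₁ θ₂)
    (hQ₁ : IntervalIntegrable Q₁ volume 0 1) {x : ℝ} (hx : x ∈ Icc (0 : ℝ) 1) : θ₁ x = θ₂ x := by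
  have := h₁.abs_sub_le h₂ hQ₁ hQ₁ hx
  simp only [sub_self, abs_zero, intervalIntegral.integral_zero, mul_zero] at this
  exact sub_eq_zero.1 (abs_nonpos_iff.1 this)

/-- The Prüfer angle at `1` is strictly increasing in the spectral parameter. -/
theorem IsPrufer.lt_of_lt {q : ℝ → ℝ} {μ ν : ℝ} (hq : IntervalIntegrable q volume 0 1)
    (h₁ : IsPrufer (fun x => q x - μ) θ₁) (h₂ : IsPrufer (fun x => q x - ν) θ₂) (h : μ < ν) :
    θ₁ 1 < θ₂ 1 := by
  have hμ : IntervalIntegrable (fun x => q x - μ) volume 0 1 := hq.sub intervalIntegrable_const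
  have hν : IntervalIntegrable (fun x => q x - ν) volume 0 1 := hq.sub intervalIntegrable_const
  have e := h₂.sub_eq h₁ hν (right_mem_Icc.2 zero_le_one)
  -- The inhomogeneity in the variation-of-constants formula is (ν - μ) sin² θ₁, nonnegative and not
  -- identically zero.
  rw [← sub_pos, e]
  refine mul_pos (Real.exp_pos _) ?_
  have hc := (hasAEDeriv_integral zero_le_one
    (IsPrufer.diffCoeff_intervalIntegrable hν h₂.continuousOn h₁.continuousOn)).continuousOn
  have hc1 := h₁.continuousOn
  obtain ⟨c, hc01, hne⟩ := h₁.exists_sin_ne_zero hμ (right_mem_Ioc.2 zero_lt_one)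
  refine intervalIntegral.integral_pos zero_lt_one ?_ (fun t _ => ?_) ⟨c, hc01, ?_⟩
  · simp only [sub_sub_sub_cancel_left]
    fun_prop
  · have : 0 ≤ (q t - μ) - (q t - ν) := by linarith
    positivity
  · have : 0 < (q c - μ) - (q c - ν) := by linarith
    positivity

/-- For very negative spectral parameters the solution has no further zero. -/
theorem IsPrufer.lt_pi {q θ : ℝ → ℝ} {μ : ℝ} (hq : IntervalIntegrable q volume 0 1)
    (h : IsPrufer (fun x => q x - μ) θ) (hμ : μ < -(∫ t in (0 : ℝ)..1, |q t|) ^ 2) :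
    θ 1 < Real.pi := by
  by_contra! hge
  have hQ : IntervalIntegrable (fun x => q x - μ) volume 0 1 := hq.sub intervalIntegrable_const
  -- At c the angle equals π, so y vanishes at both 0 and c. Integrating (yz)' over [0,c] then gives
  -- ∫ z² + ∫ q y² = μ ∫ y², which is refuted below for μ < -N², where N is the L¹ norm of q.
  obtain ⟨c, hc, hcpi⟩ : Real.pi ∈ θ '' Icc 0 1 :=
    intermediate_value_Icc zero_le_one h.continuousOn ⟨by rw [h.zero]; exact Real.pi_pos.le, hge⟩
  have hc0 : 0 < c := lt_of_le_of_ne hc.1 fun e => by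
    rw [← e, h.zero] at hcpi
    exact Real.pi_pos.ne hcpi
  have hy := (h.sin_hasAEDeriv hQ).mono le_rfl hc.1 hc.2
  have hz := (h.cos_hasAEDeriv hQ).mono le_rfl hc.1 hc.2
  set y := fun x => pruferRadius (fun x => q x - μ) θ x * Real.sin (θ x) with hydef
  set z := fun x => pruferRadius (fun x => q x - μ) θ x * Real.cos (θ x) with hzdef
  set N := ∫ t in (0 : ℝ)..1, |q t| with hN
  have hy0 : y 0 = 0 := by simp [hydef, h.zero]
  have hyc : y c = 0 := by simp [hydef, hcpi]
  have hyC := hy.continuousOn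
  have hzC := hz.continuousOn
  have hiy : IntervalIntegrable (fun t => y t * y t) volume 0 c :=
    (hyC.mul hyC).intervalIntegrable_of_Icc hc.1
  have hiz : IntervalIntegrable (fun t => z t * z t) volume 0 c :=
    (hzC.mul hzC).intervalIntegrable_of_Icc hc.1
  have hiyz : IntervalIntegrable (fun t => 2 * |y t * z t|) volume 0 c :=
    ((hyC.mul hzC).abs.intervalIntegrable_of_Icc hc.1).const_mul 2
  have hqc := hq.mono_Icc le_rfl hc.1 hc.2
  have hiq : IntervalIntegrable (fun t => q t * (y t * y t)) volume 0 c :=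
    intervalIntegrable_mul_of_continuousOn hc.1 hqc (hyC.mul hyC)
  have hiqa : IntervalIntegrable (fun t => |q t| * (y t * y t)) volume 0 c :=
    intervalIntegrable_mul_of_continuousOn hc.1 hqc.abs (hyC.mul hyC)
  -- Since (y²)' = 2yz and y(0) = 0, S bounds y² pointwise. Hence |∫ q y²| ≤ NS ≤ ∫ z² + N² ∫ y², so
  -- that μ ≥ -N².
  set S := ∫ t in (0 : ℝ)..c, 2 * |y t * z t| with hS
  have hyS : ∀ x ∈ Icc 0 c, y x * y x ≤ S := by
    intro x hx
    have h1 := (hy.mul hy).eq_add_integral hx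
    simp only [hy0, mul_zero, zero_add] at h1
    rw [h1]
    have hyzx : IntervalIntegrable (fun t => z t * y t + y t * z t) volume 0 x :=
      (((hzC.mul hyC).add (hyC.mul hzC)).intervalIntegrable_of_Icc hc.1).mono_Icc le_rfl hx.1 hx.2
    refine (intervalIntegral.integral_mono_on hx.1 hyzx (hiyz.mono_Icc le_rfl hx.1 hx.2)
      fun t _ => ?_).trans (intervalIntegral.integral_mono_interval le_rfl hx.1 hx.2
        (Eventually.of_forall fun t => by positivity) hiyz)
    have := le_abs_self (y t * z t)
    nlinarith
  have hS0 : 0 ≤ S := (mul_self_nonneg _).trans (hyS 0 (left_mem_Icc.2 hc.1))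
  have hN0 : 0 ≤ N := intervalIntegral.integral_nonneg zero_le_one fun t _ => abs_nonneg _
  have hNc : ∫ t in (0 : ℝ)..c, |q t| ≤ N := intervalIntegral.integral_mono_interval le_rfl hc.1
    hc.2 (Eventually.of_forall fun t => abs_nonneg _) hq.abs
  have hqy : ∫ t in (0 : ℝ)..c, |q t| * (y t * y t) ≤ N * S := by
    calc _ ≤ ∫ t in (0 : ℝ)..c, |q t| * S := intervalIntegral.integral_mono_on hc.1 hiqa
          (hqc.abs.mul_const S) fun t ht => mul_le_mul_of_nonneg_left (hyS t ht) (abs_nonneg _)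
      _ ≤ N * S := by
          rw [intervalIntegral.integral_mul_const]
          exact mul_le_mul_of_nonneg_right hNc hS0
  have hNS : N * S ≤ ∫ t in (0 : ℝ)..c, (z t * z t + N ^ 2 * (y t * y t)) := by
    rw [hS, ← intervalIntegral.integral_const_mul]
    refine intervalIntegral.integral_mono_on hc.1 (hiyz.const_mul N)
      (hiz.add (hiy.const_mul _)) fun t _ => ?_
    have h1 : |y t * z t| * |y t * z t| = (y t * y t) * (z t * z t) := by
      rw [abs_mul_abs_self]; ring
    rw [abs_mul]
    nlinarith [sq_nonneg (N * |y t| - |z t|), abs_mul_abs_self (y t), abs_mul_abs_self (z t)]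
  have hen := (hy.mul hz).integral_eq_sub
  simp only [hy0, hyc, zero_mul, sub_zero] at hen
  have hsum : ∫ t in (0 : ℝ)..c, (z t * z t + y t * ((q t - μ) * y t)) =
      (∫ t in (0 : ℝ)..c, z t * z t) + (∫ t in (0 : ℝ)..c, q t * (y t * y t)) -
        μ * ∫ t in (0 : ℝ)..c, y t * y t := by
    rw [← intervalIntegral.integral_const_mul, ← intervalIntegral.integral_add hiz hiq,
      ← intervalIntegral.integral_sub (hiz.add hiq) (hiy.const_mul μ)]
    exact intervalIntegral.integral_congr fun t _ => by ring
  rw [intervalIntegral.integral_add hiz (hiy.const_mul _),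
    intervalIntegral.integral_const_mul] at hNS
  have hneg : -(∫ t in (0 : ℝ)..c, |q t| * (y t * y t)) ≤ ∫ t in (0 : ℝ)..c, q t * (y t * y t) := by
    rw [← intervalIntegral.integral_neg]
    refine intervalIntegral.integral_mono_on hc.1 hiqa.neg hiq fun t _ => ?_
    have := neg_abs_le (q t)
    nlinarith [mul_self_nonneg (y t)]
  obtain ⟨t, ht, hne⟩ := h.exists_sin_ne_zero hQ ⟨hc0, hc.2⟩
  have hpos : 0 < ∫ t in (0 : ℝ)..c, y t * y t := by
    refine intervalIntegral.integral_pos hc0 (hyC.mul hyC) (fun t _ => mul_self_nonneg _)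
      ⟨t, ht, mul_self_pos.2 (mul_ne_zero (pruferRadius_pos _ _ _).ne' hne)⟩
  rw [hsum] at hen
  nlinarith

end Dependence

/-! ### Eigenvalue index and nodes as values of the angle. -/

section Index

variable {q : ℝ → ℝ}

/-- A choice of the Prüfer angle. -/
def pruferAngle (Q : ℝ → ℝ) : ℝ → ℝ := Classical.epsilon (IsPrufer Q)

theorem isPrufer_pruferAngle {Q : ℝ → ℝ} (hQ : IntervalIntegrable Q volume 0 1) :
    IsPrufer Q (pruferAngle Q) := Classical.epsilon_spec (exists_isPrufer hQ)

theorem isPrufer_pruferAngle_sub (hq : IntervalIntegrable q volume 0 1) (μ : ℝ) :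
    IsPrufer (fun x => q x - μ) (pruferAngle fun x => q x - μ) :=
  isPrufer_pruferAngle (hq.sub intervalIntegrable_const)

/-- The counting lemma for sin f = 0 is applied in the spectral variable: f is the angle at 1 as a
function of μ, which is continuous, strictly increasing and below π for μ very negative. -/
theorem encard_eigenvalues {lam : ℝ} (hq : IntervalIntegrable q volume 0 1) {n : ℕ} (hn : 1 ≤ n)
    (h : pruferAngle (fun x => q x - lam) 1 = n * Real.pi) :
    {mu : ℝ | mu < lam ∧ IsEigenvalue q mu}.encard + 1 = (n : ℕ∞) := by
  have hP := isPrufer_pruferAngle_sub hq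
  set Φ : ℝ → ℝ := fun μ => pruferAngle (fun x => q x - μ) 1 with hΦ
  have hmono : StrictMono Φ := fun μ ν hμν => (hP μ).lt_of_lt hq (hP ν) hμν
  have hpos : ∀ μ, 0 < Φ μ := fun μ =>
    (hP μ).pos (hq.sub intervalIntegrable_const) (right_mem_Ioc.2 zero_lt_one)
  have hcont : Continuous Φ := by
    rw [continuous_iff_continuousAt]
    intro μ
    rw [ContinuousAt, tendsto_iff_dist_tendsto_zero]
    have hb : ∀ ν, dist (Φ ν) (Φ μ) ≤
        Real.exp (2 * ∫ t in (0 : ℝ)..1, (|q t - μ| + 1)) * |ν - μ| := by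
      intro ν
      rw [dist_comm]
      refine ((hP μ).abs_sub_le (hP ν) (hq.sub intervalIntegrable_const)
        (hq.sub intervalIntegrable_const) (right_mem_Icc.2 zero_le_one)).trans_eq ?_
      simp [abs_sub_comm μ ν]
    refine squeeze_zero (fun _ => dist_nonneg) hb ?_
    have : Tendsto (fun ν => Real.exp (2 * ∫ t in (0 : ℝ)..1, (|q t - μ| + 1)) * |ν - μ|) (𝓝 μ)
        (𝓝 (Real.exp (2 * ∫ t in (0 : ℝ)..1, (|q t - μ| + 1)) * |μ - μ|)) := by
      apply Continuous.tendsto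
      fun_prop
    simpa using this
  -- At and below μ₀ the angle at 1 lies in (0,π), so there is no eigenvalue there; the eigenvalues
  -- below `lam` all lie in (μ₀, `lam`).
  obtain ⟨μ₀, hμ₀⟩ : ∃ μ₀, μ₀ < min lam (-(∫ t in (0 : ℝ)..1, |q t|) ^ 2) := exists_lt _
  rw [lt_min_iff] at hμ₀
  have hlow : ∀ μ ≤ μ₀, Φ μ < Real.pi := fun μ hμ => (hP μ).lt_pi hq (hμ.trans_lt hμ₀.2)
  have key := encard_sin_eq_zero (f := Φ) hn hμ₀.1 hcont.continuousOn (hlow _ le_rfl)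
    (fun x _ => hpos x) h (fun k x _ y _ hxy hk => hk.trans_lt (hmono hxy))
  convert key using 3
  ext μ
  simp only [mem_ofPred_eq, (hP μ).isEigenvalue_iff hq]
  refine ⟨fun hμ => ⟨⟨?_, hμ.1⟩, hμ.2⟩, fun hμ => ⟨hμ.1.2, hμ.2⟩⟩
  by_contra! hle
  exact (Real.sin_pos_of_pos_of_lt_pi (hpos μ) (hlow μ hle)).ne' hμ.2

/-- The index of an eigenvalue is read off from its Prüfer angle. -/
theorem isNthEigenvalue_iff {θ : ℝ → ℝ} {lam : ℝ} (hq : IntervalIntegrable q volume 0 1) {m : ℕ}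
    (h : IsPrufer (fun x => q x - lam) θ) :
    IsNthEigenvalue m q lam ↔ 1 ≤ m ∧ θ 1 = m * Real.pi := by
  have hQ : IntervalIntegrable (fun x => q x - lam) volume 0 1 := hq.sub intervalIntegrable_const
  rw [h.unique (isPrufer_pruferAngle hQ) hQ (right_mem_Icc.2 zero_le_one)]
  have hP := isPrufer_pruferAngle hQ
  constructor
  · rintro ⟨he, hcard⟩
    obtain ⟨n, hn, hθ⟩ := hP.exists_nat_of_sin_eq_zero hQ (right_mem_Ioc.2 zero_lt_one)
      ((hP.isEigenvalue_iff hq).1 he)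
    have := encard_eigenvalues hq hn hθ
    rw [hcard] at this
    have hmn : m = n := by exact_mod_cast this
    exact ⟨hmn ▸ hn, hmn ▸ hθ⟩
  · rintro ⟨hm, hθ⟩
    exact ⟨(hP.isEigenvalue_iff hq).2 (by rw [hθ]; exact Real.sin_nat_mul_pi m),
      encard_eigenvalues hq hm hθ⟩

theorem IsNthEigenvalue.unique {m : ℕ} {lam mu : ℝ} (hq : IntervalIntegrable q volume 0 1)
    (h₁ : IsNthEigenvalue m q lam) (h₂ : IsNthEigenvalue m q mu) : lam = mu := by
  have hl := isPrufer_pruferAngle_sub hq lam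
  have hm := isPrufer_pruferAngle_sub hq mu
  have e1 := ((isNthEigenvalue_iff hq hl).1 h₁).2
  have e2 := ((isNthEigenvalue_iff hq hm).1 h₂).2
  by_contra hne
  rcases lt_or_gt_of_ne hne with h | h
  · have := hl.lt_of_lt hq hm h; linarith
  · have := hm.lt_of_lt hq hl h; linarith

/-- Nodes in terms of the Prüfer angle. -/
theorem isNode_iff (hq : IntervalIntegrable q volume 0 1) {i m : ℕ} {T : ℝ} (hi : 1 ≤ i)
    (hm : 1 ≤ m) (hT : T ∈ Ioo (0 : ℝ) 1) :
    IsNode i m q T ↔ ∃ lam θ, IsPrufer (fun x => q x - lam) θ ∧ θ T = i * Real.pi ∧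
      θ 1 = m * Real.pi := by
  have hT' : T ∈ Ioc (0 : ℝ) 1 := Ioo_subset_Ioc_self hT
  constructor
  · rintro ⟨lam, E, hn, hE, -, hET, hcard⟩
    have hP := isPrufer_pruferAngle_sub hq lam
    have hQ : IntervalIntegrable (fun x => q x - lam) volume 0 1 := hq.sub intervalIntegrable_const
    refine ⟨lam, _, hP, ?_, ((isNthEigenvalue_iff hq hP).1 hn).2⟩
    obtain ⟨n, hn1, hθ⟩ := hP.exists_nat_of_sin_eq_zero hQ hT'
      ((hE.eq_zero_iff hq hP (Ioc_subset_Icc_self hT')).1 hET)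
    have hz := hP.encard_zeros hQ hT' hn1 hθ
    have hset : {x | x ∈ Ioo 0 T ∧ E x = 0} =
        {x | x ∈ Ioo 0 T ∧ Real.sin (pruferAngle (fun x => q x - lam) x) = 0} := by
      ext x
      refine and_congr_right fun hx => ?_
      exact hE.eq_zero_iff hq hP ⟨hx.1.le, hx.2.le.trans hT.2.le⟩
    rw [hset, hz] at hcard
    have : n = i := by exact_mod_cast hcard
    rw [hθ, this]
  · rintro ⟨lam, θ, hP, hθT, hθ1⟩
    have hQ : IntervalIntegrable (fun x => q x - lam) volume 0 1 := hq.sub intervalIntegrable_const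
    have hE := hP.isEigenfunction hq (by rw [hθ1]; exact Real.sin_nat_mul_pi m)
    refine ⟨lam, _, (isNthEigenvalue_iff hq hP).2 ⟨hm, hθ1⟩, hE, hT, ?_, ?_⟩
    · simp [hθT]
    · rw [← hP.encard_zeros hQ hT' hi hθT]
      congr 3
      ext x
      refine and_congr_right fun hx => ?_
      exact hE.eq_zero_iff hq hP ⟨hx.1.le, hx.2.le.trans hT.2.le⟩

end Index

/-! ### First variation of the angle and node-preserving perturbations. -/

section Perturbation

variable {Q w θ : ℝ → ℝ}

theorem intervalIntegrable_of_bdd {M a b : ℝ} (hw : Measurable w) (hM : ∀ x, |w x| ≤ M) :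
    IntervalIntegrable w volume a b := by
  refine (intervalIntegrable_const (c := M)).mono_fun hw.aestronglyMeasurable ?_
  refine Eventually.of_forall fun x => ?_
  show |w x| ≤ |M|
  exact (hM x).trans (le_abs_self M)

/-- On an interval where the potentials agree the difference of the angles solves a homogeneous
linear equation. This confines the effect of a local perturbation to its support. -/
theorem IsPrufer.eqOn_of_eqOn {Q₁ Q₂ θ₁ θ₂ : ℝ → ℝ} (h₁ : IsPrufer Q₁ θ₁) (h₂ : IsPrufer Q₂ θ₂)
    (hQ : IntervalIntegrable Q₁ volume 0 1) {c d : ℝ} (hc : 0 ≤ c) (hcd : c ≤ d) (hd : d ≤ 1)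
    (hQe : ∀ x ∈ Ioo c d, Q₁ x = Q₂ x) (hθ : θ₁ c = θ₂ c) {x : ℝ} (hx : x ∈ Icc c d) :
    θ₁ x = θ₂ x := by
  have h := ((h₁.sub_hasAEDeriv h₂).mono hc hcd hd).congr_deriv
    (g₂ := fun x => IsPrufer.diffCoeff Q₁ θ₁ θ₂ x * (θ₁ x - θ₂ x))
    (Eventually.of_forall fun x hx => by rw [hQe x hx]; ring)
  exact sub_eq_zero.1 (h.eq_zero ((IsPrufer.diffCoeff_intervalIntegrable hQ h₁.continuousOn
    h₂.continuousOn).mono_Icc hc hcd hd) (sub_eq_zero.2 hθ) hx)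

theorem IsPrufer.tendsto_perturbation (h : IsPrufer Q θ) (hQ : IntervalIntegrable Q volume 0 1)
    {M : ℝ} (hw : Measurable w) (hM : ∀ x, |w x| ≤ M) {t : ℝ} (ht : t ∈ Icc (0 : ℝ) 1) :
    Tendsto (fun s => pruferAngle (fun x => Q x + s * w x) t) (𝓝[>] 0) (𝓝 (θ t)) := by
  have hwi : IntervalIntegrable w volume 0 1 := intervalIntegrable_of_bdd hw hM
  rw [tendsto_iff_dist_tendsto_zero]
  have hb : ∀ s, dist (pruferAngle (fun x => Q x + s * w x) t) (θ t) ≤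
      Real.exp (2 * ∫ t in (0 : ℝ)..1, (|Q t| + 1)) * (|s| * ∫ t in (0 : ℝ)..1, |w t|) := by
    intro s
    rw [dist_comm]
    have hQs : IntervalIntegrable (fun x => Q x + s * w x) volume 0 1 := hQ.add (hwi.const_mul s)
    refine (h.abs_sub_le (isPrufer_pruferAngle hQs) hQ hQs ht).trans_eq ?_
    simp [abs_mul]
  refine squeeze_zero (fun _ => dist_nonneg) hb ?_
  have : Tendsto (fun s : ℝ => Real.exp (2 * ∫ t in (0 : ℝ)..1, (|Q t| + 1)) *
      (|s| * ∫ t in (0 : ℝ)..1, |w t|)) (𝓝 0)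
      (𝓝 (Real.exp (2 * ∫ t in (0 : ℝ)..1, (|Q t| + 1)) * (|0| * ∫ t in (0 : ℝ)..1, |w t|))) := by
    apply Continuous.tendsto
    fun_prop
  rw [abs_zero, zero_mul, mul_zero] at this
  exact this.mono_left nhdsWithin_le_nhds

/-- When the two angles coincide the coefficient is -(Q + 1) sin 2θ, so its negated integral is
twice the exponent defining ρ; hence the limit ρ². The coefficients are dominated by |Q| + 1. -/
theorem IsPrufer.tendsto_integral_diffCoeff (h : IsPrufer Q θ)
    (hQ : IntervalIntegrable Q volume 0 1)
    {M : ℝ} (hw : Measurable w) (hM : ∀ x, |w x| ≤ M) {t : ℝ} (ht : t ∈ Icc (0 : ℝ) 1) :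
    Tendsto (fun s => Real.exp (-∫ x in (0 : ℝ)..t,
      IsPrufer.diffCoeff Q θ (pruferAngle (fun x => Q x + s * w x)) x)) (𝓝[>] 0)
      (𝓝 (pruferRadius Q θ t ^ 2)) := by
  have hwi : IntervalIntegrable w volume 0 1 := intervalIntegrable_of_bdd hw hM
  have e : pruferRadius Q θ t ^ 2 = Real.exp (-∫ x in (0 : ℝ)..t,
      (Q x + 1) * (-(Real.sinc (θ x - θ x) * Real.sin (θ x + θ x)))) := by
    rw [pruferRadius, ← Real.exp_nat_mul, ← intervalIntegral.integral_const_mul,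
      ← intervalIntegral.integral_neg]
    congr 1
    refine intervalIntegral.integral_congr fun x _ => ?_
    simp only [sub_self, Real.sinc_zero, one_mul, ← two_mul, Real.sin_two_mul]
    push_cast
    ring
  rw [e]
  refine (Real.continuous_exp.tendsto _).comp (Tendsto.neg ?_)
  refine intervalIntegral.tendsto_integral_filter_of_dominated_convergence (fun x => |Q x| + 1)
    (Eventually.of_forall fun s => ?_) (Eventually.of_forall fun s =>
      Eventually.of_forall fun x _ => IsPrufer.abs_diffCoeff_le _ _ _ x)
    ((hQ.abs.add intervalIntegrable_const).mono_Icc le_rfl ht.1 ht.2)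
    (Eventually.of_forall fun x hx => ?_)
  · have hQs : IntervalIntegrable (fun x => Q x + s * w x) volume 0 1 := hQ.add (hwi.const_mul s)
    exact (intervalIntegrable_iff.1 ((IsPrufer.diffCoeff_intervalIntegrable hQ h.continuousOn
      (isPrufer_pruferAngle hQs).continuousOn).mono_Icc le_rfl ht.1 ht.2)).aestronglyMeasurable
  · rw [uIoc_of_le ht.1] at hx
    have h1 := h.tendsto_perturbation hQ hw hM ⟨hx.1.le, hx.2.trans ht.2⟩
    have hc : Continuous fun v => (Q x + 1) * (-(Real.sinc (θ x - v) * Real.sin (θ x + v))) := by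
      have := Real.continuous_sinc
      fun_prop
    exact (hc.tendsto (θ x)).comp h1

/-- Up to a positive factor, the integral is the difference quotient of the angle at b
(`IsPrufer.sub_perturbation_eq`); its limit shows that to first order only ∫ w y² matters. -/
theorem IsPrufer.tendsto_first_variation (h : IsPrufer Q θ)
    (hQ : IntervalIntegrable Q volume 0 1)
    {M : ℝ} (hw : Measurable w) (hM : ∀ x, |w x| ≤ M) {b : ℝ} (hb : b ∈ Icc (0 : ℝ) 1) :
    Tendsto (fun s => ∫ t in (0 : ℝ)..b, Real.exp (-∫ x in (0 : ℝ)..t,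
      IsPrufer.diffCoeff Q θ (pruferAngle (fun x => Q x + s * w x)) x) *
        (w t * Real.sin (pruferAngle (fun x => Q x + s * w x) t) ^ 2)) (𝓝[>] 0)
      (𝓝 (∫ t in (0 : ℝ)..b, w t * (pruferRadius Q θ t * Real.sin (θ t)) ^ 2)) := by
  have hwi : IntervalIntegrable w volume 0 1 := intervalIntegrable_of_bdd hw hM
  have hM0 : 0 ≤ M := (abs_nonneg _).trans (hM 0)
  refine intervalIntegral.tendsto_integral_filter_of_dominated_convergence
    (fun _ => Real.exp (∫ t in (0 : ℝ)..1, (|Q t| + 1)) * M)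
    (Eventually.of_forall fun s => ?_) (Eventually.of_forall fun s =>
      Eventually.of_forall fun t ht => ?_) intervalIntegrable_const
    (Eventually.of_forall fun t ht => ?_)
  · have hQs : IntervalIntegrable (fun x => Q x + s * w x) volume 0 1 := hQ.add (hwi.const_mul s)
    have hP := isPrufer_pruferAngle hQs
    have hA := (hasAEDeriv_integral zero_le_one (IsPrufer.diffCoeff_intervalIntegrable hQ
      h.continuousOn hP.continuousOn)).continuousOn
    have hPc := hP.continuousOn
    have := intervalIntegrable_mul_of_continuousOn zero_le_one hwi
      (s := fun t => Real.exp (-∫ x in (0 : ℝ)..t,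
      IsPrufer.diffCoeff Q θ (pruferAngle (fun x => Q x + s * w x)) x) *
        Real.sin (pruferAngle (fun x => Q x + s * w x) t) ^ 2) (by fun_prop)
    refine (intervalIntegrable_iff.1 (this.mono_Icc le_rfl hb.1 hb.2)).aestronglyMeasurable.congr
      (Eventually.of_forall fun t => ?_)
    simp only
    ring
  · rw [uIoc_of_le hb.1] at ht
    have ht1 : t ∈ Icc (0 : ℝ) 1 := ⟨ht.1.le, ht.2.trans hb.2⟩
    have hA := abs_le.1 (IsPrufer.abs_integral_diffCoeff_le (θ₁ := θ)
      (θ₂ := pruferAngle (fun x => Q x + s * w x)) hQ ht1)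
    rw [Real.norm_eq_abs, abs_mul, abs_of_pos (Real.exp_pos _), abs_mul,
      abs_of_nonneg (sq_nonneg (Real.sin _))]
    refine mul_le_mul (Real.exp_le_exp.2 (by linarith [hA.1])) ?_ (by positivity)
      (Real.exp_pos _).le
    exact (mul_le_of_le_one_right (abs_nonneg _) (Real.sin_sq_le_one _)).trans (hM t)
  · rw [uIoc_of_le hb.1] at ht
    have ht1 : t ∈ Icc (0 : ℝ) 1 := ⟨ht.1.le, ht.2.trans hb.2⟩
    have h1 := h.tendsto_integral_diffCoeff hQ hw hM ht1
    have h2 := h.tendsto_perturbation hQ hw hM ht1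
    have h3 := (Real.continuous_sin.tendsto (θ t)).comp h2
    convert h1.mul ((tendsto_const_nhds (x := w t)).mul (h3.pow 2)) using 2
    · rfl
    · ring

theorem IsPrufer.sub_perturbation_eq (h : IsPrufer Q θ) (hQ : IntervalIntegrable Q volume 0 1)
    (hwi : IntervalIntegrable w volume 0 1) {b : ℝ} (hb : b ∈ Icc (0 : ℝ) 1) (s : ℝ) :
    ∃ k > 0, θ b - pruferAngle (fun x => Q x + s * w x) b = s * (k *
      ∫ t in (0 : ℝ)..b, Real.exp (-∫ x in (0 : ℝ)..t,
      IsPrufer.diffCoeff Q θ (pruferAngle (fun x => Q x + s * w x)) x) *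
        (w t * Real.sin (pruferAngle (fun x => Q x + s * w x) t) ^ 2)) := by
  have hQs : IntervalIntegrable (fun x => Q x + s * w x) volume 0 1 := hQ.add (hwi.const_mul s)
  refine ⟨_, Real.exp_pos (∫ t in (0 : ℝ)..b,
    IsPrufer.diffCoeff Q θ (pruferAngle fun x => Q x + s * w x) t), (h.sub_eq (isPrufer_pruferAngle hQs) hQ hb).trans ?_⟩
  rw [mul_left_comm s, ← intervalIntegral.integral_const_mul s]
  congr 1
  refine intervalIntegral.integral_congr fun t _ => ?_
  ring

theorem IsPrufer.eventually_perturbation_lt (h : IsPrufer Q θ)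
    (hQ : IntervalIntegrable Q volume 0 1)
    {M : ℝ} (hw : Measurable w) (hM : ∀ x, |w x| ≤ M) {b : ℝ} (hb : b ∈ Icc (0 : ℝ) 1)
    (hpos : 0 < ∫ t in (0 : ℝ)..b, w t * (pruferRadius Q θ t * Real.sin (θ t)) ^ 2) :
    ∀ᶠ s in 𝓝[>] 0, pruferAngle (fun x => Q x + s * w x) b < θ b := by
  filter_upwards [(h.tendsto_first_variation hQ hw hM hb).eventually (lt_mem_nhds hpos),
    self_mem_nhdsWithin] with s hs hs0
  obtain ⟨k, hk, e⟩ := h.sub_perturbation_eq hQ (intervalIntegrable_of_bdd hw hM) hb s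
  rw [← sub_pos, e]
  exact mul_pos hs0 (mul_pos hk hs)

theorem IsPrufer.eventually_lt_perturbation (h : IsPrufer Q θ)
    (hQ : IntervalIntegrable Q volume 0 1)
    {M : ℝ} (hw : Measurable w) (hM : ∀ x, |w x| ≤ M) {b : ℝ} (hb : b ∈ Icc (0 : ℝ) 1)
    (hneg : ∫ t in (0 : ℝ)..b, w t * (pruferRadius Q θ t * Real.sin (θ t)) ^ 2 < 0) :
    ∀ᶠ s in 𝓝[>] 0, θ b < pruferAngle (fun x => Q x + s * w x) b := by
  filter_upwards [(h.tendsto_first_variation hQ hw hM hb).eventually (gt_mem_nhds hneg),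
    self_mem_nhdsWithin] with s hs hs0
  obtain ⟨k, hk, e⟩ := h.sub_perturbation_eq hQ (intervalIntegrable_of_bdd hw hM) hb s
  rw [← sub_neg, e]
  exact mul_neg_of_pos_of_neg hs0 (mul_neg_of_pos_of_neg hk hs)

/-- A bounded function on `(a,b]`, extended by zero. -/
def localBump (a b : ℝ) (v : ℝ → ℝ) (c : ℝ) : ℝ → ℝ := (Ioc a b).indicator fun t => v t + c

theorem localBump_measurable {a b : ℝ} {v : ℝ → ℝ} (hv : Measurable v) (c : ℝ) :
    Measurable (localBump a b v c) :=
  (hv.add_const c).indicator measurableSet_Ioc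

theorem abs_localBump_le {a b M : ℝ} {v : ℝ → ℝ} (hM : ∀ x, |v x| ≤ M) (c x : ℝ) :
    |localBump a b v c x| ≤ M + |c| := by
  unfold localBump
  by_cases hx : x ∈ Ioc a b
  · rw [indicator_of_mem hx]
    exact (abs_add_le _ _).trans (by linarith [hM x])
  · rw [indicator_of_notMem hx, abs_zero]
    linarith [(abs_nonneg _).trans (hM x), abs_nonneg c]

theorem integral_localBump_mul {a b : ℝ} {v Y : ℝ → ℝ} (ha : 0 ≤ a) (hab : a ≤ b)
    (c : ℝ) :
    ∫ t in (0 : ℝ)..b, localBump a b v c t * Y t = ∫ t in a..b, (v t + c) * Y t := by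
  rw [intervalIntegral.integral_of_le (ha.trans hab), intervalIntegral.integral_of_le hab]
  have : (fun t => localBump a b v c t * Y t) = (Ioc a b).indicator fun t => (v t + c) * Y t := by
    ext t
    by_cases ht : t ∈ Ioc a b
    · simp [localBump, indicator_of_mem ht]
    · simp [localBump, indicator_of_notMem ht]
  rw [this, setIntegral_indicator measurableSet_Ioc,
    inter_eq_right.2 (Ioc_subset_Ioc_left ha)]

/-- The solution and its derivative, ρ sin θ and ρ cos θ, never vanish together, so the solution is
nonzero somewhere on every nondegenerate interval. -/
theorem IsPrufer.integral_sin_sq_pos (h : IsPrufer Q θ) (hQ : IntervalIntegrable Q volume 0 1)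
    {a b : ℝ} (ha : 0 ≤ a) (hab : a < b) (hb : b ≤ 1) :
    0 < ∫ t in a..b, (pruferRadius Q θ t * Real.sin (θ t)) ^ 2 := by
  have hy := ((h.sin_hasAEDeriv hQ).mono ha hab.le hb)
  have hyc := hy.continuousOn
  have hd := ((h.sin_hasDerivWithinAt hQ ⟨ha, hab.le.trans hb⟩).mono (Icc_subset_Icc ha hb))
  obtain ⟨x, hx, hne⟩ : ∃ x ∈ Icc a b, pruferRadius Q θ x * Real.sin (θ x) ≠ 0 := by
    by_cases h0 : pruferRadius Q θ a * Real.sin (θ a) = 0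
    · refine exists_ne_zero_of_hasDerivWithinAt (z := fun x => pruferRadius Q θ x *
        Real.cos (θ x)) hab hd ?_
      have hs : Real.sin (θ a) = 0 := (mul_eq_zero.1 h0).resolve_left (pruferRadius_pos _ _ _).ne'
      have := Real.sin_sq_add_cos_sq (θ a)
      refine mul_ne_zero (pruferRadius_pos _ _ _).ne' fun hc => ?_
      rw [hs, hc] at this
      norm_num at this
    · exact ⟨a, left_mem_Icc.2 hab.le, h0⟩
  exact intervalIntegral.integral_pos hab (hyc.pow 2) (fun t _ => sq_nonneg _)
    ⟨x, hx, by positivity⟩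

/-- A bounded perturbation of first order zero can be corrected by a small constant so that the
Prüfer angle is unchanged outside `(a,b)`. -/
theorem IsPrufer.exists_perturbation (h : IsPrufer Q θ) (hQ : IntervalIntegrable Q volume 0 1)
    {a b M : ℝ} (ha : 0 ≤ a) (hab : a < b) (hb : b ≤ 1) {v : ℝ → ℝ} (hv : Measurable v)
    (hM : ∀ x, |v x| ≤ M)
    (hv0 : ∫ t in a..b, v t * (pruferRadius Q θ t * Real.sin (θ t)) ^ 2 = 0) {δ : ℝ}
    (hδ : 0 < δ) :
    ∀ᶠ s in 𝓝[>] 0, ∃ c ∈ Icc (-δ) δ, ∃ θ', IsPrufer (fun x => Q x + s * localBump a b v c x) θ' ∧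
      ∀ x ∈ Icc (0 : ℝ) 1, x ≤ a ∨ b ≤ x → θ' x = θ x := by
  have hb1 : b ∈ Icc (0 : ℝ) 1 := ⟨ha.trans hab.le, hb⟩
  have hyc := ((h.sin_hasAEDeriv hQ).mono ha hab.le hb).continuousOn
  have hint : ∀ c, ∫ t in (0 : ℝ)..b, localBump a b v c t *
      (pruferRadius Q θ t * Real.sin (θ t)) ^ 2 =
      c * ∫ t in a..b, (pruferRadius Q θ t * Real.sin (θ t)) ^ 2 := by
    intro c
    rw [integral_localBump_mul ha hab.le, ← intervalIntegral.integral_const_mul]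
    simp only [add_mul]
    rw [intervalIntegral.integral_add _ _, hv0, zero_add]
    · exact intervalIntegrable_mul_of_continuousOn hab.le (intervalIntegrable_of_bdd hv hM)
        (hyc.pow 2)
    · exact ((hyc.pow 2).intervalIntegrable_of_Icc hab.le).const_mul c
  have hI := h.integral_sin_sq_pos hQ ha hab hb
  have hmeas := fun c => localBump_measurable (a := a) (b := b) hv c
  have hbd := fun c => abs_localBump_le (a := a) (b := b) hM c
  -- Since v itself contributes nothing to first order, adding ±δ on (a,b] makes the first variation
  -- ±δ ∫ y². For small s the angle at b then falls on either side of θ b, and some c in [-δ,δ] hits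
  -- it exactly by continuity in c.
  have hlo := h.eventually_perturbation_lt hQ (hmeas δ) (hbd δ) hb1
    (by rw [hint]; exact mul_pos hδ hI)
  have hhi := h.eventually_lt_perturbation hQ (hmeas (-δ)) (hbd (-δ)) hb1
    (by rw [hint]; exact mul_neg_of_neg_of_pos (neg_neg_of_pos hδ) hI)
  filter_upwards [hlo, hhi] with s hs1 hs2
  have hQs : ∀ c, IntervalIntegrable (fun x => Q x + s * localBump a b v c x) volume 0 1 :=
    fun c => hQ.add ((intervalIntegrable_of_bdd (hmeas c) (hbd c)).const_mul s)
  have hcont : Continuous fun c => pruferAngle (fun x => Q x + s * localBump a b v c x) b := by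
    rw [continuous_iff_continuousAt]
    intro c
    rw [ContinuousAt, tendsto_iff_dist_tendsto_zero]
    set K := Real.exp (2 * ∫ t in (0 : ℝ)..1, (|Q t + s * localBump a b v c t| + 1)) with hK
    have hle : ∀ d, dist (pruferAngle (fun x => Q x + s * localBump a b v d x) b)
        (pruferAngle (fun x => Q x + s * localBump a b v c x) b) ≤ K * (|s| * |d - c|) := by
      intro d
      rw [dist_comm]
      refine ((isPrufer_pruferAngle (hQs c)).abs_sub_le (isPrufer_pruferAngle (hQs d)) (hQs c)
        (hQs d) hb1).trans (mul_le_mul_of_nonneg_left ?_ (Real.exp_pos _).le)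
      calc _ ≤ ∫ t in (0 : ℝ)..1, |s| * |d - c| := by
            refine intervalIntegral.integral_mono_on zero_le_one ((hQs d).sub (hQs c)).abs
              intervalIntegrable_const fun t _ => ?_
            rw [add_sub_add_left_eq_sub, ← mul_sub, abs_mul]
            refine mul_le_mul_of_nonneg_left ?_ (abs_nonneg _)
            unfold localBump
            by_cases ht : t ∈ Ioc a b
            · simp [indicator_of_mem ht]
            · simp [indicator_of_notMem ht]
        _ = _ := by simp
    refine squeeze_zero (fun _ => dist_nonneg) hle ?_
    have : Tendsto (fun d => K * (|s| * |d - c|)) (𝓝 c) (𝓝 (K * (|s| * |c - c|))) := by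
      apply Continuous.tendsto
      fun_prop
    simpa using this
  obtain ⟨c, hc, hce⟩ := intermediate_value_Icc' (neg_le_self hδ.le) hcont.continuousOn
    (show θ b ∈ Icc _ _ from ⟨hs1.le, hs2.le⟩)
  have hP := isPrufer_pruferAngle (hQs c)
  refine ⟨c, hc, _, hP, fun x hx hor => ?_⟩
  -- Before a the equations and the initial values agree; after b the equations agree again, and c
  -- was chosen so that the values at b agree.
  rcases hor with hxa | hbx
  · refine hP.eqOn_of_eqOn h (hQs c) le_rfl ha (hab.le.trans hb) (fun t ht => ?_)
      (by rw [hP.zero, h.zero]) ⟨hx.1, hxa⟩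
    simp [localBump, indicator_of_notMem (fun h : t ∈ Ioc a b => absurd h.1 (not_lt.2 ht.2.le))]
  · refine hP.eqOn_of_eqOn h (hQs c) hb1.1 hb le_rfl (fun t ht => ?_) hce ⟨hbx, hx.2⟩
    simp [localBump, indicator_of_notMem (fun h : t ∈ Ioc a b => absurd h.2 (not_le.2 ht.1))]

end Perturbation

/-! ### The odd power |x|^(p-2) x and the tangent inequality. -/

section OddPower

variable {p : ℝ}

/-- The derivative of `|x|^p / p`. -/
def oddPow (p x : ℝ) : ℝ := |x| ^ (p - 2) * x

theorem hasDerivAt_abs_rpow_oddPow (hp : 1 < p) (x : ℝ) :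
    HasDerivAt (fun x => |x| ^ p) (p * oddPow p x) x := by
  rw [oddPow, ← mul_assoc]
  exact hasDerivAt_abs_rpow x hp

/-- For p < 2 the factor |x|^(p-2) is singular at 0, so continuity is taken from the fact that |x|^p
is C¹. -/
theorem continuous_oddPow (hp : 1 < p) : Continuous (oddPow p) := by
  have h1 : Continuous (deriv fun x : ℝ => ‖x‖ ^ p) :=
    (contDiff_norm_rpow hp).continuous_deriv le_rfl
  have h2 : (deriv fun x : ℝ => ‖x‖ ^ p) = fun x => p * oddPow p x := by
    ext x
    exact (hasDerivAt_abs_rpow_oddPow hp x).deriv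
  rw [h2] at h1
  have h3 : oddPow p = fun x => p⁻¹ * (p * oddPow p x) := by
    ext x
    field_simp
  rw [h3]
  exact h1.const_mul _

theorem oddPow_zero (p : ℝ) : oddPow p 0 = 0 := by simp [oddPow]

theorem oddPow_of_nonneg (hp : 1 < p) {x : ℝ} (hx : 0 ≤ x) : oddPow p x = x ^ (p - 1) := by
  rcases hx.eq_or_lt with rfl | h
  · rw [oddPow_zero, Real.zero_rpow (by linarith)]
  · rw [oddPow, abs_of_pos h]
    nth_rewrite 2 [← Real.rpow_one x]
    rw [← Real.rpow_add h]
    congr 1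
    ring

theorem oddPow_neg (p x : ℝ) : oddPow p (-x) = -oddPow p x := by simp [oddPow]

theorem abs_oddPow (hp : 1 < p) (x : ℝ) : |oddPow p x| = |x| ^ (p - 1) := by
  rw [← oddPow_of_nonneg hp (abs_nonneg x)]
  rw [oddPow, oddPow, abs_mul, abs_abs, abs_of_nonneg (Real.rpow_nonneg (abs_nonneg x) _)]

theorem oddPow_mul_self (hp : 1 < p) (x : ℝ) : oddPow p x * x = |x| ^ p := by
  by_cases hx : x = 0
  · simp [hx, oddPow, Real.zero_rpow (by linarith : p ≠ 0)]
  · have h : 0 < |x| := abs_pos.2 hx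
    have : |x| ^ p = |x| ^ (p - 2) * |x| ^ (2 : ℝ) := by
      rw [← Real.rpow_add h]; congr 1; ring
    rw [this, oddPow, mul_assoc, Real.rpow_two, sq_abs, sq]

/-- The tangent inequality for the convex function `|x|^p`. -/
theorem abs_rpow_le_add (hp : 1 < p) (x y : ℝ) :
    |y| ^ p ≤ |x| ^ p + p * (oddPow p y * (y - x)) := by
  have hc := Real.HolderConjugate.conjExponent hp
  -- Young's inequality for x and |y|^(p-2) y is the tangent inequality in disguise, because the
  -- conjugate power of the second factor is |y|^p.
  have h := Real.young_inequality x (oddPow p y) hc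
  rw [abs_oddPow hp, ← Real.rpow_mul (abs_nonneg y)] at h
  have e : (p - 1) * p.conjExponent = p := by
    rw [Real.conjExponent]
    field_simp [(by linarith : p - 1 ≠ 0)]
  rw [e] at h
  have hs := oddPow_mul_self hp y
  have hinv : |y| ^ p / p.conjExponent = |y| ^ p - |y| ^ p / p := by
    have := hc.inv_add_inv_eq_one
    rw [div_eq_mul_inv, div_eq_mul_inv]
    linear_combination (|y| ^ p) * this
  rw [hinv] at h
  have h2 : p * (x * oddPow p y) ≤ p * (|x| ^ p / p + (|y| ^ p - |y| ^ p / p)) :=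
    mul_le_mul_of_nonneg_left h (by linarith)
  have h3 : p * (|x| ^ p / p + (|y| ^ p - |y| ^ p / p)) = |x| ^ p + (p - 1) * |y| ^ p := by
    field_simp
  nlinarith

end OddPower

/-! ### Differentiating the L^p norm along perturbations. -/

section Potentials

variable {p : ℝ}

theorem ofReal_ne_zero_of_one_lt (hp : 1 < p) : ENNReal.ofReal p ≠ 0 := by
  simp; linarith

theorem Potential.memLp (q : Potential p) :
    MemLp q (ENNReal.ofReal p) (volume.restrict (Icc (0 : ℝ) 1)) := Lp.memLp q

theorem Potential.norm_rpow (hp : 1 < p) (q : Potential p) :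
    ‖q‖ ^ p = ∫ x in Icc (0 : ℝ) 1, |q x| ^ p := by
  have h0 : 0 ≤ ∫ x in Icc (0 : ℝ) 1, |q x| ^ p :=
    integral_nonneg fun x => Real.rpow_nonneg (abs_nonneg _) _
  have h := (Potential.memLp q).eLpNorm_eq_integral_rpow_norm (ofReal_ne_zero_of_one_lt hp)
    ENNReal.ofReal_ne_top
  simp only [ENNReal.toReal_ofReal (by linarith : 0 ≤ p), Real.norm_eq_abs] at h
  rw [Lp.norm_def, h, ENNReal.toReal_ofReal (Real.rpow_nonneg h0 _),
    Real.rpow_inv_rpow h0 (by linarith)]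

theorem Potential.integrable_rpow (hp : 1 < p) (q : Potential p) :
    Integrable (fun x => |q x| ^ p) (volume.restrict (Icc (0 : ℝ) 1)) := by
  have h := (Potential.memLp q).integrable_norm_rpow (ofReal_ne_zero_of_one_lt hp)
    ENNReal.ofReal_ne_top
  simpa only [ENNReal.toReal_ofReal (by linarith : 0 ≤ p), Real.norm_eq_abs] using h

theorem one_le_ofReal (hp : 1 < p) : 1 ≤ ENNReal.ofReal p := by
  rw [ENNReal.one_le_ofReal]
  exact hp.le

theorem Potential.integrable (hp : 1 < p) (q : Potential p) :
    Integrable q (volume.restrict (Icc (0 : ℝ) 1)) :=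
  (Potential.memLp q).integrable (one_le_ofReal hp)

theorem Potential.intervalIntegrable (hp : 1 < p) (q : Potential p) :
    IntervalIntegrable q volume 0 1 := by
  rw [intervalIntegrable_iff_integrableOn_Icc_of_le zero_le_one]
  exact Potential.integrable hp q

theorem memLp_of_bdd {w : ℝ → ℝ} {M : ℝ} (hw : Measurable w) (hM : ∀ x, |w x| ≤ M) :
    MemLp w (ENNReal.ofReal p) (volume.restrict (Icc (0 : ℝ) 1)) :=
  MemLp.of_bound hw.aestronglyMeasurable M (Eventually.of_forall hM)

theorem Potential.exists_add (q : Potential p) {w : ℝ → ℝ} {M : ℝ} (hw : Measurable w)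
    (hM : ∀ x, |w x| ≤ M) (s : ℝ) :
    ∃ r : Potential p, ∀ᵐ x ∂(volume.restrict (Icc (0 : ℝ) 1)), r x = q x + s * w x := by
  refine ⟨q + ((memLp_of_bdd hw hM).const_mul s).toLp, ?_⟩
  filter_upwards [Lp.coeFn_add q ((memLp_of_bdd (p := p) hw hM).const_mul s).toLp,
    ((memLp_of_bdd (p := p) hw hM).const_mul s).coeFn_toLp] with x h1 h2
  rw [h1, Pi.add_apply, h2]

theorem Potential.integrable_oddPow (hp : 1 < p) (q : Potential p) :
    Integrable (fun x => oddPow p (q x)) (volume.restrict (Icc (0 : ℝ) 1)) := by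
  have hb : Integrable (fun x => |q x| ^ p + 1) (volume.restrict (Icc (0 : ℝ) 1)) :=
    (Potential.integrable_rpow hp q).add (integrable_const 1)
  refine hb.mono' ((continuous_oddPow hp).comp_aestronglyMeasurable
    (Potential.memLp q).aestronglyMeasurable) (Eventually.of_forall fun x => ?_)
  rw [Real.norm_eq_abs, abs_oddPow hp]
  rcases le_total (|q x|) 1 with h | h
  · have h1 : |q x| ^ (p - 1) ≤ 1 := Real.rpow_le_one (abs_nonneg _) h (by linarith)
    have h2 : 0 ≤ |q x| ^ p := Real.rpow_nonneg (abs_nonneg _) _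
    linarith
  · have := Real.rpow_le_rpow_of_exponent_le h (by linarith : p - 1 ≤ p)
    linarith

/-- First order optimality along a sequence of admissible perturbations. -/
theorem integral_oddPow_mul_nonneg (hp : 1 < p) (q : Potential p) {w : ℕ → ℝ → ℝ} {w₀ : ℝ → ℝ}
    {s : ℕ → ℝ} {M : ℝ} (hw : ∀ n, Measurable (w n)) (hM : ∀ n x, |w n x| ≤ M)
    (hlim : ∀ x, Tendsto (fun n => w n x) atTop (𝓝 (w₀ x))) (hs : ∀ n, 0 < s n)
    (hs0 : Tendsto s atTop (𝓝 0))
    (hmin : ∀ n, ∀ r : Potential p, (∀ᵐ x ∂(volume.restrict (Icc (0 : ℝ) 1)),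
      r x = q x + s n * w n x) → ‖q‖ ≤ ‖r‖) :
    0 ≤ ∫ x in Icc (0 : ℝ) 1, oddPow p (q x) * w₀ x := by
  set μ := volume.restrict (Icc (0 : ℝ) 1) with hμ
  have hM0 : 0 ≤ M := (abs_nonneg _).trans (hM 0 0)
  obtain ⟨S, hS⟩ : ∃ S, ∀ n, |s n| ≤ S := by
    obtain ⟨S, hS⟩ := (Metric.isBounded_range_of_tendsto s hs0).exists_norm_le
    exact ⟨S, fun n => hS _ (mem_range_self n)⟩
  have hS0 : 0 ≤ S := (abs_nonneg _).trans (hS 0)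
  have hqm := (Potential.memLp q).aestronglyMeasurable
  -- The tangent is taken at the perturbed potential, not at q: then minimality gives a sign for
  -- each n before any limit, and p·s_n can be divided out.
  have hterm : ∀ n, 0 ≤ ∫ x, oddPow p (q x + s n * w n x) * w n x ∂μ := by
    intro n
    obtain ⟨r, hr⟩ := Potential.exists_add q (hw n) (hM n) (s n)
    have hq0 : 0 ≤ ‖q‖ := ENNReal.toReal_nonneg
    have h1 : ‖q‖ ^ p ≤ ‖r‖ ^ p := Real.rpow_le_rpow hq0 (hmin n r hr) (by linarith)
    rw [Potential.norm_rpow hp, Potential.norm_rpow hp] at h1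
    have hint : Integrable (fun x => oddPow p (r x) * w n x) μ :=
      (Potential.integrable_oddPow hp r).mul_bdd (hw n).aestronglyMeasurable
        (Eventually.of_forall (hM n))
    have h2 : ∫ x, |r x| ^ p ∂μ ≤ ∫ x, (|q x| ^ p + p * (s n * (oddPow p (r x) * w n x))) ∂μ := by
      refine integral_mono_ae (Potential.integrable_rpow hp r)
        ((Potential.integrable_rpow hp q).add ((hint.const_mul _).const_mul _)) ?_
      filter_upwards [hr] with x hx
      have := abs_rpow_le_add hp (q x) (r x)
      rw [show r x - q x = s n * w n x by rw [hx]; ring] at this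
      refine this.trans_eq ?_
      ring
    rw [integral_add (Potential.integrable_rpow hp q) ((hint.const_mul _).const_mul _),
      integral_const_mul, integral_const_mul] at h2
    have h3 : 0 ≤ p * (s n * ∫ x, oddPow p (r x) * w n x ∂μ) := by linarith
    have h4 : ∫ x, oddPow p (q x + s n * w n x) * w n x ∂μ = ∫ x, oddPow p (r x) * w n x ∂μ := by
      refine integral_congr_ae ?_
      filter_upwards [hr] with x hx
      rw [hx]
    rw [h4]
    exact nonneg_of_mul_nonneg_right (nonneg_of_mul_nonneg_right h3 (by linarith)) (hs n)
  -- The function |q| + SM is again in L^p, so its (p - 1)-st power is integrable; it dominates all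
  -- the integrands.
  have hdom : Integrable (fun x => (|q x| + S * M) ^ (p - 1) * M) μ := by
    obtain ⟨r, hr⟩ := Potential.exists_add (p := p) ((Potential.memLp q).norm.toLp)
      (w := fun _ => M) (M := M) measurable_const (fun _ => (abs_of_nonneg hM0).le) S
    refine ((Potential.integrable_oddPow hp r).mul_const M).congr ?_
    filter_upwards [hr, (Potential.memLp q).norm.coeFn_toLp] with x hx hx'
    rw [hx, hx', Real.norm_eq_abs, oddPow_of_nonneg hp (by positivity)]
  refine ge_of_tendsto' (tendsto_integral_of_dominated_convergence _ (fun n => ?_) hdom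
    (fun n => Eventually.of_forall fun x => ?_) (Eventually.of_forall fun x => ?_)) hterm
  · exact ((continuous_oddPow hp).comp_aestronglyMeasurable
      (hqm.add ((hw n).aestronglyMeasurable.const_mul _))).mul (hw n).aestronglyMeasurable
  · rw [Real.norm_eq_abs, abs_mul, abs_oddPow hp]
    refine mul_le_mul (Real.rpow_le_rpow (abs_nonneg _) ?_ (by linarith)) (hM n x)
      (abs_nonneg _) (Real.rpow_nonneg (by positivity) _)
    refine (abs_add_le _ _).trans ?_
    rw [abs_mul]
    have := mul_le_mul (hS n) (hM n x) (abs_nonneg _) hS0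
    linarith
  · have h1 : Tendsto (fun n => q x + s n * w n x) atTop (𝓝 (q x + 0 * w₀ x)) :=
      (hs0.mul (hlim x)).const_add _
    rw [zero_mul, add_zero] at h1
    exact (((continuous_oddPow hp).tendsto _).comp h1).mul (hlim x)

end Potentials

/-- A function orthogonal to every bounded function orthogonal to `Y` is a multiple of `Y`. -/
theorem ae_eq_const_mul_of_orthogonal {a b : ℝ} (hab : a ≤ b) {G Y : ℝ → ℝ}
    (hG : IntervalIntegrable G volume a b) (hY : IntervalIntegrable Y volume a b)
    (hI : 0 < ∫ t in a..b, Y t)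
    (h : ∀ v : ℝ → ℝ, Measurable v → (∃ M, ∀ x, |v x| ≤ M) → ∫ t in a..b, v t * Y t = 0 →
      ∫ t in a..b, G t * v t = 0) :
    ∃ k, ∀ᵐ t ∂(volume.restrict (Ioc a b)), G t = k * Y t := by
  set I := ∫ t in a..b, Y t with hIdef
  set k := (∫ t in a..b, G t) / I with hk
  refine ⟨k, ?_⟩
  have hG' : Integrable G (volume.restrict (Ioc a b)) := by
    rwa [intervalIntegrable_iff_integrableOn_Ioc_of_le hab] at hG
  have hY' : Integrable Y (volume.restrict (Ioc a b)) := by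
    rwa [intervalIntegrable_iff_integrableOn_Ioc_of_le hab] at hY
  have key := (hG'.sub (hY'.const_mul k)).ae_eq_zero_of_forall_setIntegral_eq_zero ?_
  · filter_upwards [key] with t ht
    exact sub_eq_zero.1 ht
  intro s hs _
  set c := (∫ t in s, Y t ∂(volume.restrict (Ioc a b))) / I with hc
  set v : ℝ → ℝ := fun t => s.indicator (fun _ => (1 : ℝ)) t - c with hv
  have hmul : ∀ (F : ℝ → ℝ), IntervalIntegrable F volume a b →
      Integrable F (volume.restrict (Ioc a b)) → ∫ t in a..b, F t * v t =
      (∫ t in s, F t ∂(volume.restrict (Ioc a b))) - c * ∫ t in a..b, F t := by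
    intro F hF hF'
    have e : (fun t => F t * v t) = fun t => s.indicator F t - c * F t := by
      ext t
      by_cases ht : t ∈ s <;> simp [hv, ht] <;> ring
    rw [e, intervalIntegral.integral_of_le hab, integral_sub (hF'.indicator hs) (hF'.const_mul c),
      integral_indicator hs, integral_const_mul, intervalIntegral.integral_of_le hab]
  have hvm : Measurable v := (measurable_const.indicator hs).sub_const c
  have hvb : ∃ M, ∀ x, |v x| ≤ M := by
    refine ⟨1 + |c|, fun x => ?_⟩
    refine (abs_sub _ _).trans (add_le_add_left ?_ _)
    by_cases hx : x ∈ s <;> simp [hx]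
  have h0 : ∫ t in a..b, v t * Y t = 0 := by
    have := hmul Y hY hY'
    rw [← hIdef, hc, div_mul_cancel₀ _ hI.ne', sub_self] at this
    rw [← this]
    exact intervalIntegral.integral_congr fun t _ => mul_comm _ _
  have h1 := h v hvm hvb h0
  rw [hmul G hG hG'] at h1
  have e1 : ∫ t in s, (G t - k * Y t) ∂(volume.restrict (Ioc a b)) =
      (∫ t in s, G t ∂(volume.restrict (Ioc a b))) -
        k * ∫ t in s, Y t ∂(volume.restrict (Ioc a b)) := by
    rw [integral_sub hG'.integrableOn (hY'.const_mul k).integrableOn, integral_const_mul]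
  refine e1.trans ?_
  rw [← h1, hk, hc]
  ring

/-! ### Euler–Lagrange equation of an optimal potential. -/

section Optimal

variable {p T lam : ℝ} {i m : ℕ} {q : Potential p} {θ : ℝ → ℝ}

theorem IsOptimal.norm_le (h : IsOptimal p i m T 0 q) {r : Potential p} (hr : IsNode i m r T) :
    ‖q‖ ≤ ‖r‖ := by
  have := h.2 r hr
  rwa [sub_zero, sub_zero] at this

theorem ae_Ioo_of_ae_restrict {P : ℝ → Prop}
    (h : ∀ᵐ x ∂(volume.restrict (Icc (0 : ℝ) 1)), P x) :
    ∀ᵐ x, x ∈ Ioo (0 : ℝ) 1 → P x := by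
  rw [ae_restrict_iff' measurableSet_Icc] at h
  filter_upwards [h] with x hx hm
  exact hx (Ioo_subset_Icc_self hm)

theorem isNode_of_isPrufer (hp : 1 < p) (hi : 1 ≤ i) (hm : 1 ≤ m) (hT : T ∈ Ioo (0 : ℝ) 1)
    {r : Potential p} {Q : ℝ → ℝ} (h : IsPrufer Q θ)
    (hQ : ∀ᵐ x ∂(volume.restrict (Icc (0 : ℝ) 1)), Q x = r x - lam) (hθT : θ T = i * Real.pi)
    (hθ1 : θ 1 = m * Real.pi) : IsNode i m r T :=
  (isNode_iff (Potential.intervalIntegrable hp r) hi hm hT).2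
    ⟨lam, θ, h.congr_ae (ae_Ioo_of_ae_restrict hQ), hθT, hθ1⟩

theorem integral_mul_localBump {a b : ℝ} {v G : ℝ → ℝ} (ha : 0 ≤ a) (hab : a ≤ b) (hb : b ≤ 1) :
    ∫ t in Icc (0 : ℝ) 1, G t * localBump a b v 0 t = ∫ t in a..b, G t * v t := by
  rw [intervalIntegral.integral_of_le hab, integral_Icc_eq_integral_Ioc]
  have : (fun t => G t * localBump a b v 0 t) = (Ioc a b).indicator fun t => G t * v t := by
    ext t
    by_cases ht : t ∈ Ioc a b <;> simp [localBump, ht]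
  rw [this, setIntegral_indicator measurableSet_Ioc, inter_eq_right.2 (Ioc_subset_Ioc ha hb)]

/-- Optimality forces orthogonality to the admissible directions. -/
theorem IsOptimal.integral_mul_nonneg (hp : 1 < p) (hi : 1 ≤ i) (hm : 1 ≤ m)
    (hT : T ∈ Ioo (0 : ℝ) 1) (h : IsOptimal p i m T 0 q) (hP : IsPrufer (fun x => q x - lam) θ)
    (hθT : θ T = i * Real.pi) (hθ1 : θ 1 = m * Real.pi) {a b : ℝ} (ha : 0 ≤ a) (hab : a < b)
    (hb : b ≤ 1) (hor : b ≤ T ∨ T ≤ a) {v : ℝ → ℝ} (hv : Measurable v) {M : ℝ}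
    (hM : ∀ x, |v x| ≤ M)
    (hv0 : ∫ t in a..b, v t * (pruferRadius (fun x => q x - lam) θ t * Real.sin (θ t)) ^ 2 = 0) :
    0 ≤ ∫ t in a..b, oddPow p (q t) * v t := by
  have hq := Potential.intervalIntegrable hp q
  have hQ : IntervalIntegrable (fun x => q x - lam) volume 0 1 := hq.sub intervalIntegrable_const
  -- Both the step s_n and the correcting constant c_n are at most 1/(n + 1), so the constants
  -- disappear in the limit. The interval (a,b) does not contain T, so the angle is unchanged at T
  -- and at 1 and each perturbed potential is admissible.
  have hex : ∀ n : ℕ, ∃ s c : ℝ, 0 < s ∧ s < 1 / ((n : ℝ) + 1) ∧ |c| ≤ 1 / ((n : ℝ) + 1) ∧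
      ∃ θ', IsPrufer (fun x => q x - lam + s * localBump a b v c x) θ' ∧
        ∀ x ∈ Icc (0 : ℝ) 1, x ≤ a ∨ b ≤ x → θ' x = θ x := by
    intro n
    have hn : (0 : ℝ) < 1 / ((n : ℝ) + 1) := by positivity
    obtain ⟨s, ⟨c, hc, hθ'⟩, hs⟩ := ((hP.exists_perturbation hQ ha hab hb hv hM hv0 hn).and
      (Ioo_mem_nhdsGT hn)).exists
    exact ⟨s, c, hs.1, hs.2, abs_le.2 hc, hθ'⟩
  choose s c hs hs1 hc θ' hθ' heq using hex
  have hlim1 := tendsto_one_div_add_atTop_nhds_zero_nat (𝕜 := ℝ)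
  have hs0 : Tendsto s atTop (𝓝 0) := squeeze_zero (fun n => (hs n).le) (fun n => (hs1 n).le) hlim1
  have hc0 : Tendsto c atTop (𝓝 0) := squeeze_zero_norm hc hlim1
  have hc1 : ∀ n, |c n| ≤ 1 := fun n => (hc n).trans (by
    rw [div_le_one (by positivity)]; linarith [(n.cast_nonneg : (0 : ℝ) ≤ n)])
  have key := integral_oddPow_mul_nonneg hp q (w := fun n => localBump a b v (c n))
    (w₀ := localBump a b v 0) (s := s) (M := M + 1)
    (fun n => localBump_measurable hv _)
    (fun n x => (abs_localBump_le hM (c n) x).trans (by linarith [hc1 n])) (fun x => ?_) hs hs0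
    (fun n r hr => h.norm_le ?_)
  · rwa [integral_mul_localBump ha hab.le hb] at key
  · unfold localBump
    by_cases hx : x ∈ Ioc a b
    · simp only [indicator_of_mem hx]
      exact hc0.const_add _
    · simp only [indicator_of_notMem hx]
      exact tendsto_const_nhds
  · have hT1 : T ∈ Icc (0 : ℝ) 1 := Ioo_subset_Icc_self hT
    refine isNode_of_isPrufer hp hi hm hT (lam := lam) (hθ' n) ?_ ?_ ?_
    · filter_upwards [hr] with x hx
      rw [hx]; ring
    · rw [heq n T hT1 hor.symm, hθT]
    · rw [heq n 1 (right_mem_Icc.2 zero_le_one) (Or.inr hb), hθ1]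

/-- The side condition on v is linear, so the one-sided inequality holds for -v as well. -/
theorem IsOptimal.integral_mul_eq_zero (hp : 1 < p) (hi : 1 ≤ i) (hm : 1 ≤ m)
    (hT : T ∈ Ioo (0 : ℝ) 1) (h : IsOptimal p i m T 0 q) (hP : IsPrufer (fun x => q x - lam) θ)
    (hθT : θ T = i * Real.pi) (hθ1 : θ 1 = m * Real.pi) {a b : ℝ} (ha : 0 ≤ a) (hab : a < b)
    (hb : b ≤ 1) (hor : b ≤ T ∨ T ≤ a) {v : ℝ → ℝ} (hv : Measurable v) {M : ℝ}
    (hM : ∀ x, |v x| ≤ M)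
    (hv0 : ∫ t in a..b, v t * (pruferRadius (fun x => q x - lam) θ t * Real.sin (θ t)) ^ 2 = 0) :
    ∫ t in a..b, oddPow p (q t) * v t = 0 := by
  have h1 := h.integral_mul_nonneg hp hi hm hT hP hθT hθ1 ha hab hb hor hv hM hv0
  have h2 := h.integral_mul_nonneg hp hi hm hT hP hθT hθ1 ha hab hb hor (v := fun x => -v x) hv.neg
    (fun x => by rw [abs_neg]; exact hM x) (by
      simp only [neg_mul, intervalIntegral.integral_neg, hv0, neg_zero])
  simp only [mul_neg, intervalIntegral.integral_neg] at h2
  linarith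

/-- Adding a constant to the potential does not move the nodes, hence the mean of the odd power
of the optimal potential vanishes. -/
theorem IsOptimal.integral_oddPow_eq_zero (hp : 1 < p) (hi : 1 ≤ i) (hm : 1 ≤ m)
    (hT : T ∈ Ioo (0 : ℝ) 1) (h : IsOptimal p i m T 0 q) (hP : IsPrufer (fun x => q x - lam) θ)
    (hθT : θ T = i * Real.pi) (hθ1 : θ 1 = m * Real.pi) :
    ∫ t in Icc (0 : ℝ) 1, oddPow p (q t) = 0 := by
  have key : ∀ k : ℝ, 0 ≤ ∫ t in Icc (0 : ℝ) 1, oddPow p (q t) * k := by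
    intro k
    refine integral_oddPow_mul_nonneg hp q (w := fun _ _ => k) (w₀ := fun _ => k)
      (s := fun n => 1 / ((n : ℝ) + 1)) (M := |k|) (fun _ => measurable_const) (fun _ _ => le_rfl)
      (fun _ => tendsto_const_nhds) (fun n => by positivity)
      (tendsto_one_div_add_atTop_nhds_zero_nat (𝕜 := ℝ)) (fun n r hr => h.norm_le ?_)
    refine isNode_of_isPrufer hp hi hm hT (lam := lam + 1 / ((n : ℝ) + 1) * k) hP ?_ hθT hθ1
    filter_upwards [hr] with x hx
    rw [hx]; ring
  have h1 := key 1
  have h2 := key (-1)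
  simp only [mul_one, mul_neg, integral_neg] at h1 h2
  linarith

/-- The Euler–Lagrange equation of an optimal potential. -/
theorem IsOptimal.exists_multiplier (hp : 1 < p) (hi : 1 ≤ i) (hm : 1 ≤ m)
    (hT : T ∈ Ioo (0 : ℝ) 1) (h : IsOptimal p i m T 0 q) :
    ∃ lam θ k₁ k₂, IsPrufer (fun x => q x - lam) θ ∧ θ T = i * Real.pi ∧ θ 1 = m * Real.pi ∧
      (∀ᵐ t ∂(volume.restrict (Ioc 0 T)), oddPow p (q t) =
        k₁ * (pruferRadius (fun x => q x - lam) θ t * Real.sin (θ t)) ^ 2) ∧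
      (∀ᵐ t ∂(volume.restrict (Ioc T 1)), oddPow p (q t) =
        k₂ * (pruferRadius (fun x => q x - lam) θ t * Real.sin (θ t)) ^ 2) ∧
      k₁ * (∫ t in (0 : ℝ)..T, (pruferRadius (fun x => q x - lam) θ t * Real.sin (θ t)) ^ 2) +
        k₂ * (∫ t in T..1, (pruferRadius (fun x => q x - lam) θ t * Real.sin (θ t)) ^ 2) = 0 := by
  have hq := Potential.intervalIntegrable hp q
  obtain ⟨lam, θ, hP, hθT, hθ1⟩ := (isNode_iff hq hi hm hT).1 h.1
  have hQ : IntervalIntegrable (fun x => q x - lam) volume 0 1 := hq.sub intervalIntegrable_const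
  have hyc := ((hP.sin_hasAEDeriv hQ).continuousOn).pow 2
  set Y : ℝ → ℝ := fun t => (pruferRadius (fun x => q x - lam) θ t * Real.sin (θ t)) ^ 2 with hY
  have hGi : IntervalIntegrable (fun t => oddPow p (q t)) volume 0 1 := by
    rw [intervalIntegrable_iff_integrableOn_Icc_of_le zero_le_one]
    exact Potential.integrable_oddPow hp q
  have hYi : IntervalIntegrable Y volume 0 1 := hyc.intervalIntegrable_of_Icc zero_le_one
  have hpiece : ∀ a b : ℝ, 0 ≤ a → a < b → b ≤ 1 → (b ≤ T ∨ T ≤ a) →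
      ∃ k, ∀ᵐ t ∂(volume.restrict (Ioc a b)), oddPow p (q t) = k * Y t := by
    intro a b ha hab hb hor
    refine ae_eq_const_mul_of_orthogonal hab.le (hGi.mono_Icc ha hab.le hb)
      (hYi.mono_Icc ha hab.le hb) (hP.integral_sin_sq_pos hQ ha hab hb) ?_
    rintro v hv ⟨M, hM⟩ hv0
    exact h.integral_mul_eq_zero hp hi hm hT hP hθT hθ1 ha hab hb hor hv hM hv0
  obtain ⟨k₁, hk₁⟩ := hpiece 0 T le_rfl hT.1 hT.2.le (Or.inl le_rfl)
  obtain ⟨k₂, hk₂⟩ := hpiece T 1 hT.1.le hT.2 le_rfl (Or.inr le_rfl)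
  refine ⟨lam, θ, k₁, k₂, hP, hθT, hθ1, hk₁, hk₂, ?_⟩
  -- The relation between the two multipliers is the vanishing mean, split at T.
  have h0 := h.integral_oddPow_eq_zero hp hi hm hT hP hθT hθ1
  rw [integral_Icc_eq_integral_Ioc, ← intervalIntegral.integral_of_le zero_le_one,
    ← intervalIntegral.integral_add_adjacent_intervals (hGi.mono_Icc le_rfl hT.1.le hT.2.le)
      (hGi.mono_Icc hT.1.le hT.2.le le_rfl), intervalIntegral.integral_of_le hT.1.le,
    intervalIntegral.integral_of_le hT.2.le, integral_congr_ae hk₁, integral_congr_ae hk₂,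
    integral_const_mul, integral_const_mul] at h0
  rwa [intervalIntegral.integral_of_le hT.1.le, intervalIntegral.integral_of_le hT.2.le]

end Optimal

/-! ### Local Lipschitz bound for the nonlinearity. -/

section Lipschitz

variable {s : ℝ}

theorem hasDerivAt_oddPow (hs : 2 < s) (x : ℝ) :
    HasDerivAt (oddPow s) ((s - 1) * |x| ^ (s - 2)) x := by
  have hs2 : s - 2 ≠ 0 := by linarith
  by_cases hx : x = 0
  · subst hx
    rw [abs_zero, Real.zero_rpow hs2, mul_zero, hasDerivAt_iff_tendsto_slope_zero]
    have h1 : Tendsto (fun t : ℝ => |t| ^ (s - 2)) (𝓝[≠] 0) (𝓝 0) := by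
      have : Continuous fun t : ℝ => |t| ^ (s - 2) :=
        continuous_abs.rpow_const fun _ => Or.inr (by linarith)
      have h := this.tendsto 0
      rw [abs_zero, Real.zero_rpow hs2] at h
      exact h.mono_left nhdsWithin_le_nhds
    refine h1.congr' ?_
    filter_upwards [self_mem_nhdsWithin] with t ht
    rw [zero_add, oddPow_zero, sub_zero, oddPow, smul_eq_mul]
    field_simp [show t ≠ 0 from ht]
  · have h1 := ((hasDerivAt_abs hx).rpow_const (p := s - 2) (Or.inl (abs_ne_zero.2 hx))).mul
      (hasDerivAt_id x)
    refine h1.congr_deriv ?_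
    have hpos : 0 < |x| := abs_pos.2 hx
    have e : |x| ^ (s - 2) = |x| ^ (s - 2 - 1) * |x| := by
      rw [← Real.rpow_add_one hpos.ne']
      congr 1
      ring
    have hsgn : (SignType.sign x : ℝ) * x = |x| := by rw [mul_comm]; exact self_mul_sign x
    simp only [id]
    rw [e]
    linear_combination ((s - 2) * |x| ^ (s - 2 - 1)) * hsgn

theorem abs_oddPow_sub_le (hs : 2 < s) {M x y : ℝ} (hx : |x| ≤ M) (hy : |y| ≤ M) :
    |oddPow s x - oddPow s y| ≤ (s - 1) * M ^ (s - 2) * |x - y| := by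
  refine (convex_Icc (-M) M).norm_image_sub_le_of_norm_hasDerivWithin_le
    (fun t _ => (hasDerivAt_oddPow hs t).hasDerivWithinAt) (fun t ht => ?_)
    (abs_le.1 hy) (abs_le.1 hx)
  have h0 : 0 ≤ |t| ^ (s - 2) := Real.rpow_nonneg (abs_nonneg t) _
  rw [Real.norm_eq_abs, abs_of_nonneg (mul_nonneg (by linarith) h0)]
  exact mul_le_mul_of_nonneg_left (Real.rpow_le_rpow (abs_nonneg t) (abs_le.2 ht) (by linarith))
    (by linarith)

end Lipschitz

/-! ### The autonomous equation: uniqueness, energy, amplitude. -/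

section Autonomous

variable {r κ lam a b : ℝ} {u z u₁ z₁ u₂ z₂ : ℝ → ℝ}

/-- `u' = z`, `z' = (κ |u|^{2r-2} - lam) u` on `[a,b]`. -/
structure IsTrajectory (r κ lam a b : ℝ) (u z : ℝ → ℝ) : Prop where
  hasDeriv_fst : ∀ x ∈ Icc a b, HasDerivWithinAt u (z x) (Icc a b) x
  hasDeriv_snd : ∀ x ∈ Icc a b,
    HasDerivWithinAt z (κ * oddPow (2 * r) (u x) - lam * u x) (Icc a b) x

namespace IsTrajectory

theorem continuousOn_fst (h : IsTrajectory r κ lam a b u z) : ContinuousOn u (Icc a b) :=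
  fun x hx => (h.hasDeriv_fst x hx).continuousWithinAt

theorem continuousOn_snd (h : IsTrajectory r κ lam a b u z) : ContinuousOn z (Icc a b) :=
  fun x hx => (h.hasDeriv_snd x hx).continuousWithinAt

theorem mono (h : IsTrajectory r κ lam a b u z) {c d : ℝ} (hc : a ≤ c) (hd : d ≤ b) :
    IsTrajectory r κ lam c d u z :=
  ⟨fun x hx => (h.hasDeriv_fst x (Icc_subset_Icc hc hd hx)).mono (Icc_subset_Icc hc hd),
    fun x hx => (h.hasDeriv_snd x (Icc_subset_Icc hc hd hx)).mono (Icc_subset_Icc hc hd)⟩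

theorem neg (h : IsTrajectory r κ lam a b u z) :
    IsTrajectory r κ lam a b (fun x => -u x) (fun x => -z x) := by
  refine ⟨fun x hx => (h.hasDeriv_fst x hx).neg, fun x hx =>
    ((h.hasDeriv_snd x hx).neg).congr_deriv ?_⟩
  rw [oddPow_neg]
  ring

/-- Trajectories are determined by their initial values. -/
theorem eq_of_eq (hr : 1 < r) (hab : a ≤ b) (h₁ : IsTrajectory r κ lam a b u₁ z₁)
    (h₂ : IsTrajectory r κ lam a b u₂ z₂) (hu : u₁ a = u₂ a) (hz : z₁ a = z₂ a) {x : ℝ}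
    (hx : x ∈ Icc a b) : u₁ x = u₂ x := by
  have c1 := h₁.continuousOn_fst
  have c2 := h₂.continuousOn_fst
  obtain ⟨M₁, hM₁⟩ := isCompact_Icc.exists_bound_of_continuousOn c1
  obtain ⟨M₂, hM₂⟩ := isCompact_Icc.exists_bound_of_continuousOn c2
  set M := max M₁ M₂ with hM
  set F : ℝ → ℝ := fun v => κ * oddPow (2 * r) v - lam * v with hF
  set K := |κ| * ((2 * r - 1) * M ^ (2 * r - 2)) + |lam| with hK
  have hFc : Continuous F := by
    have := continuous_oddPow (p := 2 * r) (by linarith)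
    fun_prop
  have hlip : ∀ t ∈ Icc a b, |F (u₁ t) - F (u₂ t)| ≤ K * |u₁ t - u₂ t| := by
    intro t ht
    have h := abs_oddPow_sub_le (s := 2 * r) (by linarith) ((hM₁ t ht).trans (le_max_left M₁ M₂))
      ((hM₂ t ht).trans (le_max_right M₁ M₂))
    have e : F (u₁ t) - F (u₂ t) = κ * (oddPow (2 * r) (u₁ t) - oddPow (2 * r) (u₂ t)) -
        lam * (u₁ t - u₂ t) := by simp only [hF]; ring
    rw [e]
    refine (abs_sub _ _).trans ?_
    rw [abs_mul, abs_mul, hK, add_mul, mul_assoc |κ|]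
    exact add_le_add (mul_le_mul_of_nonneg_left h (abs_nonneg _)) le_rfl
  -- The difference quotient of the nonlinearity along the two trajectories is bounded and
  -- measurable, so their difference solves a linear equation with coefficient Q. Where the
  -- trajectories meet, the value 0 of the quotient does no harm.
  set Q : ℝ → ℝ := fun t => (F (u₁ t) - F (u₂ t)) / (u₁ t - u₂ t) with hQ
  have hQb : ∀ t ∈ Icc a b, |Q t| ≤ |K| := by
    intro t ht
    simp only [hQ, abs_div]
    refine div_le_of_le_mul₀ (abs_nonneg _) (abs_nonneg _) ((hlip t ht).trans ?_)
    exact mul_le_mul_of_nonneg_right (le_abs_self K) (abs_nonneg _)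
  have hQi : IntervalIntegrable Q volume a b := by
    rw [intervalIntegrable_iff_integrableOn_Icc_of_le hab]
    have m1 : AEMeasurable (fun t => F (u₁ t) - F (u₂ t)) (volume.restrict (Icc a b)) :=
      ((hFc.comp_continuousOn c1).sub (hFc.comp_continuousOn c2)).aemeasurable measurableSet_Icc
    have m2 : AEMeasurable (fun t => u₁ t - u₂ t) (volume.restrict (Icc a b)) :=
      (c1.sub c2).aemeasurable measurableSet_Icc
    refine (integrable_const |K|).mono' (m1.div m2).aestronglyMeasurable ?_
    rw [ae_restrict_iff' measurableSet_Icc]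
    exact Eventually.of_forall hQb
  have hD : HasAEDeriv (fun t => u₁ t - u₂ t) (fun t => z₁ t - z₂ t) a b :=
    .of_hasDerivWithinAt hab (fun t ht => (h₁.hasDeriv_fst t ht).sub (h₂.hasDeriv_fst t ht))
      (h₁.continuousOn_snd.sub h₂.continuousOn_snd)
  have hD' : HasAEDeriv (fun t => z₁ t - z₂ t) (fun t => Q t * (u₁ t - u₂ t)) a b := by
    refine HasAEDeriv.congr_deriv (.of_hasDerivWithinAt hab
      (fun t ht => (h₁.hasDeriv_snd t ht).sub (h₂.hasDeriv_snd t ht))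
      ((hFc.comp_continuousOn c1).sub (hFc.comp_continuousOn c2))) (Eventually.of_forall
        fun t ht => ?_)
    by_cases h0 : u₁ t - u₂ t = 0
    · have : u₁ t = u₂ t := sub_eq_zero.1 h0
      simp [this]
    · simp only [hQ]
      rw [div_mul_cancel₀ _ h0]
  exact sub_eq_zero.1 (linear_system_eq_zero hQi hD hD' (sub_eq_zero.2 hu) (sub_eq_zero.2 hz) hx).1

end IsTrajectory

/-- The potential energy of `u'' = (κ |u|^{2r-2} - lam) u`. -/
def energy (r κ lam s : ℝ) : ℝ := lam * s ^ 2 - κ / r * |s| ^ (2 * r)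

theorem energy_abs (r κ lam s : ℝ) : energy r κ lam |s| = energy r κ lam s := by
  simp [energy]

theorem hasDerivAt_energy (hr : 1 < r) (s : ℝ) :
    HasDerivAt (energy r κ lam) (2 * (lam * s - κ * oddPow (2 * r) s)) s := by
  have h1 := ((hasDerivAt_pow 2 s).const_mul lam).sub
    ((hasDerivAt_abs_rpow_oddPow (p := 2 * r) (by linarith) s).const_mul (κ / r))
  refine h1.congr_deriv ?_
  have : r ≠ 0 := by linarith
  field_simp
  push_cast
  ring

theorem IsTrajectory.energy_eq (hr : 1 < r) (hab : a ≤ b) (h : IsTrajectory r κ lam a b u z) {x y : ℝ}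
    (hx : x ∈ Icc a b) (hy : y ∈ Icc a b) :
    z x ^ 2 + energy r κ lam (u x) = z y ^ 2 + energy r κ lam (u y) := by
  have hd : ∀ t ∈ Icc a b, HasDerivWithinAt (fun t => z t ^ 2 + energy r κ lam (u t)) 0
      (Icc a b) t := by
    intro t ht
    have h1 := ((h.hasDeriv_snd t ht).pow 2).add
      ((hasDerivAt_energy (κ := κ) (lam := lam) hr (u t)).comp_hasDerivWithinAt t
        (h.hasDeriv_fst t ht))
    refine h1.congr_deriv ?_
    push_cast
    ring
  have hA := HasAEDeriv.of_hasDerivWithinAt (g := fun _ => 0) hab hd continuousOn_const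
  have e1 := hA.eq_add_integral hx
  have e2 := hA.eq_add_integral hy
  simp only [intervalIntegral.integral_zero, add_zero] at e1 e2
  rw [e1, e2]

/-- The energy is strictly increasing up to amplitudes `h` with `κ h^{2r-2} < lam`. -/
theorem energy_strictMonoOn (hr : 1 < r) {h : ℝ} (hlam : 0 < lam)
    (hh : κ * h ^ (2 * r - 2) ≤ lam) :
    StrictMonoOn (energy r κ lam) (Icc 0 h) := by
  refine strictMonoOn_of_deriv_pos (convex_Icc 0 h)
    (fun s _ => (hasDerivAt_energy hr s).continuousAt.continuousWithinAt) fun s hs => ?_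
  rw [interior_Icc] at hs
  rw [(hasDerivAt_energy hr s).deriv, oddPow, abs_of_pos hs.1]
  have h1 : κ * s ^ (2 * r - 2) < lam := by
    rcases le_or_gt κ 0 with hk | hk
    · have : 0 ≤ s ^ (2 * r - 2) := Real.rpow_nonneg hs.1.le _
      nlinarith
    · have : s ^ (2 * r - 2) < h ^ (2 * r - 2) := Real.rpow_lt_rpow hs.1.le hs.2 (by linarith)
      nlinarith
  have : 0 < s * (lam - κ * s ^ (2 * r - 2)) := mul_pos hs.1 (by linarith)
  nlinarith

/-- The amplitude of a trajectory that vanishes at both ends. -/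
theorem IsTrajectory.exists_amplitude (hr : 1 < r) (hab : a < b)
    (h : IsTrajectory r κ lam a b u z) (hua : u a = 0) (hub : u b = 0) (hza : z a ≠ 0)
    (hκ : 0 ≤ κ ∨ 0 < lam) :
    ∃ h₀, 0 < h₀ ∧ IsGreatest ((fun x => |u x|) '' Icc a b) h₀ ∧ κ * h₀ ^ (2 * r - 2) < lam ∧
      0 < lam ∧ z a ^ 2 = energy r κ lam h₀ := by
  obtain ⟨c, hc, hmax⟩ := isCompact_Icc.exists_isMaxOn (nonempty_Icc.2 hab.le)
    h.continuousOn_fst.abs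
  have hmax' : ∀ x ∈ Icc a b, |u x| ≤ |u c| := hmax
  obtain ⟨x₀, hx₀, hne⟩ := exists_ne_zero_of_hasDerivWithinAt hab
    (h.hasDeriv_fst a (left_mem_Icc.2 hab.le)) hza
  have hpos : 0 < |u c| := (abs_pos.2 hne).trans_le (hmax' x₀ hx₀)
  have huc : u c ≠ 0 := abs_pos.1 hpos
  have hca : c ≠ a := fun e => huc (e ▸ hua)
  have hcb : c ≠ b := fun e => huc (e ▸ hub)
  have hcI : c ∈ Ioo a b := ⟨lt_of_le_of_ne hc.1 hca.symm, lt_of_le_of_ne hc.2 hcb⟩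
  have hnhds : Icc a b ∈ 𝓝 c := Icc_mem_nhds hcI.1 hcI.2
  -- The square u² is differentiable and has an interior maximum at c, so 2uz vanishes there while u
  -- does not.
  have hzc : z c = 0 := by
    have hd : HasDerivAt (fun x => u x ^ 2) _ c := ((h.hasDeriv_fst c hc).hasDerivAt hnhds).pow 2
    have hloc : IsLocalMax (fun x => u x ^ 2) c := by
      filter_upwards [hnhds] with x hx
      exact sq_le_sq.2 (hmax' x hx)
    have := hloc.hasDerivAt_eq_zero hd
    simpa [huc] using this
  have hen : ∀ x ∈ Icc a b, z x ^ 2 + energy r κ lam |u x| = energy r κ lam |u c| := by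
    intro x hx
    have := h.energy_eq hr hab.le hx hc
    rw [hzc] at this
    rw [energy_abs, energy_abs, this]
    ring
  -- Every s in [0,|u c|] is a value of |u|, and there the energy misses its value at |u c| by a
  -- square.
  have hle : ∀ s ∈ Icc 0 |u c|, energy r κ lam s ≤ energy r κ lam |u c| := by
    intro s hs
    have hiv := intermediate_value_Icc hc.1 (h.continuousOn_fst.abs.mono (Icc_subset_Icc_right hc.2))
    rw [hua, abs_zero] at hiv
    obtain ⟨x, hx, rfl⟩ := hiv hs
    have := hen x ⟨hx.1, hx.2.trans hc.2⟩
    nlinarith [sq_nonneg (z x)]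
  have h1 : κ * |u c| ^ (2 * r - 2) ≤ lam := by
    by_contra! hlt
    -- Reversing both signs negates the energy. If κ|u c|^(2r-2) > `lam`, this negated function
    -- increases at |u c|, so the energy would be larger slightly to the left of its maximum.
    have hd := (hasDerivAt_energy (κ := -κ) (lam := -lam) hr |u c|).hasDerivWithinAt
      (s := Icc 0 |u c|)
    have hd0 : 0 < 2 * (-lam * |u c| - -κ * oddPow (2 * r) |u c|) := by
      rw [oddPow, abs_abs]
      nlinarith
    have hev := (eventually_of_deriv_pos (right_mem_Icc.2 hpos.le) hd hd0).2 hpos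
    obtain ⟨s, hs, hs'⟩ := (hev.and (Ico_mem_nhdsLT hpos)).exists
    have := hle s ⟨hs'.1, hs'.2.le⟩
    simp only [energy] at this hs
    have e : -κ / r = -(κ / r) := neg_div _ _
    rw [e] at hs
    linarith
  -- In case of equality the constant u c is an equilibrium; by uniqueness u would stay there and
  -- not vanish at b.
  have h2 : κ * |u c| ^ (2 * r - 2) ≠ lam := by
    intro he
    have hT : IsTrajectory r κ lam c b (fun _ => u c) (fun _ => 0) := by
      refine ⟨fun x _ => hasDerivWithinAt_const _ _ _, fun x _ =>
        (hasDerivWithinAt_const _ _ _).congr_deriv ?_⟩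
      rw [oddPow, ← he]
      ring
    have := (h.mono hc.1 le_rfl).eq_of_eq hr hc.2 hT rfl hzc (right_mem_Icc.2 hc.2)
    exact huc (this ▸ hub)
  have h3 : κ * |u c| ^ (2 * r - 2) < lam := lt_of_le_of_ne h1 h2
  refine ⟨|u c|, hpos, ⟨⟨c, hc, rfl⟩, ?_⟩, h3, ?_, ?_⟩
  · rintro _ ⟨x, hx, rfl⟩
    exact hmax' x hx
  · rcases hκ with hκ | hκ
    · exact (mul_nonneg hκ (Real.rpow_nonneg hpos.le _)).trans_lt h3
    · exact hκ
  · have := hen a (left_mem_Icc.2 hab.le)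
    rw [hua, abs_zero] at this
    have e0 : energy r κ lam 0 = 0 := by
      simp [energy, Real.zero_rpow (by linarith : 2 * r ≠ 0)]
    rw [e0] at this
    linarith

end Autonomous

/-! ### Quadrature over quarter oscillations. -/

section Quarter

variable {r κ lam a b c d h₀ : ℝ} {u z : ℝ → ℝ}

/-- Change of variables on a quarter oscillation. -/
theorem IsTrajectory.integral_quarter (hcd : c < d) (h : IsTrajectory r κ lam c d u z)
    (hu : ∀ x ∈ Ioo c d, u x ≠ 0) (hz : ∀ x ∈ Ioo c d, z x ≠ 0)
    (hle : ∀ x ∈ Icc c d, |u x| ≤ h₀)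
    (hen : ∀ x ∈ Icc c d, z x ^ 2 = energy r κ lam h₀ - energy r κ lam |u x|)
    (hends : (|u c| = 0 ∧ |u d| = h₀) ∨ (|u c| = h₀ ∧ |u d| = 0)) (F : ℝ → ℝ) :
    ∫ x in c..d, F |u x| =
      ∫ s in Ioo 0 h₀, F s / √(energy r κ lam h₀ - energy r κ lam s) := by
  have hder : ∀ x ∈ Ioo c d, HasDerivAt (fun x => |u x|) ((SignType.sign (u x) : ℝ) * z x) x :=
    fun x hx => (hasDerivAt_abs (hu x hx)).comp x
      ((h.hasDeriv_fst x (Ioo_subset_Icc_self hx)).hasDerivAt (Icc_mem_nhds hx.1 hx.2))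
  have hder_ne : ∀ x ∈ Ioo c d, (SignType.sign (u x) : ℝ) * z x ≠ 0 := fun x hx =>
    mul_ne_zero (by
      rcases lt_or_gt_of_ne (hu x hx) with h | h
      · simp [sign_neg h]
      · simp [sign_pos h]) (hz x hx)
  have hcont := h.continuousOn_fst.abs
  -- Two equal values of |u| would by Rolle produce a zero of its derivative ±z.
  have hinj : InjOn (fun x => |u x|) (Ioo c d) := by
    have key : ∀ x ∈ Ioo c d, ∀ y ∈ Ioo c d, x < y → |u x| ≠ |u y| := by
      intro x hx y hy hxy e
      obtain ⟨t, ht, ht0⟩ := exists_hasDerivAt_eq_zero hxy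
        (hcont.mono (Icc_subset_Icc hx.1.le hy.2.le)) e
        (fun t ht => hder t ⟨hx.1.trans ht.1, ht.2.trans hy.2⟩)
      exact hder_ne t ⟨hx.1.trans ht.1, ht.2.trans hy.2⟩ ht0
    intro x hx y hy e
    by_contra hne
    rcases lt_or_gt_of_ne hne with hxy | hxy
    · exact key x hx y hy hxy e
    · exact key y hy x hx hxy e.symm
  have himg : (fun x => |u x|) '' Ioo c d = Ioo 0 h₀ := by
    apply Subset.antisymm
    · rintro _ ⟨x, hx, rfl⟩
      refine ⟨abs_pos.2 (hu x hx), lt_of_le_of_ne (hle x (Ioo_subset_Icc_self hx)) fun e => ?_⟩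
      have := hen x (Ioo_subset_Icc_self hx)
      simp only at e
      rw [e, sub_self] at this
      exact hz x hx (pow_eq_zero_iff two_ne_zero |>.1 this)
    · rcases hends with ⟨e1, e2⟩ | ⟨e1, e2⟩
      · have := intermediate_value_Ioo hcd.le hcont
        simp only [e1, e2] at this
        exact this
      · have := intermediate_value_Ioo' hcd.le hcont
        simp only [e1, e2] at this
        exact this
  -- The Jacobian |z| equals √(E(h₀) - E(|u|)) by conservation of energy and cancels the
  -- denominator.
  rw [← himg, integral_image_eq_integral_abs_deriv_smul measurableSet_Ioo
    (fun x hx => (hder x hx).hasDerivWithinAt) hinj, intervalIntegral.integral_of_le hcd.le,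
    integral_Ioc_eq_integral_Ioo]
  refine setIntegral_congr_fun measurableSet_Ioo fun x hx => ?_
  have hzx := abs_pos.2 (hz x hx)
  have hsg : |(SignType.sign (u x) : ℝ)| = 1 := by
    rcases lt_or_gt_of_ne (hu x hx) with h | h
    · simp [sign_neg h]
    · simp [sign_pos h]
  simp only [smul_eq_mul]
  rw [← hen x (Ioo_subset_Icc_self hx), Real.sqrt_sq_eq_abs, abs_mul, hsg]
  field_simp

variable {θ R : ℝ → ℝ}

/-- Integrals of functions of `|u|` over an interval that consists of `n` half oscillations. -/
theorem IsTrajectory.integral_comp_abs (hr : 1 < r) (hab : a < b)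
    (h : IsTrajectory r κ lam a b u z)
    (hθ : ∀ x ∈ Icc a b, HasDerivWithinAt θ
      (1 - (κ * |u x| ^ (2 * r - 2) - lam + 1) * Real.sin (θ x) ^ 2) (Icc a b) x)
    (hu : ∀ x ∈ Icc a b, u x = R x * Real.sin (θ x))
    (hz : ∀ x ∈ Icc a b, z x = R x * Real.cos (θ x)) (hR : ∀ x ∈ Icc a b, R x ≠ 0)
    {k n : ℕ} (hθa : θ a = k * Real.pi) (hθb : θ b = (k + n : ℕ) * Real.pi)
    (hle : ∀ x ∈ Icc a b, |u x| ≤ h₀) (hκ : κ * h₀ ^ (2 * r - 2) < lam) (hlam : 0 < lam)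
    (hza : z a ^ 2 = energy r κ lam h₀) {F : ℝ → ℝ} (hF : Continuous F) :
    ∫ x in a..b, F |u x| =
      2 * n * ∫ s in Ioo 0 h₀, F s / √(energy r κ lam h₀ - energy r κ lam s) := by
  have hpi := Real.pi_pos
  have ha := left_mem_Icc.2 hab.le
  have hb := right_mem_Icc.2 hab.le
  have hu0 : ∀ x ∈ Icc a b, Real.sin (θ x) = 0 → |u x| = 0 := fun x hx hs => by
    rw [hu x hx, hs, mul_zero, abs_zero]
  have hua : |u a| = 0 := hu0 a ha (by rw [hθa]; exact Real.sin_nat_mul_pi k)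
  have e0 : energy r κ lam 0 = 0 := by
    simp [energy, Real.zero_rpow (by linarith : 2 * r ≠ 0)]
  have hen : ∀ x ∈ Icc a b, z x ^ 2 = energy r κ lam h₀ - energy r κ lam |u x| := by
    intro x hx
    have := h.energy_eq hr hab.le hx ha
    rw [← energy_abs r κ lam (u a), hua, e0, hza, ← energy_abs r κ lam (u x)] at this
    linarith
  have hκx : ∀ x ∈ Icc a b, κ * |u x| ^ (2 * r - 2) < lam := by
    intro x hx
    have h1 : |u x| ^ (2 * r - 2) ≤ h₀ ^ (2 * r - 2) :=
      Real.rpow_le_rpow (abs_nonneg _) (hle x hx) (by linarith)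
    have h2 : 0 ≤ |u x| ^ (2 * r - 2) := Real.rpow_nonneg (abs_nonneg _) _
    rcases le_or_gt κ 0 with hk | hk <;> nlinarith
  have hθc : ContinuousOn θ (Icc a b) := fun x hx => (hθ x hx).continuousWithinAt
  -- Here θ' = cos² θ + (`lam` - κ|u|^(2r-2)) sin² θ > 0, so θ is strictly increasing throughout and
  -- [a,b] can be cut where θ is a multiple of π/2.
  have hmono : StrictMonoOn θ (Icc a b) := by
    refine strictMonoOn_of_deriv_pos (convex_Icc a b) hθc fun x hx => ?_
    rw [interior_Icc] at hx
    have hx' := Ioo_subset_Icc_self hx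
    rw [((hθ x hx').hasDerivAt (Icc_mem_nhds hx.1 hx.2)).deriv]
    have h1 := Real.sin_sq_add_cos_sq (θ x)
    have h2 := hκx x hx'
    by_cases hs : Real.sin (θ x) = 0
    · rw [hs]; norm_num
    · have h3 : 0 < Real.sin (θ x) ^ 2 := by positivity
      have h4 := Real.sin_sq_le_one (θ x)
      nlinarith [mul_pos h3 (sub_pos.2 h2)]
  -- The 2n + 1 cutting points are the solutions of θ = (2k + j)π/2 for j ≤ 2n; for larger j an
  -- irrelevant value serves.
  have hex : ∀ j : ℕ, ∃ x, j ≤ 2 * n → x ∈ Icc a b ∧ θ x = ((2 * k + j : ℕ) : ℝ) * (Real.pi / 2) := by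
    intro j
    by_cases hj : j ≤ 2 * n
    · have hmem : ((2 * k + j : ℕ) : ℝ) * (Real.pi / 2) ∈ Icc (θ a) (θ b) := by
        have hj' : (j : ℝ) ≤ 2 * n := by exact_mod_cast hj
        have hj0 : (0 : ℝ) ≤ j := j.cast_nonneg
        rw [hθa, hθb]
        push_cast
        constructor <;> nlinarith
      obtain ⟨x, hx, hxe⟩ := intermediate_value_Icc hab.le hθc hmem
      exact ⟨x, fun _ => ⟨hx, hxe⟩⟩
    · exact ⟨0, fun h => absurd h hj⟩
  choose c hc using hex
  have hc0 : c 0 = a := by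
    have := hc 0 (Nat.zero_le _)
    refine hmono.injOn this.1 ha ?_
    rw [this.2, hθa]
    push_cast
    ring
  have hcn : c (2 * n) = b := by
    have := hc (2 * n) le_rfl
    refine hmono.injOn this.1 hb ?_
    rw [this.2, hθb]
    push_cast
    ring
  have hstep : ∀ j < 2 * n, c j < c (j + 1) := by
    intro j hj
    have h1 := hc j hj.le
    have h2 := hc (j + 1) hj
    refine (hmono.lt_iff_lt h1.1 h2.1).1 ?_
    rw [h1.2, h2.2]
    push_cast
    nlinarith
  -- At even j sin θ = 0, so u = 0. At odd j cos θ = 0, so z = 0 and the energy of |u| equals that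
  -- of h₀; strict monotonicity of the energy gives |u| = h₀.
  have hval : ∀ j ≤ 2 * n, (Even j → |u (c j)| = 0) ∧ (¬ Even j → |u (c j)| = h₀) := by
    intro j hj
    obtain ⟨h1, h2⟩ := hc j hj
    constructor
    · rintro ⟨l, rfl⟩
      refine hu0 _ h1 ?_
      rw [h2, show ((2 * k + (l + l) : ℕ) : ℝ) * (Real.pi / 2) = ((k + l : ℕ) : ℝ) * Real.pi by
        push_cast; ring]
      exact Real.sin_nat_mul_pi _
    · intro ho
      obtain ⟨l, rfl⟩ := Nat.not_even_iff_odd.1 ho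
      have hcos : Real.cos (θ (c (2 * l + 1))) = 0 := by
        rw [Real.cos_eq_zero_iff]
        refine ⟨(k + l : ℕ), ?_⟩
        rw [h2]
        push_cast
        ring
      have h3 := hen _ h1
      rw [hz _ h1, hcos, mul_zero] at h3
      have h4 := energy_strictMonoOn hr hlam hκ.le
      refine h4.injOn ⟨abs_nonneg _, hle _ h1⟩ ⟨(abs_nonneg _).trans (hle _ h1), le_rfl⟩ ?_
      linarith
  have hquarter : ∀ j < 2 * n, ∫ x in c j..c (j + 1), F |u x| =
      ∫ s in Ioo 0 h₀, F s / √(energy r κ lam h₀ - energy r κ lam s) := by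
    intro j hj
    have h1 := hc j hj.le
    have h2 := hc (j + 1) hj
    have hsub : Icc (c j) (c (j + 1)) ⊆ Icc a b := Icc_subset_Icc h1.1.1 h2.1.2
    have hlt : ∀ x ∈ Ioo (c j) (c (j + 1)), ((2 * k + j : ℕ) : ℝ) * (Real.pi / 2) < θ x ∧
        θ x < ((2 * k + j + 1 : ℕ) : ℝ) * (Real.pi / 2) := by
      intro x hx
      have hx' := hsub (Ioo_subset_Icc_self hx)
      refine ⟨?_, ?_⟩
      · rw [← h1.2]; exact hmono h1.1 hx' hx.1
      · rw [add_assoc, ← h2.2]; exact hmono hx' h2.1 hx.2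
    have hint : ∀ x ∈ Ioo (c j) (c (j + 1)), ∀ l : ℤ, θ x ≠ l * (Real.pi / 2) := by
      intro x hx l e
      obtain ⟨g1, g2⟩ := hlt x hx
      rw [e] at g1 g2
      have g1' := lt_of_mul_lt_mul_right g1 (by positivity)
      have g2' := lt_of_mul_lt_mul_right g2 (by positivity)
      have g3 : ((2 * k + j : ℕ) : ℤ) < l := by exact_mod_cast g1'
      have g4 : l < ((2 * k + j + 1 : ℕ) : ℤ) := by exact_mod_cast g2'
      push_cast at g3 g4
      omega
    refine (h.mono h1.1.1 h2.1.2).integral_quarter (hstep j hj) (fun x hx => ?_) (fun x hx => ?_)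
      (fun x hx => hle x (hsub hx)) (fun x hx => hen x (hsub hx)) ?_ F
    · have hx' := hsub (Ioo_subset_Icc_self hx)
      rw [hu x hx']
      refine mul_ne_zero (hR x hx') fun hs => ?_
      obtain ⟨l, hl⟩ := Real.sin_eq_zero_iff.1 hs
      refine hint x hx (2 * l) ?_
      rw [← hl]
      push_cast
      ring
    · have hx' := hsub (Ioo_subset_Icc_self hx)
      rw [hz x hx']
      refine mul_ne_zero (hR x hx') fun hs => ?_
      obtain ⟨l, hl⟩ := Real.cos_eq_zero_iff.1 hs
      refine hint x hx (2 * l + 1) ?_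
      rw [hl]
      push_cast
      ring
    · by_cases hj2 : Even j
      · exact Or.inl ⟨(hval j hj.le).1 hj2, (hval (j + 1) hj).2 (by simpa [Nat.even_add_one] using hj2)⟩
      · exact Or.inr ⟨(hval j hj.le).2 hj2, (hval (j + 1) hj).1 (by simpa [Nat.even_add_one] using hj2)⟩
  have hFi : IntervalIntegrable (fun x => F |u x|) volume a b :=
    (hF.comp_continuousOn h.continuousOn_fst.abs).intervalIntegrable_of_Icc hab.le
  have hsum := intervalIntegral.sum_integral_adjacent_intervals (a := c) (n := 2 * n)
    (f := fun x => F |u x|) (μ := volume)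
    (fun j hj => hFi.mono_Icc (hc j hj.le).1.1 (hstep j hj).le (hc (j + 1) hj).1.2)
  rw [hc0, hcn] at hsum
  rw [← hsum, Finset.sum_congr rfl fun j hj => hquarter j (Finset.mem_range.1 hj)]
  simp

/-- Rescaling the quarter-period integral to the unit interval. -/
theorem integral_energy_eq (hr : 1 < r) (hh : 0 < h₀) (hlam : 0 < lam) (F : ℝ → ℝ) :
    ∫ s in Ioo 0 h₀, F s / √(energy r κ lam h₀ - energy r κ lam s) =
      (√lam)⁻¹ * ∫ t in (0 : ℝ)..1, F (h₀ * t) /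
        √(1 - t ^ 2 - κ * (h₀ ^ (2 * r - 2) / lam / r) * (1 - t ^ (2 * r))) := by
  have h1 : ∫ s in Ioo 0 h₀, F s / √(energy r κ lam h₀ - energy r κ lam s) =
      h₀ * ∫ t in (0 : ℝ)..1, F (h₀ * t) / √(energy r κ lam h₀ - energy r κ lam (h₀ * t)) := by
    rw [intervalIntegral.mul_integral_comp_mul_left (f := fun s => F s /
      √(energy r κ lam h₀ - energy r κ lam s)), mul_zero, mul_one,
      intervalIntegral.integral_of_le hh.le, integral_Ioc_eq_integral_Ioo]
  rw [h1, ← intervalIntegral.integral_const_mul, ← intervalIntegral.integral_const_mul]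
  refine intervalIntegral.integral_congr fun t ht => ?_
  rw [uIcc_of_le zero_le_one] at ht
  have e : h₀ ^ (2 * r) = h₀ ^ 2 * h₀ ^ (2 * r - 2) := by
    rw [← Real.rpow_two, ← Real.rpow_add hh]; congr 1; ring
  -- Pulling out `lam`·h₀² leaves the radicand with parameter h₀^(2r-2)/`lam`; its root cancels the
  -- h₀ from ds = h₀ dt and leaves 1/√`lam`.
  have hen : energy r κ lam h₀ - energy r κ lam (h₀ * t) = (√lam * h₀) ^ 2 *
      (1 - t ^ 2 - κ * (h₀ ^ (2 * r - 2) / lam / r) * (1 - t ^ (2 * r))) := by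
    rw [energy, energy, abs_mul, abs_of_pos hh, abs_of_nonneg ht.1, Real.mul_rpow hh.le ht.1,
      mul_pow, mul_pow, Real.sq_sqrt hlam.le, e]
    have : r ≠ 0 := by linarith
    field_simp
    ring
  have hs := Real.sqrt_pos.2 hlam
  rw [hen, Real.sqrt_mul (sq_nonneg _), Real.sqrt_sq (by positivity)]
  field_simp

end Quarter

/-! ### Convergence and monotonicity of the travel-time integrals. -/

section Period

variable {p σ a σ' a' t : ℝ}

theorem one_lt_conjExponent (hp : 1 < p) : 1 < p.conjExponent :=
  (Real.HolderConjugate.conjExponent hp).symm.lt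

/-- Bernoulli's inequality for (1 + (t² - 1))^p*. -/
theorem one_sub_rpow_le (hp : 1 < p) (ht : t ∈ Icc (0 : ℝ) 1) :
    1 - t ^ (2 * p.conjExponent) ≤ p.conjExponent * (1 - t ^ 2) := by
  have h := one_add_mul_self_le_rpow_one_add (s := t ^ 2 - 1) (by nlinarith [sq_nonneg t])
    (one_lt_conjExponent hp).le
  rw [add_sub_cancel, ← Real.rpow_natCast, ← Real.rpow_mul ht.1] at h
  push_cast at h
  rw [Real.rpow_two] at h
  linarith

theorem one_sub_rpow_pos (hp : 1 < p) (ht : t ∈ Ico (0 : ℝ) 1) :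
    0 < 1 - t ^ (2 * p.conjExponent) := by
  have := Real.rpow_lt_one ht.1 ht.2 (z := 2 * p.conjExponent)
    (by linarith [one_lt_conjExponent hp])
  linarith

/-- For σa ≤ 0 the extra term only helps; for σa > 0 Bernoulli's inequality bounds it by σa(1 - t²).
The lower bound reduces convergence to that of the arcsine integral. -/
theorem radicand_ge (hp : 1 < p) (ht : t ∈ Icc (0 : ℝ) 1) :
    min 1 (1 - σ * a) * (1 - t ^ 2) ≤ radicand p σ a t := by
  have hr := one_lt_conjExponent hp
  have h1 := one_sub_rpow_le hp ht
  have h2 : 0 ≤ 1 - t ^ (2 * p.conjExponent) := by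
    have := Real.rpow_le_one ht.1 ht.2 (z := 2 * p.conjExponent) (by linarith)
    linarith
  have h3 : 0 ≤ 1 - t ^ 2 := by nlinarith [ht.1, ht.2]
  have e : σ * (a / p.conjExponent) * (1 - t ^ (2 * p.conjExponent)) =
      σ * a * ((1 - t ^ (2 * p.conjExponent)) / p.conjExponent) := by ring
  have h4 : (1 - t ^ (2 * p.conjExponent)) / p.conjExponent ≤ 1 - t ^ 2 := by
    rw [div_le_iff₀ (by linarith)]
    linarith
  have h5 : 0 ≤ (1 - t ^ (2 * p.conjExponent)) / p.conjExponent := by positivity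
  rw [radicand, e]
  rcases le_or_gt (σ * a) 0 with h | h
  · have := min_le_left 1 (1 - σ * a)
    nlinarith
  · have := min_le_right 1 (1 - σ * a)
    nlinarith

theorem radicand_pos (hp : 1 < p) (h : σ * a < 1) (ht : t ∈ Ico (0 : ℝ) 1) :
    0 < radicand p σ a t := by
  refine lt_of_lt_of_le (mul_pos (lt_min zero_lt_one (by linarith)) ?_)
    (radicand_ge hp (Ico_subset_Icc_self ht))
  nlinarith [ht.1, ht.2]

theorem intervalIntegrable_one_div_sqrt_one_sub_sq :
    IntervalIntegrable (fun t : ℝ => 1 / √(1 - t ^ 2)) volume 0 1 := by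
  refine intervalIntegral.intervalIntegrable_deriv_of_nonneg (g := Real.arcsin)
    Real.continuous_arcsin.continuousOn (fun x hx => ?_) fun x _ => by positivity
  rw [min_eq_left zero_le_one, max_eq_right zero_le_one] at hx
  exact Real.hasDerivAt_arcsin (by linarith [hx.1]) hx.2.ne

theorem integral_one_div_sqrt_one_sub_sq :
    ∫ t in (0 : ℝ)..1, 1 / √(1 - t ^ 2) = Real.pi / 2 := by
  rw [intervalIntegral.integral_eq_sub_of_hasDerivAt_of_le zero_le_one
    Real.continuous_arcsin.continuousOn
    (fun x hx => Real.hasDerivAt_arcsin (by linarith [hx.1]) hx.2.ne)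
    intervalIntegrable_one_div_sqrt_one_sub_sq]
  simp

theorem continuousOn_radicand (hp : 1 < p) : Continuous (radicand p σ a) := by
  have hr := one_lt_conjExponent hp
  have : Continuous fun t : ℝ => t ^ (2 * p.conjExponent) :=
    continuous_id.rpow_const fun _ => Or.inr (by linarith)
  unfold radicand
  fun_prop

theorem intervalIntegrable_one_div_sqrt_radicand (hp : 1 < p) (h : σ * a < 1) :
    IntervalIntegrable (fun t => 1 / √(radicand p σ a t)) volume 0 1 := by
  set δ := min 1 (1 - σ * a) with hδ
  have hδ0 : 0 < δ := lt_min zero_lt_one (by linarith)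
  refine (intervalIntegrable_one_div_sqrt_one_sub_sq.const_mul (1 / √δ)).mono_fun
    ((continuousOn_radicand hp).measurable.sqrt.const_div 1).aestronglyMeasurable ?_
  rw [Filter.EventuallyLE, ae_restrict_iff' measurableSet_uIoc, uIoc_of_le zero_le_one]
  filter_upwards [ae_ne_and_ne 0 1] with t hne ht
  have ht' : t < 1 := lt_of_le_of_ne ht.2 hne.2
  have h1 : 0 < 1 - t ^ 2 := by nlinarith [ht.1]
  have h2 := radicand_ge (σ := σ) (a := a) hp (Ioc_subset_Icc_self ht)
  rw [Real.norm_eq_abs, Real.norm_eq_abs, abs_of_nonneg (by positivity),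
    abs_of_nonneg (by positivity), div_mul_div_comm, one_mul, ← Real.sqrt_mul hδ0.le]
  exact one_div_le_one_div_of_le (Real.sqrt_pos.2 (mul_pos hδ0 h1)) (Real.sqrt_le_sqrt h2)

/-- The radicand depends on σ and a only through σa and strictly decreases in it for 0 < t < 1. The
two signs may differ because the pieces with κ = 1 and κ = -1 have to be compared. -/
theorem lowerT_lt (hp : 1 < p) (h : σ * a < σ' * a') (h' : σ' * a' < 1) :
    lowerT p σ a < lowerT p σ' a' := by
  have h1 := intervalIntegrable_one_div_sqrt_radicand hp (h.trans h')
  have h2 := intervalIntegrable_one_div_sqrt_radicand hp h'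
  rw [← sub_pos, lowerT, lowerT, ← intervalIntegral.integral_sub h2 h1]
  refine intervalIntegral.intervalIntegral_pos_of_pos_on (h2.sub h1) (fun t ht => ?_) zero_lt_one
  have hr := one_lt_conjExponent hp
  have ht' : t ∈ Ico (0 : ℝ) 1 := Ioo_subset_Ico_self ht
  rw [sub_pos]
  refine one_div_lt_one_div_of_lt (Real.sqrt_pos.2 (radicand_pos hp h' ht'))
    (Real.sqrt_lt_sqrt (radicand_pos hp h' ht').le ?_)
  have h3 := one_sub_rpow_pos hp ht'
  have h4 : 0 < (1 - t ^ (2 * p.conjExponent)) / p.conjExponent := by positivity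
  have e : ∀ s b : ℝ, s * (b / p.conjExponent) * (1 - t ^ (2 * p.conjExponent)) =
      s * b * ((1 - t ^ (2 * p.conjExponent)) / p.conjExponent) := fun s b => by ring
  rw [radicand, radicand, e, e]
  nlinarith

/-- This is the case of zero potential, where the quarter period is π/2 whatever the amplitude. -/
theorem lowerT_zero (p a : ℝ) : lowerT p 0 a = Real.pi / 2 := by
  rw [lowerT, ← integral_one_div_sqrt_one_sub_sq]
  refine intervalIntegral.integral_congr fun t _ => ?_
  simp [radicand]

theorem lowerT_injOn (hp : 1 < p) (hσ : σ ≠ 0) {S : Set ℝ} (hS : ∀ x ∈ S, σ * x < 1) :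
    InjOn (lowerT p σ) S := by
  intro x hx y hy hxy
  by_contra hne
  have hne' : σ * x ≠ σ * y := fun h => hne (mul_left_cancel₀ hσ h)
  rcases lt_or_gt_of_ne hne' with h | h
  · exact (lowerT_lt hp h (hS y hy)).ne hxy
  · exact (lowerT_lt hp h (hS x hx)).ne hxy.symm

end Period

/-! ### The eigenfunction on one side of the node. -/

section Piece

variable {p lam κ c a b : ℝ} {Q θ u : ℝ → ℝ} {k n : ℕ}

/-- Complete description of an eigenfunction on an interval between two zeros where the potential
is a multiple of a power of the eigenfunction. -/
theorem IsPrufer.exists_amplitude {q : ℝ → ℝ} (hp : 1 < p) (hq : IntervalIntegrable q volume 0 1)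
    (hP : IsPrufer (fun x => q x - lam) θ) (ha : 0 ≤ a) (hab : a < b) (hb : b ≤ 1)
    (hθa : θ a = k * Real.pi) (hθb : θ b = (k + n : ℕ) * Real.pi) (hc : c ≠ 0)
    (hu : ∀ x ∈ Icc a b, u x = c * (pruferRadius (fun x => q x - lam) θ x * Real.sin (θ x)))
    (hqu : ∀ᵐ x ∂(volume.restrict (Ioc a b)), q x = κ * |u x| ^ (2 * p.conjExponent - 2))
    (hκ : 0 ≤ κ ∨ 0 < lam) :
    ∃ h₀, 0 < h₀ ∧ IsGreatest ((fun x => |u x|) '' Icc a b) h₀ ∧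
      κ * (h₀ ^ (2 * p.conjExponent - 2) / lam) < 1 ∧ 0 < lam ∧
      (∃ z, IsTrajectory p.conjExponent κ lam a b u z ∧
        z a ^ 2 = energy p.conjExponent κ lam h₀) ∧
      ∀ F : ℝ → ℝ, Continuous F → ∫ x in a..b, F |u x| =
        2 * n / √lam * ∫ t in (0 : ℝ)..1, F (h₀ * t) /
          √(radicand p κ (h₀ ^ (2 * p.conjExponent - 2) / lam) t) := by
  have hr := one_lt_conjExponent hp
  set r := p.conjExponent with hrdef
  have hQ : IntervalIntegrable (fun x => q x - lam) volume 0 1 := hq.sub intervalIntegrable_const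
  set ρ := pruferRadius (fun x => q x - lam) θ with hρ
  set z : ℝ → ℝ := fun x => c * (ρ x * Real.cos (θ x)) with hz
  -- Once q is replaced almost everywhere by a continuous function of u, the derivatives of u, z and
  -- θ become classical ones.
  have hqu' : ∀ᵐ x, x ∈ Ioo a b → q x = κ * |u x| ^ (2 * r - 2) := by
    rw [ae_restrict_iff' measurableSet_Ioc] at hqu
    filter_upwards [hqu] with x hx hm
    exact hx (Ioo_subset_Ioc_self hm)
  have hud : HasAEDeriv u z a b :=
    (((hP.sin_hasAEDeriv hQ).mono ha hab.le hb).const_mul c).congr_fun hu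
  have hzd : HasAEDeriv z (fun x => κ * oddPow (2 * r) (u x) - lam * u x) a b := by
    refine (((hP.cos_hasAEDeriv hQ).mono ha hab.le hb).const_mul c).congr_deriv ?_
    filter_upwards [hqu'] with x hx hm
    have h1 := hu x (Ioo_subset_Icc_self hm)
    have h2 : c * ((q x - lam) * (ρ x * Real.sin (θ x))) = (q x - lam) * u x := by rw [h1]; ring
    rw [h2, hx hm, oddPow]
    ring
  have huc := hud.continuousOn
  have hθd : HasAEDeriv θ (fun x => 1 - (κ * |u x| ^ (2 * r - 2) - lam + 1) *
      Real.sin (θ x) ^ 2) a b := by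
    refine (hP.hasAEDeriv.mono ha hab.le hb).congr_deriv ?_
    filter_upwards [hqu'] with x hx hm
    rw [hx hm]
  have hθc := hθd.continuousOn
  have hup : ContinuousOn (fun x => |u x| ^ (2 * r - 2)) (Icc a b) :=
    huc.abs.rpow_const fun _ _ => Or.inr (by linarith)
  have hodd := (continuous_oddPow (p := 2 * r) (by linarith)).comp_continuousOn huc
  have htraj : IsTrajectory r κ lam a b u z :=
    ⟨fun x hx => hud.hasDerivWithinAt hzd.continuousOn hx,
      fun x hx => hzd.hasDerivWithinAt ((hodd.const_mul κ).sub (huc.const_mul lam)) hx⟩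
  have hua : u a = 0 := by
    rw [hu a (left_mem_Icc.2 hab.le), hθa, Real.sin_nat_mul_pi]; ring
  have hub : u b = 0 := by
    rw [hu b (right_mem_Icc.2 hab.le), hθb, Real.sin_nat_mul_pi]; ring
  have hza : z a ≠ 0 := by
    refine mul_ne_zero hc (mul_ne_zero (pruferRadius_pos _ _ _).ne' ?_)
    rw [hθa]
    intro h0
    have := Real.sin_sq_add_cos_sq (k * Real.pi)
    rw [h0, Real.sin_nat_mul_pi] at this
    norm_num at this
  obtain ⟨h₀, hpos, hgr, hlt, hlam, hen⟩ := htraj.exists_amplitude hr hab hua hub hza hκ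
  refine ⟨h₀, hpos, hgr, ?_, hlam, ⟨z, htraj, hen⟩, fun F hF => ?_⟩
  · rw [← mul_div_assoc, div_lt_one hlam]
    exact hlt
  · have hθd' : ∀ x ∈ Icc a b, HasDerivWithinAt θ
        (1 - (κ * |u x| ^ (2 * r - 2) - lam + 1) * Real.sin (θ x) ^ 2) (Icc a b) x := by
      intro x hx
      exact hθd.hasDerivWithinAt (by fun_prop) hx
    rw [htraj.integral_comp_abs hr hab hθd' (R := fun x => c * ρ x)
      (fun x hx => (hu x hx).trans (mul_assoc _ _ _).symm) (fun x _ => (mul_assoc _ _ _).symm)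
      (fun x _ => mul_ne_zero hc (pruferRadius_pos _ _ _).ne') hθa hθb
      (fun x hx => hgr.2 ⟨x, hx, rfl⟩) hlt hlam hen hF, integral_energy_eq hr hpos hlam,
      ← mul_assoc, ← div_eq_mul_inv]
    rfl

end Piece

/-! ### Sign and shape of the optimal potential. -/

section Profile

variable {p lam T : ℝ} {i m : ℕ} {θ : ℝ → ℝ}

theorem two_mul_conjExponent_sub_two (hp : 1 < p) : 2 * p.conjExponent - 2 = 2 * (p - 1)⁻¹ := by
  have : p - 1 ≠ 0 := by linarith
  rw [Real.conjExponent]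
  field_simp
  ring

/-- The right side is nonnegative, so x ≥ 0 and x = (ky²)^(1/(p-1)); the exponent 2/(p - 1) equals
2p* - 2. -/
theorem eq_rpow_of_oddPow_eq (hp : 1 < p) {x y k : ℝ} (hk : 0 ≤ k)
    (h : oddPow p x = k * y ^ 2) : x = |√k * y| ^ (2 * p.conjExponent - 2) := by
  have hv : 0 ≤ k * y ^ 2 := by positivity
  have hx : 0 ≤ x := by
    by_contra! hlt
    have : oddPow p x < 0 := mul_neg_of_pos_of_neg (Real.rpow_pos_of_pos (abs_pos.2 hlt.ne) _) hlt
    linarith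
  rw [oddPow_of_nonneg hp hx] at h
  have h1 : |√k * y| ^ (2 : ℝ) = k * y ^ 2 := by
    rw [Real.rpow_two, sq_abs, mul_pow, Real.sq_sqrt hk]
  rw [two_mul_conjExponent_sub_two hp, Real.rpow_mul (abs_nonneg _), h1, ← h,
    Real.rpow_rpow_inv hx (by linarith)]

theorem eq_neg_rpow_of_oddPow_eq (hp : 1 < p) {x y k : ℝ} (hk : k ≤ 0)
    (h : oddPow p x = k * y ^ 2) : x = -|√(-k) * y| ^ (2 * p.conjExponent - 2) := by
  rw [← eq_rpow_of_oddPow_eq hp (x := -x) (y := y) (neg_nonneg.2 hk) (by rw [oddPow_neg, h]; ring)]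
  ring

variable {q : ℝ → ℝ}

/-- The part of `[0,1]` to the left of the node. -/
theorem IsPrufer.left_piece (hp : 1 < p) (hq : IntervalIntegrable q volume 0 1)
    (hT : T ∈ Ioo (0 : ℝ) 1) (hP : IsPrufer (fun x => q x - lam) θ) (hθT : θ T = i * Real.pi)
    {κ c : ℝ} (hc : c ≠ 0) {u : ℝ → ℝ}
    (hu : ∀ x ∈ Icc 0 T, u x = c * (pruferRadius (fun x => q x - lam) θ x * Real.sin (θ x)))
    (hqu : ∀ᵐ x ∂(volume.restrict (Ioc 0 T)), q x = κ * |u x| ^ (2 * p.conjExponent - 2))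
    (hκ : 0 ≤ κ ∨ 0 < lam) :
    ∃ h₀, 0 < h₀ ∧ IsGreatest ((fun x => |u x|) '' Icc 0 T) h₀ ∧
      κ * (h₀ ^ (2 * p.conjExponent - 2) / lam) < 1 ∧ 0 < lam ∧
      (∃ z, IsTrajectory p.conjExponent κ lam 0 T u z ∧
        z 0 ^ 2 = energy p.conjExponent κ lam h₀) ∧
      ∀ F : ℝ → ℝ, Continuous F → ∫ x in (0 : ℝ)..T, F |u x| =
        2 * i / √lam * ∫ t in (0 : ℝ)..1, F (h₀ * t) /
          √(radicand p κ (h₀ ^ (2 * p.conjExponent - 2) / lam) t) :=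
  hP.exists_amplitude (k := 0) (n := i) hp hq le_rfl hT.1 hT.2.le (by simp [hP.zero])
    (by simpa using hθT) hc hu hqu hκ

/-- The part of `[0,1]` to the right of the node. -/
theorem IsPrufer.right_piece (hp : 1 < p) (hq : IntervalIntegrable q volume 0 1)
    (hT : T ∈ Ioo (0 : ℝ) 1) (him : i < m) (hP : IsPrufer (fun x => q x - lam) θ)
    (hθT : θ T = i * Real.pi) (hθ1 : θ 1 = m * Real.pi)
    {κ c : ℝ} (hc : c ≠ 0) {u : ℝ → ℝ}
    (hu : ∀ x ∈ Icc T 1, u x = c * (pruferRadius (fun x => q x - lam) θ x * Real.sin (θ x)))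
    (hqu : ∀ᵐ x ∂(volume.restrict (Ioc T 1)), q x = κ * |u x| ^ (2 * p.conjExponent - 2))
    (hκ : 0 ≤ κ ∨ 0 < lam) :
    ∃ h₀, 0 < h₀ ∧ IsGreatest ((fun x => |u x|) '' Icc T 1) h₀ ∧
      κ * (h₀ ^ (2 * p.conjExponent - 2) / lam) < 1 ∧ 0 < lam ∧
      (∃ z, IsTrajectory p.conjExponent κ lam T 1 u z ∧
        z T ^ 2 = energy p.conjExponent κ lam h₀) ∧
      ∀ F : ℝ → ℝ, Continuous F → ∫ x in T..1, F |u x| =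
        2 * ((m : ℝ) - i) / √lam * ∫ t in (0 : ℝ)..1, F (h₀ * t) /
          √(radicand p κ (h₀ ^ (2 * p.conjExponent - 2) / lam) t) := by
  have := hP.exists_amplitude (k := i) (n := m - i) hp hq hT.1.le hT.2 le_rfl hθT
    (by rw [Nat.add_sub_cancel' him.le]; exact hθ1) hc hu hqu hκ
  rwa [Nat.cast_sub him.le] at this

/-- The travel times determine the ordering of `T` and `i / m`. -/
theorem travel_times (hi : 1 ≤ i) (him : i < m) (hlam : 0 < lam) {t₁ t₂ : ℝ}
    (h₁ : T = 2 * i / √lam * t₁) (h₂ : 1 - T = 2 * ((m : ℝ) - i) / √lam * t₂) :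
    (t₁ = t₂ → T = i / m) ∧ (t₁ < t₂ → T < i / m) ∧ (t₂ < t₁ → i / m < T) := by
  have hs := Real.sqrt_pos.2 hlam
  have hi0 : (0 : ℝ) < i := by exact_mod_cast hi
  have hmi : (0 : ℝ) < (m : ℝ) - i := sub_pos.2 (by exact_mod_cast him)
  have hm0 : (0 : ℝ) < m := Nat.cast_pos.2 (by omega)
  -- Writing (T - i/m)m = T(m - i) - (1 - T)i gives both travel times the same positive factor.
  have key : (T - i / m) * m = 2 * i * (m - i) / √lam * (t₁ - t₂) := by
    have e : (T - i / m) * m = T * (m - i) - (1 - T) * i := by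
      field_simp
      ring
    rw [e, h₂]
    nth_rewrite 1 [h₁]
    ring
  have hc : 0 < 2 * i * ((m : ℝ) - i) / √lam := by positivity
  refine ⟨fun h => ?_, fun h => ?_, fun h => ?_⟩
  · rw [h, sub_self, mul_zero] at key
    exact sub_eq_zero.1 ((mul_eq_zero.1 key).resolve_right hm0.ne')
  · have := mul_neg_of_pos_of_neg hc (sub_neg.2 h)
    rw [← key] at this
    exact sub_neg.1 (neg_of_mul_neg_left this hm0.le)
  · have := mul_pos hc (sub_pos.2 h)
    rw [← key] at this
    exact sub_pos.1 (pos_of_mul_pos_left this hm0.le)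

theorem integral_one_div_eq_lowerT (p κ α : ℝ) :
    (∫ t in (0 : ℝ)..1, (fun _ : ℝ => (1 : ℝ)) t / √(radicand p κ α t)) = lowerT p κ α := rfl

/-- Qualitative form of the optimal potential. -/
theorem IsOptimal.exists_profile {q : Potential p} (hp : 1 < p) (hi : 1 ≤ i) (him : i < m)
    (hT : T ∈ Ioo (0 : ℝ) 1) (hTne : T ≠ (i : ℝ) / m) (h : IsOptimal p i m T 0 q) :
    ∃ lam θ σ A B, (σ = 1 ∨ σ = -1) ∧ nodeSign i m T = σ ∧ 0 < A ∧ 0 < B ∧ 0 < lam ∧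
      IsPrufer (fun x => q x - lam) θ ∧ θ T = i * Real.pi ∧ θ 1 = m * Real.pi ∧
      (∀ᵐ t ∂(volume.restrict (Ioc 0 T)), q t =
        σ * |A * (pruferRadius (fun x => q x - lam) θ t * Real.sin (θ t))| ^
          (2 * p.conjExponent - 2)) ∧
      (∀ᵐ t ∂(volume.restrict (Ioc T 1)), q t =
        -σ * |B * (pruferRadius (fun x => q x - lam) θ t * Real.sin (θ t))| ^
          (2 * p.conjExponent - 2)) ∧
      A ^ 2 * (∫ t in (0 : ℝ)..T, (pruferRadius (fun x => q x - lam) θ t * Real.sin (θ t)) ^ 2) =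
        B ^ 2 * (∫ t in T..1, (pruferRadius (fun x => q x - lam) θ t * Real.sin (θ t)) ^ 2) := by
  have hr := one_lt_conjExponent hp
  have hqi := Potential.intervalIntegrable hp q
  obtain ⟨lam, θ, k₁, k₂, hP, hθT, hθ1, hq1, hq2, hk⟩ :=
    h.exists_multiplier hp hi (hi.trans him.le) hT
  have hQ : IntervalIntegrable (fun x => q x - lam) volume 0 1 := hqi.sub intervalIntegrable_const
  have hI₁ := hP.integral_sin_sq_pos hQ le_rfl hT.1 hT.2.le
  have hI₂ := hP.integral_sin_sq_pos hQ hT.1.le hT.2 le_rfl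
  set y : ℝ → ℝ := fun t => pruferRadius (fun x => q x - lam) θ t * Real.sin (θ t) with hy
  set I₁ := ∫ t in (0 : ℝ)..T, y t ^ 2 with hI₁def
  set I₂ := ∫ t in T..1, y t ^ 2 with hI₂def
  have hone : Continuous fun _ : ℝ => (1 : ℝ) := continuous_const
  have hl1 : ∀ h₀ κ : ℝ, ∀ u : ℝ → ℝ, (∀ F : ℝ → ℝ, Continuous F → ∫ x in (0 : ℝ)..T, F |u x| =
        2 * i / √lam * ∫ t in (0 : ℝ)..1, F (h₀ * t) /
          √(radicand p κ (h₀ ^ (2 * p.conjExponent - 2) / lam) t)) →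
      T = 2 * i / √lam * lowerT p κ (h₀ ^ (2 * p.conjExponent - 2) / lam) := by
    intro h₀ κ u hF
    have := hF _ hone
    rwa [integral_one_div_eq_lowerT, intervalIntegral.integral_const, smul_eq_mul, mul_one,
      sub_zero] at this
  have hl2 : ∀ h₀ κ : ℝ, ∀ u : ℝ → ℝ, (∀ F : ℝ → ℝ, Continuous F → ∫ x in T..1, F |u x| =
        2 * ((m : ℝ) - i) / √lam * ∫ t in (0 : ℝ)..1, F (h₀ * t) /
          √(radicand p κ (h₀ ^ (2 * p.conjExponent - 2) / lam) t)) →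
      1 - T = 2 * ((m : ℝ) - i) / √lam * lowerT p κ (h₀ ^ (2 * p.conjExponent - 2) / lam) := by
    intro h₀ κ u hF
    have := hF _ hone
    rwa [integral_one_div_eq_lowerT, intervalIntegral.integral_const, smul_eq_mul, mul_one] at this
  rcases lt_trichotomy k₁ 0 with hk1 | hk1 | hk1
  · have hk2 : 0 < k₂ := by
      have : 0 < k₂ * I₂ := by nlinarith
      exact pos_of_mul_pos_left this hI₂.le
    have e1 : ∀ᵐ t ∂(volume.restrict (Ioc 0 T)),
        q t = -1 * |√(-k₁) * y t| ^ (2 * p.conjExponent - 2) := by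
      filter_upwards [hq1] with t ht
      rw [neg_one_mul]
      exact eq_neg_rpow_of_oddPow_eq hp hk1.le ht
    have e2 : ∀ᵐ t ∂(volume.restrict (Ioc T 1)),
        q t = 1 * |√k₂ * y t| ^ (2 * p.conjExponent - 2) := by
      filter_upwards [hq2] with t ht
      rw [one_mul]
      exact eq_rpow_of_oddPow_eq hp hk2.le ht
    have hA : 0 < √(-k₁) := Real.sqrt_pos.2 (neg_pos.2 hk1)
    have hB : 0 < √k₂ := Real.sqrt_pos.2 hk2
    -- The right piece is treated first: there κ = 1 and positivity of `lam` is a conclusion, which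
    -- the left piece with κ = -1 then needs as input.
    obtain ⟨b, hb, -, hb1, hlam, -, hF2⟩ := hP.right_piece hp hqi hT him hθT hθ1 hB.ne'
      (u := fun x => √k₂ * y x) (fun _ _ => rfl) e2 (Or.inl zero_le_one)
    obtain ⟨a, ha, -, ha1, -, -, hF1⟩ := hP.left_piece hp hqi hT hθT hA.ne'
      (u := fun x => √(-k₁) * y x) (fun _ _ => rfl) e1 (Or.inr hlam)
    have hα : 0 < a ^ (2 * p.conjExponent - 2) / lam := by positivity
    have hβ : 0 < b ^ (2 * p.conjExponent - 2) / lam := by positivity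
    -- The left piece has the negative product σa, hence the shorter travel time, which puts T below
    -- i/m and identifies the sign.
    have hlt := lowerT_lt hp (σ := -1) (σ' := 1) (a := a ^ (2 * p.conjExponent - 2) / lam)
      (a' := b ^ (2 * p.conjExponent - 2) / lam)
      (by rw [neg_one_mul, one_mul]; exact (neg_neg_of_pos hα).trans hβ) hb1
    have hT' := (travel_times hi him hlam (hl1 _ _ _ hF1) (hl2 _ _ _ hF2)).2.1 hlt
    refine ⟨lam, θ, -1, √(-k₁), √k₂, Or.inr rfl, if_pos hT', hA, hB, hlam, hP, hθT, hθ1, e1, ?_, ?_⟩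
    · rw [neg_neg]; exact e2
    · rw [Real.sq_sqrt (neg_nonneg.2 hk1.le), Real.sq_sqrt hk2.le]
      linarith
  -- With k₁ = 0 also k₂ = 0, so q = 0 and all quarter periods are equal; this gives T = i/m, which
  -- is excluded.
  · have hk2 : k₂ = 0 := by
      rw [hk1, zero_mul, zero_add] at hk
      exact (mul_eq_zero.1 hk).resolve_right hI₂.ne'
    have hz : ∀ x v : ℝ, oddPow p x = 0 * v ^ 2 →
        x = 0 * |v| ^ (2 * p.conjExponent - 2) := by
      intro x v hx
      rw [eq_rpow_of_oddPow_eq hp le_rfl hx, Real.sqrt_zero, zero_mul, zero_mul, abs_zero,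
        Real.zero_rpow (by linarith)]
    have e1 : ∀ᵐ t ∂(volume.restrict (Ioc 0 T)),
        q t = 0 * |1 * y t| ^ (2 * p.conjExponent - 2) := by
      filter_upwards [hq1] with t ht
      rw [one_mul]
      exact hz _ _ (by rw [ht, hk1])
    have e2 : ∀ᵐ t ∂(volume.restrict (Ioc T 1)),
        q t = 0 * |1 * y t| ^ (2 * p.conjExponent - 2) := by
      filter_upwards [hq2] with t ht
      rw [one_mul]
      exact hz _ _ (by rw [ht, hk2])
    obtain ⟨a, -, -, -, hlam, -, hF1⟩ := hP.left_piece hp hqi hT hθT one_ne_zero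
      (u := fun x => 1 * y x) (fun _ _ => rfl) e1 (Or.inl le_rfl)
    obtain ⟨b, -, -, -, -, -, hF2⟩ := hP.right_piece hp hqi hT him hθT hθ1 one_ne_zero
      (u := fun x => 1 * y x) (fun _ _ => rfl) e2 (Or.inl le_rfl)
    exact absurd ((travel_times hi him hlam (hl1 _ _ _ hF1) (hl2 _ _ _ hF2)).1
      (by rw [lowerT_zero, lowerT_zero])) hTne
  · have hk2 : k₂ < 0 := by
      have : k₂ * I₂ < 0 := by nlinarith
      exact neg_of_mul_neg_left this hI₂.le
    have e1 : ∀ᵐ t ∂(volume.restrict (Ioc 0 T)),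
        q t = 1 * |√k₁ * y t| ^ (2 * p.conjExponent - 2) := by
      filter_upwards [hq1] with t ht
      rw [one_mul]
      exact eq_rpow_of_oddPow_eq hp hk1.le ht
    have e2 : ∀ᵐ t ∂(volume.restrict (Ioc T 1)),
        q t = -1 * |√(-k₂) * y t| ^ (2 * p.conjExponent - 2) := by
      filter_upwards [hq2] with t ht
      rw [neg_one_mul]
      exact eq_neg_rpow_of_oddPow_eq hp hk2.le ht
    have hA : 0 < √k₁ := Real.sqrt_pos.2 hk1
    have hB : 0 < √(-k₂) := Real.sqrt_pos.2 (neg_pos.2 hk2)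
    obtain ⟨a, ha, -, ha1, hlam, -, hF1⟩ := hP.left_piece hp hqi hT hθT hA.ne'
      (u := fun x => √k₁ * y x) (fun _ _ => rfl) e1 (Or.inl zero_le_one)
    obtain ⟨b, hb, -, hb1, -, -, hF2⟩ := hP.right_piece hp hqi hT him hθT hθ1 hB.ne'
      (u := fun x => √(-k₂) * y x) (fun _ _ => rfl) e2 (Or.inr hlam)
    have hα : 0 < a ^ (2 * p.conjExponent - 2) / lam := by positivity
    have hβ : 0 < b ^ (2 * p.conjExponent - 2) / lam := by positivity
    have hlt := lowerT_lt hp (σ := -1) (σ' := 1) (a := b ^ (2 * p.conjExponent - 2) / lam)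
      (a' := a ^ (2 * p.conjExponent - 2) / lam)
      (by rw [neg_one_mul, one_mul]; exact (neg_neg_of_pos hβ).trans hα) ha1
    have hT' := (travel_times hi him hlam (hl1 _ _ _ hF1) (hl2 _ _ _ hF2)).2.2 hlt
    refine ⟨lam, θ, 1, √k₁, √(-k₂), Or.inl rfl, if_neg (not_lt.2 hT'.le), hA, hB, hlam, hP, hθT, hθ1,
      e1, e2, ?_⟩
    rw [Real.sq_sqrt hk1.le, Real.sq_sqrt (neg_nonneg.2 hk2.le)]
    linarith

end Profile

/-! ### Exact formulas, and determination by the parameters. -/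

section Final

variable {p lam T h₀ : ℝ} {i m : ℕ}

theorem rpow_two_mul_conjExponent (hp : 1 < p) (x : ℝ) :
    (|x| ^ (2 * p.conjExponent - 2)) ^ p = |x| ^ (2 * p.conjExponent) := by
  rw [← Real.rpow_mul (abs_nonneg x)]
  congr 1
  have : p - 1 ≠ 0 := by linarith
  rw [Real.conjExponent]
  field_simp
  ring

/-- Because (2p* - 2)(p - 1) = 2. This is the source of the factor α^(p-1) in V. -/
theorem sq_eq_rpow (hp : 1 < p) (hlam : 0 < lam) (hh : 0 < h₀) :
    h₀ ^ 2 = lam ^ (p - 1) * (h₀ ^ (2 * p.conjExponent - 2) / lam) ^ (p - 1) := by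
  have hpos : 0 < h₀ ^ (2 * p.conjExponent - 2) := Real.rpow_pos_of_pos hh _
  rw [← Real.mul_rpow hlam.le (by positivity), mul_div_cancel₀ _ hlam.ne',
    ← Real.rpow_mul hh.le, two_mul_conjExponent_sub_two hp, mul_assoc,
    inv_mul_cancel₀ (by linarith), mul_one, Real.rpow_two]

theorem rpow_eq_rpow (hp : 1 < p) (hlam : 0 < lam) (hh : 0 < h₀) :
    h₀ ^ (2 * p.conjExponent) =
      (lam * (h₀ ^ (2 * p.conjExponent - 2) / lam)) ^ ((p - 1) * p.conjExponent) := by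
  rw [mul_div_cancel₀ _ hlam.ne', ← Real.rpow_mul hh.le, two_mul_conjExponent_sub_two hp]
  congr 1
  have : p - 1 ≠ 0 := by linarith
  field_simp

/-- The three integrals over a nodal piece: length, square norm and power norm. -/
theorem piece_integrals {a b κ N : ℝ} {u : ℝ → ℝ} (hp : 1 < p) (hlam : 0 < lam) (hh : 0 < h₀)
    (hF : ∀ F : ℝ → ℝ, Continuous F → ∫ x in a..b, F |u x| =
        N / √lam * ∫ t in (0 : ℝ)..1, F (h₀ * t) /
          √(radicand p κ (h₀ ^ (2 * p.conjExponent - 2) / lam) t)) :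
    b - a = N / √lam * lowerT p κ (h₀ ^ (2 * p.conjExponent - 2) / lam) ∧
    ∫ x in a..b, u x ^ 2 = N / √lam * (lam ^ (p - 1) *
      lowerV p κ (h₀ ^ (2 * p.conjExponent - 2) / lam)) ∧
    ∫ x in a..b, |u x| ^ (2 * p.conjExponent) =
      N * (lam * (h₀ ^ (2 * p.conjExponent - 2) / lam)) ^ ((p - 1) * p.conjExponent) / √lam *
        lowerU p κ (h₀ ^ (2 * p.conjExponent - 2) / lam) := by
  have hr := one_lt_conjExponent hp
  refine ⟨?_, ?_, ?_⟩
  · have := hF (fun _ => 1) continuous_const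
    rwa [intervalIntegral.integral_const, smul_eq_mul, mul_one] at this
  · have := hF (fun s => s ^ 2) (continuous_pow 2)
    simp only [sq_abs] at this
    rw [this, lowerV, ← mul_assoc (lam ^ (p - 1)), ← sq_eq_rpow hp hlam hh]
    congr 1
    rw [← intervalIntegral.integral_const_mul]
    refine intervalIntegral.integral_congr fun t _ => ?_
    ring
  · have hc : Continuous fun s : ℝ => |s| ^ (2 * p.conjExponent) :=
      continuous_abs.rpow_const fun _ => Or.inr (by linarith)
    have := hF _ hc
    simp only [abs_abs] at this
    rw [this, lowerU, ← rpow_eq_rpow hp hlam hh, mul_div_right_comm, mul_assoc (N / √lam)]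
    congr 1
    rw [← intervalIntegral.integral_const_mul]
    refine intervalIntegral.integral_congr fun t ht => ?_
    rw [uIcc_of_le zero_le_one] at ht
    rw [abs_mul, abs_of_pos hh, abs_of_nonneg ht.1, Real.mul_rpow hh.le ht.1]
    ring

theorem invFunOn_eq_of_injOn {f : ℝ → ℝ} {S : Set ℝ} (hf : InjOn f S) {x y : ℝ} (hx : x ∈ S)
    (hy : y = f x) : y ∈ f '' S ∧ x = Function.invFunOn f S y := by
  subst hy
  exact ⟨⟨x, hx, rfl⟩, (hf.leftInvOn_invFunOn hx).symm⟩

/-- Two trajectories of the same energy starting at zero agree up to sign. -/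
theorem IsTrajectory.abs_eq_of_energy {r κ a b : ℝ} {u₁ z₁ u₂ z₂ : ℝ → ℝ} (hr : 1 < r) (hab : a ≤ b)
    (h₁ : IsTrajectory r κ lam a b u₁ z₁) (h₂ : IsTrajectory r κ lam a b u₂ z₂) (hu₁ : u₁ a = 0)
    (hu₂ : u₂ a = 0) (hz : z₁ a ^ 2 = z₂ a ^ 2) {x : ℝ} (hx : x ∈ Icc a b) : |u₁ x| = |u₂ x| := by
  rcases sq_eq_sq_iff_eq_or_eq_neg.1 hz with h | h
  · rw [h₁.eq_of_eq hr hab h₂ (hu₁.trans hu₂.symm) h hx]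
  · rw [h₁.eq_of_eq hr hab h₂.neg (by simp [hu₁, hu₂]) h hx, abs_neg]

theorem sqrt_mul_div_eq {L N t : ℝ} (hlam : 0 < lam) (hN : 0 < N) (h : L = 2 * N / √lam * t) :
    √lam * L / (2 * N) = t := by
  have := Real.sqrt_pos.2 hlam
  rw [h]
  field_simp

theorem ae_restrict_Icc_of_pieces {P : ℝ → Prop} (hT : T ∈ Ioo (0 : ℝ) 1)
    (h₁ : ∀ᵐ x ∂(volume.restrict (Ioc 0 T)), P x) (h₂ : ∀ᵐ x ∂(volume.restrict (Ioc T 1)), P x) :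
    ∀ᵐ x ∂(volume.restrict (Icc (0 : ℝ) 1)), P x := by
  rw [← restrict_Ioc_eq_restrict_Icc, ← Ioc_union_Ioc_eq_Ioc hT.1.le hT.2.le, ae_restrict_union_iff]
  exact ⟨h₁, h₂⟩

theorem ae_pieces_of_ae_restrict_Icc {P : ℝ → Prop} (hT : T ∈ Ioo (0 : ℝ) 1)
    (h : ∀ᵐ x ∂(volume.restrict (Icc (0 : ℝ) 1)), P x) :
    (∀ᵐ x ∂(volume.restrict (Ioc 0 T)), P x) ∧ ∀ᵐ x ∂(volume.restrict (Ioc T 1)), P x := by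
  rwa [← restrict_Ioc_eq_restrict_Icc, ← Ioc_union_Ioc_eq_Ioc hT.1.le hT.2.le,
    ae_restrict_union_iff] at h

/-- A potential with a characteristic triple, in terms of trajectories. -/
theorem IsCharacteristicTriple.exists_trajectories {r : Potential p} {α β : ℝ} (hp : 1 < p)
    (hi : 1 ≤ i) (him : i < m) (hT : T ∈ Ioo (0 : ℝ) 1) (hlam : 0 < lam)
    (hnode : IsNode i m r T) (h : IsCharacteristicTriple p i m T r α β lam) :
    ∃ (u v z w : ℝ → ℝ) (h₀ k₀ : ℝ), 0 < h₀ ∧ 0 < k₀ ∧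
      α = h₀ ^ (2 * p.conjExponent - 2) / lam ∧ β = k₀ ^ (2 * p.conjExponent - 2) / lam ∧
      IsTrajectory p.conjExponent (nodeSign i m T) lam 0 T u z ∧
      IsTrajectory p.conjExponent (-nodeSign i m T) lam T 1 v w ∧ u 0 = 0 ∧ v T = 0 ∧
      z 0 ^ 2 = energy p.conjExponent (nodeSign i m T) lam h₀ ∧
      w T ^ 2 = energy p.conjExponent (-nodeSign i m T) lam k₀ ∧
      (∀ᵐ x ∂(volume.restrict (Ioc 0 T)),
        r x = nodeSign i m T * |u x| ^ (2 * p.conjExponent - 2)) ∧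
      (∀ᵐ x ∂(volume.restrict (Ioc T 1)),
        r x = -nodeSign i m T * |v x| ^ (2 * p.conjExponent - 2)) := by
  obtain ⟨hn, E, u, A, B, h₀, k₀, hE, hA, hB, huA, huB, hae, hh, hk, hα, hβ⟩ := h
  have hri := Potential.intervalIntegrable hp r
  have hQ : IntervalIntegrable (fun x => r x - lam) volume 0 1 := hri.sub intervalIntegrable_const
  -- The node provides an angle for some spectral value; both that value and `lam` are the m-th
  -- eigenvalue, so they coincide.
  obtain ⟨mu, θ, hP, hθT, hθ1⟩ := (isNode_iff hri hi (hi.trans him.le) hT).1 hnode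
  obtain rfl : mu = lam :=
    IsNthEigenvalue.unique hri ((isNthEigenvalue_iff hri hP).2 ⟨hi.trans him.le, hθ1⟩) hn
  obtain ⟨C, hC, hEC⟩ := hE.eq_const_mul hri hP
  have hET : E T = 0 := by
    rw [hEC T (Ioo_subset_Icc_self hT), hθT, Real.sin_nat_mul_pi]; ring
  have huT : u T = 0 := by rw [huA T (right_mem_Icc.2 hT.1.le), hET, mul_zero]
  have huB' : ∀ x ∈ Icc T 1, u x = B * E x := by
    intro x hx
    rcases hx.1.eq_or_lt with rfl | hlt
    · rw [huT, hET, mul_zero]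
    · exact huB x ⟨hlt, hx.2⟩
  obtain ⟨hae1, hae2⟩ := ae_pieces_of_ae_restrict_Icc hT hae
  have hae1' : ∀ᵐ x ∂(volume.restrict (Ioc 0 T)),
      r x = nodeSign i m T * |u x| ^ (2 * p.conjExponent - 2) := by
    rw [ae_restrict_iff' measurableSet_Ioc] at hae1 ⊢
    filter_upwards [hae1] with x hx hm
    rw [hx hm, if_pos hm.2]
  have hae2' : ∀ᵐ x ∂(volume.restrict (Ioc T 1)),
      r x = -nodeSign i m T * |u x| ^ (2 * p.conjExponent - 2) := by
    rw [ae_restrict_iff' measurableSet_Ioc] at hae2 ⊢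
    filter_upwards [hae2] with x hx hm
    rw [hx hm, if_neg (not_le.2 hm.1)]
  obtain ⟨h₁, hpos₁, hgr₁, -, -, ⟨z, hz, hze⟩, -⟩ := hP.left_piece hp hri hT hθT
    (mul_ne_zero hA.ne' hC) (u := u) (fun x hx => by
      rw [huA x hx, hEC x ⟨hx.1, hx.2.trans hT.2.le⟩]; ring) hae1' (Or.inr hlam)
  obtain ⟨k₁, hpos₂, hgr₂, -, -, ⟨w, hw, hwe⟩, -⟩ := hP.right_piece hp hri hT him hθT hθ1
    (mul_ne_zero hB.ne' hC) (u := u) (fun x hx => by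
      rw [huB' x hx, hEC x ⟨hT.1.le.trans hx.1, hx.2⟩]; ring) hae2' (Or.inr hlam)
  obtain rfl := hgr₁.unique hh
  obtain rfl := hgr₂.unique hk
  refine ⟨u, u, z, w, h₁, k₁, hpos₁, hpos₂, hα, hβ, hz, hw, ?_, huT, hze, hwe, hae1', hae2'⟩
  rw [huA 0 (left_mem_Icc.2 hT.1.le), hE.2.1, mul_zero]

/-- The characteristic parameters determine the potential. -/
theorem IsCharacteristicTriple.unique {q r : Potential p} {α β : ℝ} (hp : 1 < p)
    (hi : 1 ≤ i) (him : i < m) (hT : T ∈ Ioo (0 : ℝ) 1) (hlam : 0 < lam)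
    (hnq : IsNode i m q T) (hnr : IsNode i m r T)
    (hq : IsCharacteristicTriple p i m T q α β lam)
    (hr : IsCharacteristicTriple p i m T r α β lam) : r = q := by
  have hr1 := one_lt_conjExponent hp
  obtain ⟨u, v, z, w, h₀, k₀, hh, hk, hα, hβ, hu, hv, hu0, hvT, hz, hw, hq1, hq2⟩ :=
    hq.exists_trajectories hp hi him hT hlam hnq
  obtain ⟨u', v', z', w', h₀', k₀', hh', hk', hα', hβ', hu', hv', hu0', hvT', hz', hw', hr1', hr2'⟩ :=
    hr.exists_trajectories hp hi him hT hlam hnr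
  -- With `lam` shared and a positive exponent, equal parameters mean equal amplitudes, hence equal
  -- energies.
  have hinj : ∀ s t : ℝ, 0 < s → 0 < t →
      s ^ (2 * p.conjExponent - 2) / lam = t ^ (2 * p.conjExponent - 2) / lam → s = t := by
    intro s t hs ht h
    have hne : 2 * p.conjExponent - 2 ≠ 0 := by linarith
    exact (Real.rpow_left_inj hs.le ht.le hne).1 ((div_left_inj' hlam.ne').1 h)
  obtain rfl := hinj h₀ h₀' hh hh' (hα.symm.trans hα')
  obtain rfl := hinj k₀ k₀' hk hk' (hβ.symm.trans hβ')
  refine Lp.ext (ae_restrict_Icc_of_pieces hT ?_ ?_)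
  · rw [ae_restrict_iff' measurableSet_Ioc] at hq1 hr1' ⊢
    filter_upwards [hq1, hr1'] with x h1 h2 hm
    rw [h1 hm, h2 hm, hu.abs_eq_of_energy hr1 hT.1.le hu' hu0 hu0' (hz.trans hz'.symm)
      (Ioc_subset_Icc_self hm)]
  · rw [ae_restrict_iff' measurableSet_Ioc] at hq2 hr2' ⊢
    filter_upwards [hq2, hr2'] with x h1 h2 hm
    rw [h1 hm, h2 hm, hv.abs_eq_of_energy hr1 hT.2.le hv' hvT hvT' (hw.trans hw'.symm)
      (Ioc_subset_Icc_self hm)]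

end Final

end InverseNodal

end

theorem mainTheorem4 (p : ℝ) (hp : 1 < p) (i m : ℕ) (hi : 1 ≤ i) (him : i < m)
    (T : ℝ) (hT0 : 0 < T) (hT1 : T < 1) (hTne : T ≠ (i : ℝ) / m)
    (ε : ℝ) (hε : ε = nodeSign i m T)
    (q : Potential p) (hq : IsOptimal p i m T 0 q) :
    -- the integrals converge, and `T̲_p`, `T̄_p` are invertible on their domains
    (∀ α ∈ lowerDomain ε,
      IntervalIntegrable (fun t => 1 / √(radicand p ε α t)) MeasureTheory.volume 0 1) ∧
    (∀ β ∈ upperDomain ε,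
      IntervalIntegrable (fun t => 1 / √(radicand p (-ε) β t)) MeasureTheory.volume 0 1) ∧
    Set.InjOn (lowerT p ε) (lowerDomain ε) ∧
    Set.InjOn (upperT p ε) (upperDomain ε) ∧
    ∃ α β lam : ℝ,
      IsCharacteristicTriple p i m T q α β lam ∧
      0 < lam ∧ α ∈ lowerDomain ε ∧ β ∈ upperDomain ε ∧
      -- the system of three equations
      √lam * T / (2 * i) ∈ lowerT p ε '' lowerDomain ε ∧
      α = lowerTInv p ε (√lam * T / (2 * i)) ∧
      √lam * (1 - T) / (2 * ((m : ℝ) - i)) ∈ upperT p ε '' upperDomain ε ∧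
      β = upperTInv p ε (√lam * (1 - T) / (2 * ((m : ℝ) - i))) ∧
      (i : ℝ) * lowerV p ε α = ((m : ℝ) - i) * upperV p ε β ∧
      -- the norm of the optimal potential
      ‖q‖ ^ p =
        2 * i * (lam * α) ^ ((p - 1) * p.conjExponent) / √lam * lowerU p ε α +
        2 * ((m : ℝ) - i) * (lam * β) ^ ((p - 1) * p.conjExponent) / √lam * upperU p ε β ∧
      -- the three parameters determine the optimal potential
      ∀ r : Potential p, IsOptimal p i m T 0 r → IsCharacteristicTriple p i m T r α β lam → r = q
    := by
  have hT : T ∈ Ioo (0 : ℝ) 1 := ⟨hT0, hT1⟩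
  have hr := one_lt_conjExponent hp
  have hi0 : (0 : ℝ) < i := by exact_mod_cast hi
  have hmi : (0 : ℝ) < (m : ℝ) - i := sub_pos.2 (by exact_mod_cast him)
  obtain ⟨lam, θ, σ, A, B, hσ, hns, hA, hB, hlam, hP, hθT, hθ1, hq1, hq2, hAB⟩ :=
    hq.exists_profile hp hi him hT hTne
  obtain rfl : ε = σ := hε.trans hns
  have hε0 : ε ≠ 0 := by rcases hσ with rfl | rfl <;> norm_num
  -- For positive α, membership in the domain amounts to εα < 1: a genuine bound for ε = 1,
  -- automatic for ε = -1. The same holds for β with -ε.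
  have hlow : ∀ α ∈ lowerDomain ε, ε * α < 1 := by
    rintro α ⟨h0, h1⟩
    rcases hσ with rfl | rfl
    · linarith [h1 rfl]
    · linarith
  have hupp : ∀ β ∈ upperDomain ε, -ε * β < 1 := by
    rintro β ⟨h0, h1⟩
    rcases hσ with rfl | rfl
    · linarith
    · linarith [h1 rfl]
  have hlow' : ∀ α, 0 < α → ε * α < 1 → α ∈ lowerDomain ε := by
    refine fun α h0 h1 => ⟨h0, fun h => ?_⟩
    rw [h] at h1
    linarith
  have hupp' : ∀ β, 0 < β → -ε * β < 1 → β ∈ upperDomain ε := by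
    refine fun β h0 h1 => ⟨h0, fun h => ?_⟩
    rw [h] at h1
    linarith
  have hinj₁ : InjOn (lowerT p ε) (lowerDomain ε) := lowerT_injOn hp hε0 hlow
  -- By definition `upperT p ε` is `lowerT p (-ε)`, so one injectivity result serves both.
  have hinj₂ : InjOn (upperT p ε) (upperDomain ε) := lowerT_injOn hp (neg_ne_zero.2 hε0) hupp
  refine ⟨fun α hα => intervalIntegrable_one_div_sqrt_radicand hp (hlow α hα),
    fun β hβ => intervalIntegrable_one_div_sqrt_radicand hp (hupp β hβ), hinj₁, hinj₂, ?_⟩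
  have hqi := Potential.intervalIntegrable hp q
  have hQ : IntervalIntegrable (fun x => q x - lam) volume 0 1 := hqi.sub intervalIntegrable_const
  have hE := hP.isEigenfunction hqi (by rw [hθ1]; exact Real.sin_nat_mul_pi m)
  have hyc := (hP.sin_hasAEDeriv hQ).continuousOn
  set y : ℝ → ℝ := fun t => pruferRadius (fun x => q x - lam) θ t * Real.sin (θ t) with hy
  have hyT : y T = 0 := by simp [hy, hθT]
  set u : ℝ → ℝ := fun x => if x ≤ T then A * y x else B * y x with hu
  have hu1 : ∀ x ∈ Icc 0 T, u x = A * y x := fun x hx => if_pos hx.2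
  have hu2' : ∀ x ∈ Ioc T 1, u x = B * y x := fun x hx => if_neg (not_le.2 hx.1)
  -- At T both rescalings vanish, so the right-hand formula extends to the closed interval.
  have hu2 : ∀ x ∈ Icc T 1, u x = B * y x := by
    intro x hx
    rcases hx.1.eq_or_lt with rfl | hlt
    · rw [hu1 T (right_mem_Icc.2 hT0.le), hyT, mul_zero, mul_zero]
    · exact hu2' x ⟨hlt, hx.2⟩
  have hqu1 : ∀ᵐ x ∂(volume.restrict (Ioc 0 T)),
      q x = ε * |u x| ^ (2 * p.conjExponent - 2) := by
    rw [ae_restrict_iff' measurableSet_Ioc] at hq1 ⊢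
    filter_upwards [hq1] with x hx hm
    rw [hx hm, hu1 x (Ioc_subset_Icc_self hm)]
  have hqu2 : ∀ᵐ x ∂(volume.restrict (Ioc T 1)),
      q x = -ε * |u x| ^ (2 * p.conjExponent - 2) := by
    rw [ae_restrict_iff' measurableSet_Ioc] at hq2 ⊢
    filter_upwards [hq2] with x hx hm
    rw [hx hm, hu2' x hm]
  obtain ⟨h₀, hh, hgr₁, hα1, -, -, hF₁⟩ :=
    hP.left_piece hp hqi hT hθT hA.ne' hu1 hqu1 (Or.inr hlam)
  obtain ⟨k₀, hk, hgr₂, hβ1, -, -, hF₂⟩ :=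
    hP.right_piece hp hqi hT him hθT hθ1 hB.ne' hu2 hqu2 (Or.inr hlam)
  obtain ⟨hl₁, hV₁, hU₁⟩ := piece_integrals hp hlam hh hF₁
  obtain ⟨hl₂, hV₂, hU₂⟩ := piece_integrals hp hlam hk hF₂
  rw [sub_zero] at hl₁
  have hαpos : 0 < h₀ ^ (2 * p.conjExponent - 2) / lam := by positivity
  have hβpos : 0 < k₀ ^ (2 * p.conjExponent - 2) / lam := by positivity
  set α := h₀ ^ (2 * p.conjExponent - 2) / lam with hα
  set β := k₀ ^ (2 * p.conjExponent - 2) / lam with hβ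
  have hαd := hlow' α hαpos hα1
  have hβd := hupp' β hβpos hβ1
  obtain ⟨hm₁, hi₁⟩ := invFunOn_eq_of_injOn hinj₁ hαd (sqrt_mul_div_eq hlam hi0 hl₁)
  obtain ⟨hm₂, hi₂⟩ := invFunOn_eq_of_injOn hinj₂ hβd (sqrt_mul_div_eq hlam hmi hl₂)
  have hqu : ∀ᵐ x ∂(volume.restrict (Icc (0 : ℝ) 1)), q x =
      (if x ≤ T then ε else -ε) * |u x| ^ (2 * p.conjExponent - 2) := by
    refine ae_restrict_Icc_of_pieces hT ?_ ?_
    · rw [ae_restrict_iff' measurableSet_Ioc] at hqu1 ⊢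
      filter_upwards [hqu1] with x hx hm
      rw [hx hm, if_pos hm.2]
    · rw [ae_restrict_iff' measurableSet_Ioc] at hqu2 ⊢
      filter_upwards [hqu2] with x hx hm
      rw [hx hm, if_neg (not_le.2 hm.1)]
  have htriple : IsCharacteristicTriple p i m T q α β lam :=
    ⟨(isNthEigenvalue_iff hqi hP).2 ⟨hi.trans him.le, hθ1⟩, y, u, A, B, h₀, k₀, hE, hA, hB, hu1,
      hu2', by rwa [hns], hgr₁, hgr₂, rfl, rfl⟩
  refine ⟨α, β, lam, htriple, hlam, hαd, hβd, hm₁, hi₁, hm₂, hi₂, ?_, ?_, fun r hro hrt =>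
    htriple.unique hp hi him hT hlam hq.1 hro.1 hrt⟩
  · have e1 : ∫ x in (0 : ℝ)..T, u x ^ 2 = A ^ 2 * ∫ x in (0 : ℝ)..T, y x ^ 2 := by
      rw [← intervalIntegral.integral_const_mul]
      refine intervalIntegral.integral_congr fun x hx => ?_
      rw [uIcc_of_le hT0.le] at hx
      simp only [hu1 x hx, mul_pow]
    have e2 : ∫ x in T..1, u x ^ 2 = B ^ 2 * ∫ x in T..1, y x ^ 2 := by
      rw [← intervalIntegral.integral_const_mul]
      refine intervalIntegral.integral_congr fun x hx => ?_
      rw [uIcc_of_le hT1.le] at hx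
      simp only [hu2 x hx, mul_pow]
    -- The equality of ∫ u² on the two sides of T, which is the vanishing mean of the odd power,
    -- becomes the third equation after removal of the common factor 2`lam`^(p-1)/√`lam`.
    have e3 := hV₁.symm.trans (e1.trans (hAB.trans (e2.symm.trans hV₂)))
    have hc : 0 < 2 / √lam * lam ^ (p - 1) := by
      have := Real.sqrt_pos.2 hlam
      positivity
    refine mul_left_cancel₀ hc.ne' ?_
    rw [upperV]
    rw [lowerV, lowerV] at e3
    rw [lowerV]
    linear_combination e3
  · rw [Potential.norm_rpow hp]
    -- The sign drops out, and (2p* - 2)p = 2p*.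
    have e1 : ∫ x in Icc (0 : ℝ) 1, |q x| ^ p =
        ∫ x in Icc (0 : ℝ) 1, |u x| ^ (2 * p.conjExponent) := by
      refine integral_congr_ae ?_
      filter_upwards [hqu] with x hx
      rw [hx, abs_mul, abs_of_nonneg (Real.rpow_nonneg (abs_nonneg (u x)) _)]
      have : |if x ≤ T then ε else -ε| = 1 := by
        rcases hσ with rfl | rfl <;> split_ifs <;> norm_num
      rw [this, one_mul, rpow_two_mul_conjExponent hp]
    have hcont : ∀ c : ℝ, ContinuousOn (fun x => |c * y x| ^ (2 * p.conjExponent)) (Icc 0 1) :=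
      fun c => (hyc.const_mul c).abs.rpow_const fun _ _ => Or.inr (by linarith)
    have hi1 : IntervalIntegrable (fun x => |u x| ^ (2 * p.conjExponent)) volume 0 T := by
      refine (ContinuousOn.congr ((hcont A).mono (Icc_subset_Icc_right hT1.le))
        fun x hx => ?_).intervalIntegrable_of_Icc hT0.le
      simp only [hu1 x hx]
    have hi2 : IntervalIntegrable (fun x => |u x| ^ (2 * p.conjExponent)) volume T 1 := by
      refine (ContinuousOn.congr ((hcont B).mono (Icc_subset_Icc_left hT0.le))
        fun x hx => ?_).intervalIntegrable_of_Icc hT1.le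
      simp only [hu2 x hx]
    rw [e1, integral_Icc_eq_integral_Ioc, ← intervalIntegral.integral_of_le zero_le_one,
      ← intervalIntegral.integral_add_adjacent_intervals hi1 hi2, hU₁, hU₂]
    rfl
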